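/- **Setting.** Let $\mathcal Z,\mathcal V$ be separable real Hilbert spaces and $\mathcal X$ a real Banach space, with $\mathcal Z$ densely and compactly embedded in $\mathcal V$ and $\mathcal V$ continuously embedded in $\mathcal X$. Let $A\in\mathrm{Lin}(\mathcal Z,\mathcal Z^*)$ and $\mathbb V\in\mathrm{Lin}(\mathcal V,\mathcal V^*)$ be bounded, symmetric and elliptic: $\langle Az,z\rangle\ge\alpha\|z\|_{\mathcal Z}^2$ and $\langle\mathbb Vv,v\rangle\ge\gamma\|v\|_{\mathcal V}^2$ for some $\alpha,\gamma>0$. Let $\mathcal F\in C^2(\mathcal Z;\mathbb R)$, $\mathcal F\ge0$, be such that $\mathrm D\mathcal F\in C^1(\mathcal Z;\mathcal V^*)$ with $\|\mathrm D^2\mathcal F(z)v\|_{\mathcal V^*}\le C(1+\|z\|_{\mathcal Z}^q)\|v\|_{\mathcal Z}$ for some $C$ and some $q\ge1$, and such that $\mathcal F:\mathcal Z\to\mathbb R$ and $\mathrm D\mathcal F:\mathcal Z\to\mathcal Z^*$ are (sequentially) weak-weak continuous. Put $\mathcal I(z)=\frac12\langle Az,z\rangle+\mathcal F(z)$. Let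 $\mathcal R:\mathcal X\to[0,\infty)$ be convex, continuous and positively homogeneous of degree one, with $c\|x\|_{\mathcal X}\le\mathcal R(x)\le C\|x\|_{\mathcal X}$ for some $c,C>0$. For $v\in\mathcal V$ let $\partial\mathcal R(v)\subset\mathcal V^*$ be the convex subdifferential at $v$ of $\mathcal R$ restricted to $\mathcal V$, and for $\xi\in\mathcal V^*$ let $$\operatorname{dist}_{\mathbb V}(\xi,\partial\mathcal R(0))=\inf\{\langle\xi-\sigma,\mathbb V^{-1}(\xi-\sigma)\rangle^{1/2}:\sigma\in\partial\mathcal R(0)\}.$$ Via the embedding $\mathcal V^*\subset\mathcal Z^*$, for $\ell_*\in\mathcal V^*$ consider, as an identity in $\mathcal Z^*$, $$0\in\partial\mathcal R(\dot z(t))+\mathbb V\dot z(t)+\mathrm D\mathcal I(z(t))-\ell_*,\qquad t>0.\tag{$*$}$$ Functions $z\in L^\infty(\mathbb R_+;\mathcal Z)$ with $\dot z\in L^1((0,a);\mathcal V)$ for all $a>0$ are identified with their representative $[0,\infty)\to\mathcal Z$ that is continuous with values in $\mathcal V$; $\operatorname{Var}_{\mathcal Z}$ is the total variation with respect to $\|\cdot\|_{\mathcal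 Z}$. **Theorem.** 1. *Uniqueness.* For every $\ell_*\in\mathcal V^*$ and $z_0\in\mathcal Z$ there is at most one function $z\in L^\infty(\mathbb R_+;\mathcal Z)$ with $\dot z\in L^1((0,a);\mathcal V)$ for every $a>0$ that satisfies $z(0)=z_0$ and $(*)$ for almost all $t>0$. 2. *Existence and regularity.* For every $\ell_*\in\mathcal V^*$ and $z_0\in\mathcal Z$ with $\mathrm D\mathcal I(z_0)\in\mathcal V^*$ there is a unique function $z\in L^\infty(\mathbb R_+;\mathcal Z)$ with $\dot z\in L^2(\mathbb R_+;\mathcal V)$ that satisfies $z(0)=z_0$ and $(*)$ for almost all $t>0$. Moreover $z\in W^{1,\infty}(\mathbb R_+;\mathcal V)$, $\operatorname{Var}_{\mathcal Z}(z;[0,\infty))<\infty$ and $\mathrm D\mathcal I(z(\cdot))\in L^\infty(\mathbb R_+;\mathcal V^*)$. 3. *Uniform estimates.* There are functions $m_1,m_2:\mathcal Z\times\mathcal V^*\to[0,\infty)$ mapping bounded sets to bounded sets such that for all $\ell_*\in\mathcal V^*$ and all $z_0\in\mathcal Z$ with $\mathrm D\mathcal I(z_0)\in\mathcal V^*$ the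 solution $z$ for $(z_0,\ell_*)$ satisfies $$\|z\|_{L^\infty(\mathbb R_+;\mathcal Z)}\le m_1(z_0,\ell_*),$$ $$\|\dot z\|_{L^\infty(\mathbb R_+;\mathcal V)}+\operatorname{Var}_{\mathcal Z}(z;[0,\infty))\le m_2(z_0,\ell_*)\big(\operatorname{dist}_{\mathbb V}(-\mathrm D\mathcal I(z_0)+\ell_*,\partial\mathcal R(0))+m_1(z_0,\ell_*)\big),$$ $$\|\mathrm D\mathcal I(z(\cdot))\|_{L^\infty(\mathbb R_+;\mathcal V^*)}\le\operatorname{diam}_{\mathcal V^*}(\partial\mathcal R(0))+\|\ell_*\|_{\mathcal V^*}+c_{\mathbb V}\|\dot z\|_{L^\infty(\mathbb R_+;\mathcal V)},$$ where $c_{\mathbb V}=\|\mathbb V\|_{\mathrm{Lin}(\mathcal V,\mathcal V^*)}$. -/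

import Mathlib

open MeasureTheory Set Filter Topology
open scoped ENNReal

/-- Data of the semilinear system together with its standing assumptions:
separable Hilbert spaces `Z`, `V` and a Banach space `X` with a dense compact embedding
`ι : Z → V` and a continuous embedding `j : V → X`, the elliptic symmetric operators `A`
and `𝕍`, the lower order term `F` and the dissipation potential `R`. -/
structure ViscousSystem (Z V X : Type*)
    [NormedAddCommGroup Z] [InnerProductSpace ℝ Z]
    [NormedAddCommGroup V] [InnerProductSpace ℝ V]
    [NormedAddCommGroup X] [NormedSpace ℝ X] where
  /-- the embedding of `Z` into `V` -/
  ι : Z →L[ℝ] V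
  ι_injective : Function.Injective ι
  ι_denseRange : DenseRange ι
  ι_compact : IsCompactOperator ι
  /-- the embedding of `V` into `X` -/
  j : V →L[ℝ] X
  j_injective : Function.Injective j
  /-- the leading order operator `A : Z → Z*` -/
  A : Z →L[ℝ] StrongDual ℝ Z
  A_symm : ∀ z₁ z₂ : Z, A z₁ z₂ = A z₂ z₁
  A_elliptic : ∃ α : ℝ, 0 < α ∧ ∀ z : Z, α * ‖z‖ ^ 2 ≤ A z z
  /-- the viscosity operator `𝕍 : V → V*` -/
  visc : V →L[ℝ] StrongDual ℝ V
  visc_symm : ∀ v₁ v₂ : V, visc v₁ v₂ = visc v₂ v₁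
  visc_elliptic : ∃ γ : ℝ, 0 < γ ∧ ∀ v : V, γ * ‖v‖ ^ 2 ≤ visc v v
  /-- the nonconvex lower order term of the energy -/
  F : Z → ℝ
  F_contDiff : ContDiff ℝ 2 F
  F_nonneg : ∀ z : Z, 0 ≤ F z
  /-- `D F` takes values in `V*`, is of class `C¹` as a map `Z → V*`, and
  `‖D²F(z) w‖_{V*} ≤ C (1 + ‖z‖_Z ^ q) ‖w‖_Z`. -/
  F_lowerOrder : ∃ G : Z → StrongDual ℝ V,
    (∀ z w : Z, G z (ι w) = fderiv ℝ F z w) ∧ ContDiff ℝ 1 G ∧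
    ∃ C q : ℝ, 1 ≤ q ∧ ∀ z w : Z, ‖fderiv ℝ G z w‖ ≤ C * (1 + ‖z‖ ^ q) * ‖w‖
  /-- `F` is (sequentially) weakly continuous. -/
  F_weak : ∀ (u : ℕ → Z) (z : Z),
    (∀ f : StrongDual ℝ Z, Tendsto (fun n => f (u n)) atTop (𝓝 (f z))) →
    Tendsto (fun n => F (u n)) atTop (𝓝 (F z))
  /-- `D F : Z → Z*` is (sequentially) weak-weak continuous. -/
  DF_weak : ∀ (u : ℕ → Z) (z : Z),
    (∀ f : StrongDual ℝ Z, Tendsto (fun n => f (u n)) atTop (𝓝 (f z))) →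
    ∀ w : Z, Tendsto (fun n => fderiv ℝ F (u n) w) atTop (𝓝 (fderiv ℝ F z w))
  /-- the dissipation potential -/
  R : X → ℝ
  R_nonneg : ∀ x : X, 0 ≤ R x
  R_convex : ConvexOn ℝ univ R
  R_continuous : Continuous R
  R_homogeneous : ∀ (s : ℝ) (x : X), 0 < s → R (s • x) = s * R x
  R_bounds : ∃ c C : ℝ, 0 < c ∧ 0 < C ∧ ∀ x : X, c * ‖x‖ ≤ R x ∧ R x ≤ C * ‖x‖

namespace ViscousSystem

variable {Z V X : Type*}
  [NormedAddCommGroup Z] [InnerProductSpace ℝ Z]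
  [NormedAddCommGroup V] [InnerProductSpace ℝ V]
  [NormedAddCommGroup X] [NormedSpace ℝ X]

/-- The stored energy `I(z) = ½ ⟨A z, z⟩ + F(z)`. -/
noncomputable def I (S : ViscousSystem Z V X) (z : Z) : ℝ :=
  (1 / 2) * S.A z z + S.F z

/-- The derivative `D I(z) ∈ Z*`. -/
noncomputable def DI (S : ViscousSystem Z V X) (z : Z) : StrongDual ℝ Z :=
  fderiv ℝ S.I z

/-- The functional `ζ ∈ Z*` belongs to `V*` and is, as an element of `V*`, equal to `ξ`. -/
def Represents (S : ViscousSystem Z V X) (ξ : StrongDual ℝ V) (ζ : StrongDual ℝ Z) : Prop :=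
  ∀ w : Z, ξ (S.ι w) = ζ w

/-- The convex subdifferential `∂R(v) ⊆ V*` of the dissipation potential at `v ∈ V`. -/
def subdiff (S : ViscousSystem Z V X) (v : V) : Set (StrongDual ℝ V) :=
  {η | ∀ w : V, S.R (S.j v) + η (w - v) ≤ S.R (S.j w)}

/-- Ellipticity makes `𝕍 : V → V*` an isomorphism, so that the inverse below is genuine. -/
theorem visc_isInvertible [CompleteSpace V] (S : ViscousSystem Z V X) :
    S.visc.IsInvertible := by
  obtain ⟨γ, hγ, h⟩ := S.visc_elliptic
  have hc : IsCoercive S.visc := ⟨γ, hγ, fun u => by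
    have := h u
    nlinarith [this]⟩
  refine ⟨hc.continuousLinearEquivOfBilin.trans
    (InnerProductSpace.toDual ℝ V).toContinuousLinearEquiv, ?_⟩
  ext v w
  simp

/-- The dual norm `‖ξ‖_{𝕍⁻¹} = ⟨ξ, 𝕍⁻¹ ξ⟩^{1/2}` on `V*`. -/
noncomputable def dualNorm (S : ViscousSystem Z V X) (ξ : StrongDual ℝ V) : ℝ :=
  Real.sqrt (ξ (S.visc.inverse ξ))

/-- `dist_𝕍(ξ, ∂R(0)) = inf {‖ξ - σ‖_{𝕍⁻¹} : σ ∈ ∂R(0)}`. -/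
noncomputable def dist (S : ViscousSystem Z V X) (ξ : StrongDual ℝ V) : ℝ :=
  sInf ((fun σ => S.dualNorm (ξ - σ)) '' S.subdiff 0)

/-- The differential inclusion `0 ∈ ∂R(v) + 𝕍 v + D I(z) - ℓ`, an identity in `Z*`. -/
def Inclusion (S : ViscousSystem Z V X) (ℓ : StrongDual ℝ V) (z : Z) (v : V) : Prop :=
  ∃ η ∈ S.subdiff v, ∀ w : Z,
    η (S.ι w) + S.visc v (S.ι w) + S.DI z w - ℓ (S.ι w) = 0

/-- `z ∈ L^∞(ℝ₊; Z)` has the derivative `ż = v ∈ L¹((0,a); V)` for all `a > 0`, satisfies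
`z(0) = z₀`, and solves `0 ∈ ∂R(ż) + 𝕍 ż + D I(z) - ℓ` almost everywhere on `ℝ₊`.
The path `z`, which matters on `[0,∞)` only, is the representative that is continuous
with values in `V`. -/
structure IsSolution (S : ViscousSystem Z V X) (ℓ : StrongDual ℝ V) (z₀ : Z)
    (z : ℝ → Z) (v : ℝ → V) : Prop where
  memLp : MemLp z ∞ (volume.restrict (Ioi 0))
  integrable : ∀ a : ℝ, 0 < a → IntegrableOn v (Ioo 0 a)
  primitive : ∀ t : ℝ, 0 ≤ t → S.ι (z t) = S.ι (z 0) + ∫ s in (0 : ℝ)..t, v s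
  initial : z 0 = z₀
  inclusion : ∀ᵐ t ∂(volume.restrict (Ioi (0 : ℝ))), S.Inclusion ℓ (z t) (v t)

end ViscousSystem

/-- `m` maps bounded sets to bounded sets. -/
def MapsBoundedToBounded {E : Type*} [Bornology E] (m : E → ℝ) : Prop :=
  ∀ B : Set E, Bornology.IsBounded B → Bornology.IsBounded (m '' B)

/-! ### Absolutely continuous functions and a chain rule for primitives -/

section AbsolutelyContinuous

/-! Uniqueness. The difference `w` of two solutions ought to be tested with its velocity `g`, but
`g` is merely locally integrable in `V`, so `⟨𝕍 g, g⟩` need not be integrable and no chain rule for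
`½⟨A w, w⟩` is at hand. The test function is therefore the exponential average `y` of `g`, which
solves `y' = r (g - y)` and equals `r` times the difference of `w` and its own average. Convexity of
the quadratic energy makes the `A`-term dominate the derivative of the averaged energy
(`sub_expAverage_quadratic_le`). The viscous term is `⟨𝕍 y, y⟩` plus an exact derivative of the
right sign (`integral_visc_expAverage_le`), and it absorbs the Lipschitz lower order term. Since
`∂R` is monotone and bounded, it costs at most `2K‖g - y‖`, whose integral vanishes as `r → ∞`
(`tendsto_integral_norm_expAverage_sub`). Integrating once more in time and applying Grönwall gives
`w = 0` (`IsSolution.eqOn`).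

Existence and bounds. Implicit Euler steps are minimizers, found by the direct method. Subtracting
two consecutive Euler equations and testing with the new velocity bounds the velocity and the
increment in `Z` by the old velocity plus a lower order term. Ehrling's inequality, with `R` as the
weak norm, absorbs that term at the price of the dissipation of the step (`exists_step_estimate`).
The total dissipation is bounded by the initial energy, so the sums are uniform in time and in the
step size. The first step is treated like the others by means of a fictitious velocity `𝕍⁻¹(-DI(z₀)
+ ℓ - σ)` with `σ ∈ ∂R(0)`; this is where the distance to `∂R(0)` enters.

Convergence. The problem is semilinear, so two approximations can be compared directly: their
distance is controlled by the sum of their step sizes (`IsApprox.exists_compare`). With steps `4⁻ⁿ`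
the states converge strongly in `Z` at every time and the velocities strongly in `V` at almost every
time. The inclusion is closed under strong convergence, and the bounds survive the limit. By
uniqueness they hold for every solution. -/

theorem absolutelyContinuousOnInterval_of_dist_le {X Y : Type*} [PseudoMetricSpace X]
    [PseudoMetricSpace Y] {f : ℝ → X} {h : ℝ → Y} {a b K : ℝ}
    (hf : AbsolutelyContinuousOnInterval f a b)
    (hle : ∀ s ∈ uIcc a b, ∀ t ∈ uIcc a b, dist (h s) (h t) ≤ K * dist (f s) (f t)) :
    AbsolutelyContinuousOnInterval h a b := by
  unfold AbsolutelyContinuousOnInterval at hf ⊢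
  refine squeeze_zero' (Eventually.of_forall fun _ => Finset.sum_nonneg fun _ _ => dist_nonneg)
    ?_ (by simpa using hf.const_mul K)
  rw [eventually_inf_principal]
  filter_upwards with E hE
  rw [Finset.mul_sum]
  exact Finset.sum_le_sum fun i hi => hle _ (hE.1 i hi).1 _ (hE.1 i hi).2

theorem IntervalIntegrable.mono_zero {E : Type*} [NormedAddCommGroup E] {g : ℝ → E} {t T : ℝ}
    (hg : IntervalIntegrable g volume 0 T) (ht : t ∈ uIcc 0 T) :
    IntervalIntegrable g volume 0 t :=
  hg.mono_set (uIcc_subset_uIcc_left ht)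

variable {E : Type*} [NormedAddCommGroup E] [NormedSpace ℝ E]

theorem absolutelyContinuousOnInterval_primitive {g : ℝ → E} {T : ℝ}
    (hg : IntervalIntegrable g volume 0 T) :
    AbsolutelyContinuousOnInterval (fun t => ∫ s in (0 : ℝ)..t, g s) 0 T := by
  refine absolutelyContinuousOnInterval_of_dist_le (K := 1)
    (hg.norm.absolutelyContinuousOnInterval_intervalIntegral (c := 0) left_mem_uIcc) ?_
  intro s hs t ht
  rw [one_mul, dist_eq_norm, dist_eq_norm,
    intervalIntegral.integral_interval_sub_left (hg.mono_zero hs) (hg.mono_zero ht),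
    intervalIntegral.integral_interval_sub_left (hg.norm.mono_zero hs) (hg.norm.mono_zero ht)]
  exact intervalIntegral.norm_integral_le_abs_integral_norm

theorem continuousOn_primitive_zero {g : ℝ → E} {T : ℝ}
    (hg : IntervalIntegrable g volume 0 T) :
    ContinuousOn (fun t => ∫ s in (0 : ℝ)..t, g s) (uIcc 0 T) :=
  (absolutelyContinuousOnInterval_primitive hg).continuousOn

variable [CompleteSpace E]

/-- Subtracting the primitive of `f'` leaves an absolutely continuous function with derivative zero
almost everywhere, hence a constant. -/
theorem AbsolutelyContinuousOnInterval.integral_eq_sub_of_ae_hasDerivAt {f f' : ℝ → E} {T : ℝ}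
    (hf : AbsolutelyContinuousOnInterval f 0 T)
    (hd : ∀ᵐ x, x ∈ uIcc 0 T → HasDerivAt f (f' x) x)
    (hi : IntervalIntegrable f' volume 0 T) :
    ∫ x in (0 : ℝ)..T, f' x = f T - f 0 := by
  have h0 : ∀ᵐ x, x ∈ uIcc 0 T →
      HasDerivAt (fun x => f x - ∫ s in (0 : ℝ)..x, f' s) 0 x := by
    filter_upwards [hd, hi.ae_hasDerivAt_integral] with x h1 h2 hx
    simpa only [sub_self] using (h1 hx).fun_sub (h2 hx 0 left_mem_uIcc)
  obtain ⟨C, hC⟩ := AbsolutelyContinuousOnInterval.const_of_ae_hasDerivAt_zero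
    (hf.fun_sub (absolutelyContinuousOnInterval_primitive hi)) h0
  have h1 := hC T right_mem_uIcc
  have h2 := hC 0 left_mem_uIcc
  simp only [intervalIntegral.integral_same, sub_zero] at h2
  rw [h2, ← h1]
  abel

/-- The chain rule for a symmetric bounded bilinear form along a primitive. -/
theorem bilin_primitive_self (B : E →L[ℝ] StrongDual ℝ E) (hB : ∀ x y, B x y = B y x)
    {g u : ℝ → E} {T : ℝ} (hg : IntervalIntegrable g volume 0 T)
    (hu : ∀ t ∈ uIcc 0 T, u t = ∫ s in (0 : ℝ)..t, g s) :
    IntervalIntegrable (fun t => B (u t) (g t)) volume 0 T ∧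
    B (u T) (u T) = 2 * ∫ t in (0 : ℝ)..T, B (u t) (g t) := by
  set U : ℝ → E := fun t => ∫ s in (0 : ℝ)..t, g s with hU
  have hac := absolutelyContinuousOnInterval_primitive hg
  have hcont : ContinuousOn U (uIcc 0 T) := hac.continuousOn
  obtain ⟨M, hM⟩ := hac.exists_bound
  have hint : IntervalIntegrable (fun t => B (U t) (g t)) volume 0 T := by
    rw [intervalIntegrable_iff] at hg ⊢
    have hBU : ContinuousOn (fun t => B (U t)) (uIcc 0 T) := B.continuous.comp_continuousOn hcont
    have hm : AEStronglyMeasurable (fun t => B (U t)) (volume.restrict (uIoc 0 T)) :=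
      (hBU.mono uIoc_subset_uIcc).aestronglyMeasurable measurableSet_uIoc
    refine Integrable.mono' (hg.norm.const_mul (‖B‖ * M)) ?_ ?_
    · have := (isBoundedBilinearMap_apply (𝕜 := ℝ) (E := E) (F := ℝ)).continuous
      exact this.comp_aestronglyMeasurable (hm.prodMk hg.aestronglyMeasurable)
    · refine (ae_restrict_iff' measurableSet_uIoc).2 (Eventually.of_forall fun t ht => ?_)
      calc ‖B (U t) (g t)‖ ≤ ‖B‖ * ‖U t‖ * ‖g t‖ := B.le_opNorm₂ _ _
        _ ≤ ‖B‖ * M * ‖g t‖ := by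
          gcongr
          exact hM t (uIoc_subset_uIcc ht)
  have key : ∫ t in (0 : ℝ)..T, 2 * B (U t) (g t) = B (U T) (U T) - B (U 0) (U 0) := by
    refine AbsolutelyContinuousOnInterval.integral_eq_sub_of_ae_hasDerivAt
      (f := fun t => B (U t) (U t)) ?_ ?_ (hint.const_mul 2)
    · refine absolutelyContinuousOnInterval_of_dist_le (K := 2 * (‖B‖ * M)) hac ?_
      intro s hs t ht
      -- By symmetry the difference factors, so the quadratic form is Lipschitz along the bounded
      -- path `U` and inherits its absolute continuity.
      have e : B (U s) (U s) - B (U t) (U t) = B (U s + U t) (U s - U t) := by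
        simp only [map_add, map_sub, add_apply]
        rw [hB (U t) (U s)]
        ring
      rw [dist_eq_norm, dist_eq_norm, e]
      calc ‖B (U s + U t) (U s - U t)‖ ≤ ‖B‖ * ‖U s + U t‖ * ‖U s - U t‖ := B.le_opNorm₂ _ _
        _ ≤ ‖B‖ * (M + M) * ‖U s - U t‖ := by
          gcongr
          exact (norm_add_le _ _).trans (add_le_add (hM s hs) (hM t ht))
        _ = _ := by ring
    · filter_upwards [hg.ae_hasDerivAt_integral] with x hx hxm
      have h1 : HasDerivAt U (g x) x := hx hxm 0 left_mem_uIcc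
      have h2 : HasDerivAt (fun t => B (U t)) (B (g x)) x := B.hasFDerivAt.comp_hasDerivAt x h1
      have h3 := h2.clm_apply h1
      convert h3 using 1
      rw [hB (g x) (U x)]
      ring
  have hUu : ∀ t ∈ uIoc 0 T, B (U t) (g t) = B (u t) (g t) := fun t ht => by
    rw [hu t (uIoc_subset_uIcc ht)]
  refine ⟨hint.congr hUu, ?_⟩
  rw [hu T right_mem_uIcc, ← intervalIntegral.integral_congr_ae (Eventually.of_forall hUu)]
  rw [intervalIntegral.integral_const_mul] at key
  rw [key]
  simp [U]

end AbsolutelyContinuous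

/-! ### Grönwall's inequality -/

section Gronwall

/-- Grönwall's inequality in integral form. -/
theorem le_mul_exp_of_le_add_integral {a : ℝ → ℝ} {δ c T : ℝ} (hc : 0 ≤ c)
    (ha : ContinuousOn a (Icc 0 T))
    (h : ∀ t ∈ Icc 0 T, a t ≤ δ + c * ∫ s in (0 : ℝ)..t, a s) :
    ∀ t ∈ Icc 0 T, a t ≤ δ * Real.exp (c * t) := by
  intro t ht
  have hT : 0 ≤ T := ht.1.trans ht.2
  have hint : ∀ s ∈ Icc 0 T, IntervalIntegrable a volume 0 s := fun s hs =>
    (ha.mono (Icc_subset_Icc_right hs.2)).intervalIntegrable_of_Icc hs.1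
  have hcont : ContinuousOn (fun t => ∫ s in (0 : ℝ)..t, a s) (Icc 0 T) := by
    have := continuousOn_primitive_zero (hint T ⟨hT, le_rfl⟩)
    rwa [uIcc_of_le hT] at this
  -- The differential inequality `H' ≤ c H + δ` is applied to the primitive `H` of `a`, because `a`
  -- need not be differentiable.
  have hH : ∀ t ∈ Icc 0 T, (∫ s in (0 : ℝ)..t, a s) ≤ gronwallBound 0 c δ (t - 0) := by
    refine le_gronwallBound_of_liminf_deriv_right_le (f' := a) hcont ?_ (by simp) ?_
    · intro x hx r hr
      have hd : HasDerivWithinAt (fun t => ∫ s in (0 : ℝ)..t, a s) (a x) (Ici x) x := by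
        refine intervalIntegral.integral_hasDerivWithinAt_right
          (hint x ⟨hx.1, hx.2.le⟩) (s := Ici x) (t := Ioi x) ?_ ?_
        · refine ⟨Icc 0 T, ?_, ?_⟩
          · exact mem_nhdsWithin.2 ⟨Iio T, isOpen_Iio, hx.2, fun y hy =>
              ⟨hx.1.trans hy.2.le, hy.1.le⟩⟩
          · exact (ha.aestronglyMeasurable measurableSet_Icc)
        · exact ((ha x ⟨hx.1, hx.2.le⟩).mono_of_mem_nhdsWithin
            (mem_nhdsWithin.2 ⟨Iio T, isOpen_Iio, hx.2, fun y hy =>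
              ⟨hx.1.trans (le_of_lt hy.2), le_of_lt hy.1⟩⟩))
      have := (hasDerivWithinAt_iff_tendsto_slope' (by simp)).1
        (hd.mono (Ioi_subset_Ici le_rfl))
      refine ((this.eventually (gt_mem_nhds hr)).frequently).mono fun z hz => ?_
      simpa [slope, smul_eq_mul] using hz
    · intro x hx
      have := h x ⟨hx.1, hx.2.le⟩
      linarith
  have h1 := h t ht
  have h2 := hH t ht
  rw [sub_zero] at h2
  rcases hc.eq_or_lt with rfl | hc'
  · simpa using h1
  · rw [gronwallBound_of_K_ne_0 hc'.ne'] at h2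
    have h3 : c * ∫ s in (0 : ℝ)..t, a s ≤ δ * (Real.exp (c * t) - 1) := by
      have := mul_le_mul_of_nonneg_left h2 hc
      refine this.trans (le_of_eq ?_)
      field_simp
      ring
    linarith

end Gronwall

/-! ### Exponential averages in time -/

section ExpAverage

variable {E : Type*} [NormedAddCommGroup E] [NormedSpace ℝ E]

/-- The average of `g` on `[0, t]` with the exponential weight `r e^{-r (t - s)}`. -/
noncomputable def expAverage (r : ℝ) (g : ℝ → E) (t : ℝ) : E :=
  (r * Real.exp (-(r * t))) • ∫ s in (0 : ℝ)..t, Real.exp (r * s) • g s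

theorem IntervalIntegrable.exp_smul {g : ℝ → E} {T : ℝ} (r : ℝ)
    (hg : IntervalIntegrable g volume 0 T) :
    IntervalIntegrable (fun s => Real.exp (r * s) • g s) volume 0 T :=
  hg.continuousOn_smul (by fun_prop)

theorem absolutelyContinuousOnInterval_exp (r c T : ℝ) :
    AbsolutelyContinuousOnInterval (fun t => c * Real.exp (r * t)) 0 T := by
  have : ContDiff ℝ 1 (fun t : ℝ => c * Real.exp (r * t)) := by fun_prop
  exact this.contDiffOn.absolutelyContinuousOnInterval

theorem continuousOn_expAverage {g : ℝ → E} {T : ℝ} (r : ℝ)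
    (hg : IntervalIntegrable g volume 0 T) : ContinuousOn (expAverage r g) (uIcc 0 T) := by
  unfold expAverage
  exact ContinuousOn.smul (by fun_prop) (continuousOn_primitive_zero (hg.exp_smul r))

theorem intervalIntegrable_expAverage {g : ℝ → E} {T : ℝ} (r : ℝ)
    (hg : IntervalIntegrable g volume 0 T) : IntervalIntegrable (expAverage r g) volume 0 T :=
  (continuousOn_expAverage r hg).intervalIntegrable

theorem expAverage_congr {g h : ℝ → E} {t : ℝ} (r : ℝ) (hgh : ∀ s ∈ uIoc 0 t, g s = h s) :
    expAverage r g t = expAverage r h t := by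
  unfold expAverage
  congr 1
  exact intervalIntegral.integral_congr_ae (Eventually.of_forall fun s hs => by
    simp only [hgh s hs])

theorem expAverage_sub {g h : ℝ → E} {t : ℝ} (r : ℝ)
    (hg : IntervalIntegrable g volume 0 t) (hh : IntervalIntegrable h volume 0 t) :
    expAverage r (fun s => g s - h s) t = expAverage r g t - expAverage r h t := by
  unfold expAverage
  rw [← smul_sub, ← intervalIntegral.integral_sub (hg.exp_smul r) (hh.exp_smul r)]
  simp only [smul_sub]

theorem norm_expAverage_le {g : ℝ → E} {t r : ℝ} (hr : 0 ≤ r) (ht : 0 ≤ t) :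
    ‖expAverage r g t‖ ≤ expAverage r (fun s => ‖g s‖) t := by
  unfold expAverage
  rw [norm_smul, Real.norm_of_nonneg (by positivity), smul_eq_mul]
  gcongr
  refine (intervalIntegral.norm_integral_le_integral_norm ht).trans (le_of_eq ?_)
  refine intervalIntegral.integral_congr fun s _ => ?_
  simp only [norm_smul, Real.norm_of_nonneg (Real.exp_pos _).le, smul_eq_mul]

theorem expAverage_nonneg {g : ℝ → ℝ} {t r : ℝ} (hr : 0 ≤ r) (ht : 0 ≤ t)
    (hg : ∀ s ∈ Icc 0 t, 0 ≤ g s) : 0 ≤ expAverage r g t := by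
  unfold expAverage
  refine smul_nonneg (by positivity) (intervalIntegral.integral_nonneg ht fun s hs => ?_)
  exact smul_nonneg (Real.exp_pos _).le (hg s hs)

/-- The exponential average solves `y' = r (g - y)`, `y(0) = 0`. -/
theorem expAverage_eq_integral [CompleteSpace E] {g : ℝ → E} {T : ℝ} (r : ℝ)
    (hg : IntervalIntegrable g volume 0 T) :
    expAverage r g T = ∫ s in (0 : ℝ)..T, r • (g s - expAverage r g s) := by
  have hi : IntervalIntegrable (fun s => r • (g s - expAverage r g s)) volume 0 T :=
    (hg.sub (intervalIntegrable_expAverage r hg)).smul r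
  have hac : AbsolutelyContinuousOnInterval (expAverage r g) 0 T := by
    have h := (absolutelyContinuousOnInterval_exp (-r) r T).fun_smul
      (absolutelyContinuousOnInterval_primitive (hg.exp_smul r))
    simp only [neg_mul] at h
    exact h
  have h := hac.integral_eq_sub_of_ae_hasDerivAt
    (f' := fun s => r • (g s - expAverage r g s)) ?_ hi
  · rw [h]
    simp [expAverage]
  · filter_upwards [(hg.exp_smul r).ae_hasDerivAt_integral] with x hx hxm
    have h1 := hx hxm 0 left_mem_uIcc
    have h2 : HasDerivAt (fun t => r * Real.exp (-(r * t)))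
        (r * (Real.exp (-(r * x)) * (-r))) x := by
      have := ((hasDerivAt_id x).const_mul r).fun_neg.exp.const_mul r
      simpa using this
    have h3 := h2.fun_smul h1
    unfold expAverage
    convert h3 using 1
    rw [smul_smul, mul_assoc r, ← Real.exp_add]
    simp only [neg_add_cancel, Real.exp_zero, mul_one, smul_sub, smul_smul]
    rw [sub_eq_add_neg, ← neg_smul]
    congr 2
    ring

/-- The exponential average of a primitive. -/
theorem sub_expAverage_of_primitive [CompleteSpace E] {g u : ℝ → E} {T : ℝ} {x₀ : E} (r : ℝ)
    (hg : IntervalIntegrable g volume 0 T)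
    (hu : ∀ t ∈ uIcc 0 T, u t = x₀ + ∫ s in (0 : ℝ)..t, g s) :
    r • (u T - expAverage r u T) = (r * Real.exp (-(r * T))) • x₀ + expAverage r g T := by
  set U : ℝ → E := fun t => x₀ + ∫ s in (0 : ℝ)..t, g s with hU
  have hUc : ContinuousOn U (uIcc 0 T) :=
    continuousOn_const.add (continuousOn_primitive_zero hg)
  have hUi : IntervalIntegrable U volume 0 T := hUc.intervalIntegrable
  have hUac : AbsolutelyContinuousOnInterval U 0 T :=
    absolutelyContinuousOnInterval_of_dist_le (K := 1)
      (absolutelyContinuousOnInterval_primitive hg) fun s _ t _ => by simp [U]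
  have key : ∫ s in (0 : ℝ)..T, (Real.exp (r * s) • g s + (r * Real.exp (r * s)) • U s) =
      Real.exp (r * T) • U T - Real.exp (r * 0) • U 0 := by
    refine AbsolutelyContinuousOnInterval.integral_eq_sub_of_ae_hasDerivAt
      (f := fun t => Real.exp (r * t) • U t) ?_ ?_ ?_
    · simpa using (absolutelyContinuousOnInterval_exp r 1 T).fun_smul hUac
    · filter_upwards [hg.ae_hasDerivAt_integral] with x hx hxm
      have h1 : HasDerivAt U (g x) x := 
        (hx hxm 0 left_mem_uIcc).const_add x₀
      have h2 : HasDerivAt (fun t => Real.exp (r * t)) (r * Real.exp (r * x)) x := by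
        have := ((hasDerivAt_id x).const_mul r).exp
        simpa [mul_comm] using this
      exact h2.fun_smul h1
    · exact (hg.exp_smul r).add (hUi.continuousOn_smul (by fun_prop))
  have hcU : expAverage r u T = expAverage r U T :=
    expAverage_congr r fun s hs => hu s (uIoc_subset_uIcc hs)
  rw [hcU, hu T right_mem_uIcc]
  change r • (U T - expAverage r U T) = _
  rw [intervalIntegral.integral_add (hg.exp_smul r) (hUi.continuousOn_smul (by fun_prop))] at key
  have h4 : ∫ s in (0 : ℝ)..T, (r * Real.exp (r * s)) • U s =
      r • ∫ s in (0 : ℝ)..T, Real.exp (r * s) • U s := by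
    rw [← intervalIntegral.integral_smul]
    simp only [smul_smul]
  rw [h4] at key
  have hU0 : U 0 = x₀ := by simp [U]
  rw [mul_zero, Real.exp_zero, one_smul, hU0] at key
  have h5 : ∫ s in (0 : ℝ)..T, Real.exp (r * s) • g s =
      Real.exp (r * T) • U T - x₀ - r • ∫ s in (0 : ℝ)..T, Real.exp (r * s) • U s :=
    eq_sub_of_add_eq key
  unfold expAverage
  rw [h5]
  have h6 : Real.exp (-(r * T)) * Real.exp (r * T) = 1 := by
    rw [← Real.exp_add]; simp
  simp only [smul_sub, smul_smul]
  rw [mul_assoc r, h6, mul_one]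
  have : r * (r * Real.exp (-(r * T))) = r * Real.exp (-(r * T)) * r := by ring
  rw [this]
  abel

/-- Averaging is a contraction in `L¹(0,T)`: integrating `y' = r(‖g‖ - y)` for the average `y` of
`‖g‖` gives `r ∫(‖g‖ - y) = y(T) ≥ 0`. -/
theorem integral_norm_expAverage_le {g : ℝ → E} {T r : ℝ} (hr : 0 < r) (hT : 0 ≤ T)
    (hg : IntervalIntegrable g volume 0 T) :
    ∫ t in (0 : ℝ)..T, ‖expAverage r g t‖ ≤ ∫ t in (0 : ℝ)..T, ‖g t‖ := by
  have h1 : ∫ t in (0 : ℝ)..T, ‖expAverage r g t‖ ≤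
      ∫ t in (0 : ℝ)..T, expAverage r (fun s => ‖g s‖) t :=
    intervalIntegral.integral_mono_on hT (intervalIntegrable_expAverage r hg).norm
      (intervalIntegrable_expAverage r hg.norm) fun t ht => norm_expAverage_le hr.le ht.1
  have h2 := expAverage_eq_integral r hg.norm
  have h3 : 0 ≤ expAverage r (fun s => ‖g s‖) T :=
    expAverage_nonneg hr.le hT fun _ _ => norm_nonneg _
  rw [h2, intervalIntegral.integral_smul, intervalIntegral.integral_sub hg.norm
    (intervalIntegrable_expAverage r hg.norm), smul_eq_mul] at h3
  have := nonneg_of_mul_nonneg_right h3 hr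
  linarith

/-- Integration by parts turns `r` times the error into `r e^{-rt} g(0)` plus the average of `g'`.
Both are bounded in `L¹` independently of `r`, so the error is of order `1/r`. -/
theorem tendsto_integral_norm_expAverage_sub_of_contDiff [CompleteSpace E] {g : ℝ → E} {T : ℝ} (hT : 0 ≤ T)
    (hg : ContDiff ℝ 1 g) :
    Tendsto (fun r => ∫ t in (0 : ℝ)..T, ‖g t - expAverage r g t‖) atTop (𝓝 0) := by
  have hd : Continuous (deriv g) := hg.continuous_deriv le_rfl
  have hi : ∀ a b : ℝ, IntervalIntegrable (deriv g) volume a b := fun a b =>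
    hd.intervalIntegrable a b
  have hprim : ∀ t, g t = g 0 + ∫ s in (0 : ℝ)..t, deriv g s := fun t => by
    rw [intervalIntegral.integral_deriv_eq_sub (fun x _ => (hg.differentiable one_ne_zero) x)
      (hi 0 t)]
    abel
  set M := ∫ t in (0 : ℝ)..T, ‖deriv g t‖
  have hb : ∀ r : ℝ, 0 < r → ∫ t in (0 : ℝ)..T, ‖g t - expAverage r g t‖ ≤
      r⁻¹ * (‖g 0‖ + M) := by
    intro r hr
    have heq : ∀ t, g t - expAverage r g t =
        r⁻¹ • ((r * Real.exp (-(r * t))) • g 0 + expAverage r (deriv g) t) := fun t => by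
      rw [← sub_expAverage_of_primitive r (hi 0 t) (fun s _ => hprim s), smul_smul,
        inv_mul_cancel₀ hr.ne', one_smul]
    have hexp : IntervalIntegrable (fun t : ℝ => r * Real.exp (-(r * t)) * ‖g 0‖) volume 0 T :=
      Continuous.intervalIntegrable (by fun_prop) _ _
    have he : ∫ t in (0 : ℝ)..T, r * Real.exp (-(r * t)) * ‖g 0‖ ≤ ‖g 0‖ := by
      have h1 : ∀ x ∈ uIcc 0 T, HasDerivAt (fun t : ℝ => -Real.exp (-(r * t)) * ‖g 0‖)
          (r * Real.exp (-(r * x)) * ‖g 0‖) x := fun x _ => by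
        have := (((hasDerivAt_id x).const_mul r).fun_neg.exp.fun_neg).mul_const ‖g 0‖
        refine this.congr_deriv ?_
        simp only [id]
        ring
      rw [intervalIntegral.integral_eq_sub_of_hasDerivAt h1 hexp]
      have := mul_nonneg (Real.exp_pos (-(r * T))).le (norm_nonneg (g 0))
      simp
      linarith
    calc ∫ t in (0 : ℝ)..T, ‖g t - expAverage r g t‖
        ≤ ∫ t in (0 : ℝ)..T, r⁻¹ * (r * Real.exp (-(r * t)) * ‖g 0‖ +
            ‖expAverage r (deriv g) t‖) := by
          refine intervalIntegral.integral_mono_on hT ?_ ?_ fun t ht => ?_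
          · exact ((hg.continuous.intervalIntegrable 0 T).sub
              (intervalIntegrable_expAverage r (hg.continuous.intervalIntegrable 0 T))).norm
          · exact (hexp.add (intervalIntegrable_expAverage r (hi 0 T)).norm).const_mul _
          · rw [heq t, norm_smul, Real.norm_of_nonneg (by positivity)]
            gcongr
            refine (norm_add_le _ _).trans ?_
            rw [norm_smul, Real.norm_of_nonneg (by positivity)]
      _ = r⁻¹ * ((∫ t in (0 : ℝ)..T, r * Real.exp (-(r * t)) * ‖g 0‖) +
            ∫ t in (0 : ℝ)..T, ‖expAverage r (deriv g) t‖) := by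
          rw [intervalIntegral.integral_const_mul, intervalIntegral.integral_add hexp
            (intervalIntegrable_expAverage r (hi 0 T)).norm]
      _ ≤ r⁻¹ * (‖g 0‖ + M) := by
          gcongr
          exact integral_norm_expAverage_le hr hT (hi 0 T)
  refine squeeze_zero' (Eventually.of_forall fun r =>
    intervalIntegral.integral_nonneg hT fun _ _ => norm_nonneg _)
    ((eventually_gt_atTop 0).mono hb) ?_
  simpa using tendsto_inv_atTop_zero.mul_const (‖g 0‖ + M)

theorem exists_contDiff_integral_norm_sub_le [CompleteSpace E] {g : ℝ → E} {T : ℝ} (hT : 0 ≤ T)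
    (hg : IntervalIntegrable g volume 0 T) {δ : ℝ} (hδ : 0 < δ) :
    ∃ k : ℝ → E, ContDiff ℝ 1 k ∧ ∫ t in (0 : ℝ)..T, ‖g t - k t‖ ≤ δ := by
  have hgi : Integrable g (volume.restrict (Ioc 0 T)) := by
    rwa [intervalIntegrable_iff_integrableOn_Ioc_of_le hT] at hg
  obtain ⟨h, hsupp, hle, hcont, -⟩ :=
    hgi.exists_hasCompactSupport_integral_sub_le (half_pos hδ)
  obtain ⟨k, hk, hkd⟩ := (hsupp.uniformContinuous_of_continuous hcont).exists_contDiff_dist_le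
    -- Dividing by `T + 1` rather than `T` covers the case `T = 0`.
    (ε := δ / 2 / (T + 1)) (by positivity)
  refine ⟨k, hk.of_le (by exact_mod_cast le_top), ?_⟩
  have hhi := hcont.intervalIntegrable (μ := volume) 0 T
  have hki := hk.continuous.intervalIntegrable (μ := volume) 0 T
  have h1 : ∫ t in (0 : ℝ)..T, ‖g t - h t‖ ≤ δ / 2 := by
    rwa [intervalIntegral.integral_of_le hT]
  have h2 : ∫ t in (0 : ℝ)..T, ‖h t - k t‖ ≤ δ / 2 := by
    calc ∫ t in (0 : ℝ)..T, ‖h t - k t‖ ≤ ∫ t in (0 : ℝ)..T, δ / 2 / (T + 1) := by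
          refine intervalIntegral.integral_mono_on hT (hhi.sub hki).norm (by simp) fun t _ => ?_
          rw [← dist_eq_norm, dist_comm]
          exact (hkd t).le
      _ = δ / 2 * (T / (T + 1)) := by simp; ring
      _ ≤ δ / 2 * 1 := by
          gcongr
          rw [div_le_one (by positivity)]
          linarith
      _ = δ / 2 := mul_one _
  calc ∫ t in (0 : ℝ)..T, ‖g t - k t‖
      ≤ ∫ t in (0 : ℝ)..T, (‖g t - h t‖ + ‖h t - k t‖) := by
        refine intervalIntegral.integral_mono_on hT (hg.sub hki).norm
          ((hg.sub hhi).norm.add (hhi.sub hki).norm) fun t _ => norm_sub_le_norm_sub_add_norm_sub _ _ _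
    _ ≤ δ := by
        rw [intervalIntegral.integral_add (hg.sub hhi).norm (hhi.sub hki).norm]
        linarith

/-- The exponential averages converge in `L¹(0, T)`. -/
theorem tendsto_integral_norm_expAverage_sub [CompleteSpace E] {g : ℝ → E} {T : ℝ} (hT : 0 ≤ T)
    (hg : IntervalIntegrable g volume 0 T) :
    Tendsto (fun r => ∫ t in (0 : ℝ)..T, ‖g t - expAverage r g t‖) atTop (𝓝 0) := by
  rw [Metric.tendsto_atTop]
  intro δ hδ
  -- The error `g - k` is paid twice, once directly and once after averaging, where the contraction
  -- property applies.
  obtain ⟨k, hk, hle⟩ := exists_contDiff_integral_norm_sub_le hT hg (δ := δ / 4) (by positivity)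
  obtain ⟨r₀, hr₀⟩ := Metric.tendsto_atTop.1
    (tendsto_integral_norm_expAverage_sub_of_contDiff hT hk) (δ / 4) (by positivity)
  refine ⟨max r₀ 1, fun r hr => ?_⟩
  have hr1 : 0 < r := lt_of_lt_of_le one_pos ((le_max_right _ _).trans hr)
  have hnn : ∀ f : ℝ → E, 0 ≤ ∫ t in (0 : ℝ)..T, ‖f t‖ := fun f =>
    intervalIntegral.integral_nonneg hT fun _ _ => norm_nonneg _
  have h2 := hr₀ r ((le_max_left _ _).trans hr)
  rw [Real.dist_eq, sub_zero, abs_of_nonneg (hnn _)] at h2 ⊢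
  have hki := hk.continuous.intervalIntegrable (μ := volume) 0 T
  have hgk := hg.sub hki
  have e1 := integral_norm_expAverage_le hr1 hT hgk
  have i1 := hgk.norm
  have i2 := (hki.sub (intervalIntegrable_expAverage r hki)).norm
  have i3 := (intervalIntegrable_expAverage r hgk).norm
  have : ∫ t in (0 : ℝ)..T, ‖g t - expAverage r g t‖ ≤
      ∫ t in (0 : ℝ)..T, (‖g t - k t‖ + ‖k t - expAverage r k t‖ +
        ‖expAverage r (fun s => g s - k s) t‖) := by
    refine intervalIntegral.integral_mono_on hT
      (hg.sub (intervalIntegrable_expAverage r hg)).norm ((i1.add i2).add i3) fun t ht => ?_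
    have hm : t ∈ uIcc 0 T := by rwa [uIcc_of_le hT]
    rw [expAverage_sub r (hg.mono_zero hm) (hki.mono_zero hm)]
    have : g t - expAverage r g t = (g t - k t) + (k t - expAverage r k t) -
      (expAverage r g t - expAverage r k t) := by abel
    rw [this]
    exact (norm_sub_le _ _).trans (add_le_add_left (norm_add_le _ _) _)
  rw [intervalIntegral.integral_add (i1.add i2) i3, intervalIntegral.integral_add i1 i2] at this
  linarith

end ExpAverage

/-! ### Consequences of the standing assumptions -/

namespace ViscousSystem

variable {Z V X : Type*}
  [NormedAddCommGroup Z] [InnerProductSpace ℝ Z]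
  [NormedAddCommGroup V] [InnerProductSpace ℝ V]
  [NormedAddCommGroup X] [NormedSpace ℝ X]

/-- The derivative of `F` as a map with values in `V*`. -/
noncomputable def G (S : ViscousSystem Z V X) : Z → StrongDual ℝ V :=
  S.F_lowerOrder.choose

theorem G_apply (S : ViscousSystem Z V X) (z w : Z) : S.G z (S.ι w) = fderiv ℝ S.F z w :=
  S.F_lowerOrder.choose_spec.1 z w

theorem contDiff_G (S : ViscousSystem Z V X) : ContDiff ℝ 1 S.G :=
  S.F_lowerOrder.choose_spec.2.1

theorem continuous_G (S : ViscousSystem Z V X) : Continuous S.G := S.contDiff_G.continuous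

theorem differentiable_F (S : ViscousSystem Z V X) : Differentiable ℝ S.F :=
  S.F_contDiff.differentiable two_ne_zero

theorem hasFDerivAt_I (S : ViscousSystem Z V X) (z : Z) :
    HasFDerivAt S.I (S.A z + (S.G z).comp S.ι) z := by
  have h1 : HasFDerivAt (fun z => S.A z) S.A z := S.A.hasFDerivAt
  have h2 := ((h1.clm_apply (hasFDerivAt_id z)).const_mul (1 / 2)).add
    (S.differentiable_F z).hasFDerivAt
  refine h2.congr_fderiv ?_
  ext w
  simp only [add_apply, smul_apply, ContinuousLinearMap.comp_apply, ContinuousLinearMap.flip_apply,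
    ContinuousLinearMap.id_apply, id, smul_eq_mul, S.G_apply, S.A_symm w z]
  ring

theorem DI_apply (S : ViscousSystem Z V X) (z w : Z) :
    S.DI z w = S.A z w + S.G z (S.ι w) := by
  rw [DI, (S.hasFDerivAt_I z).fderiv]
  rfl

theorem R_zero (S : ViscousSystem Z V X) : S.R 0 = 0 := by
  have := S.R_homogeneous 2 0 two_pos
  rw [smul_zero] at this
  linarith

theorem R_add_le (S : ViscousSystem Z V X) (x y : X) : S.R (x + y) ≤ S.R x + S.R y := by
  have h := S.R_convex.2 (mem_univ x) (mem_univ y) (by norm_num : (0 : ℝ) ≤ 1 / 2)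
    (by norm_num : (0 : ℝ) ≤ 1 / 2) (by norm_num)
  have h2 := S.R_homogeneous (1 / 2) (x + y) (by norm_num)
  rw [← smul_add, h2, smul_eq_mul, smul_eq_mul] at h
  linarith

/-- Sublinearity of `R` splits the subgradient inequality in two: testing with `v + w` gives
domination by `R`, testing with `0` gives contact at `v`. The first condition alone describes
`∂R(0)`. -/
theorem mem_subdiff_iff (S : ViscousSystem Z V X) {v : V} {η : StrongDual ℝ V} :
    η ∈ S.subdiff v ↔ (∀ w, η w ≤ S.R (S.j w)) ∧ S.R (S.j v) ≤ η v := by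
  constructor
  · intro h
    have h0 := h 0
    rw [map_zero, S.R_zero, zero_sub, map_neg] at h0
    refine ⟨fun w => ?_, by linarith⟩
    have := h (v + w)
    rw [add_sub_cancel_left, map_add] at this
    linarith [S.R_add_le (S.j v) (S.j w)]
  · rintro ⟨h1, h2⟩ w
    rw [map_sub]
    linarith [h1 w]

theorem subdiff_apply_self (S : ViscousSystem Z V X) {v : V} {η : StrongDual ℝ V}
    (h : η ∈ S.subdiff v) : η v = S.R (S.j v) :=
  le_antisymm ((S.mem_subdiff_iff.1 h).1 v) (S.mem_subdiff_iff.1 h).2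

theorem subdiff_subset_subdiff_zero (S : ViscousSystem Z V X) (v : V) :
    S.subdiff v ⊆ S.subdiff 0 := fun η h =>
  S.mem_subdiff_iff.2 ⟨(S.mem_subdiff_iff.1 h).1, by simp [S.R_zero]⟩

theorem zero_mem_subdiff_zero (S : ViscousSystem Z V X) : 0 ∈ S.subdiff 0 :=
  S.mem_subdiff_iff.2 ⟨fun w => by simpa using S.R_nonneg _, by simp [S.R_zero]⟩

theorem subdiff_monotone (S : ViscousSystem Z V X) {v₁ v₂ : V} {η₁ η₂ : StrongDual ℝ V}
    (h₁ : η₁ ∈ S.subdiff v₁) (h₂ : η₂ ∈ S.subdiff v₂) : 0 ≤ (η₁ - η₂) (v₁ - v₂) := by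
  have a := (S.mem_subdiff_iff.1 h₁).1 v₂
  have b := (S.mem_subdiff_iff.1 h₂).1 v₁
  rw [sub_apply, map_sub, map_sub, S.subdiff_apply_self h₁, S.subdiff_apply_self h₂]
  linarith

theorem exists_R_le (S : ViscousSystem Z V X) :
    ∃ K : ℝ, 0 < K ∧ ∀ v, S.R (S.j v) ≤ K * ‖v‖ := by
  obtain ⟨c, C, hc, hC, h⟩ := S.R_bounds
  refine ⟨C * (‖S.j‖ + 1), by positivity, fun v => ((h _).2).trans ?_⟩
  rw [mul_assoc]
  gcongr
  refine (S.j.le_opNorm v).trans ?_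
  gcongr
  linarith

theorem norm_le_of_le_R (S : ViscousSystem Z V X) {K : ℝ} (hK : 0 ≤ K)
    (hR : ∀ v, S.R (S.j v) ≤ K * ‖v‖) {η : StrongDual ℝ V} (h : ∀ w, η w ≤ S.R (S.j w)) :
    ‖η‖ ≤ K := by
  refine η.opNorm_le_bound hK fun w => abs_le.2 ⟨?_, (h w).trans (hR w)⟩
  have := (h (-w)).trans (hR (-w))
  rw [norm_neg, map_neg] at this
  linarith

theorem isBounded_subdiff_zero (S : ViscousSystem Z V X) :
    Bornology.IsBounded (S.subdiff 0) := by
  obtain ⟨K, hK, hR⟩ := S.exists_R_le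
  refine isBounded_iff_forall_norm_le.2 ⟨K, fun η hη => ?_⟩
  exact S.norm_le_of_le_R hK.le hR (S.mem_subdiff_iff.1 hη).1

/-- The growth bound on `D²F` is uniform on balls, so the mean value inequality applies. Using `|M|`
keeps the real power meaningful for every `M`. -/
theorem exists_lipschitz_G (S : ViscousSystem Z V X) (M : ℝ) :
    ∃ L : ℝ, 0 ≤ L ∧ ∀ z w : Z, ‖z‖ ≤ M → ‖w‖ ≤ M → ‖S.G z - S.G w‖ ≤ L * ‖z - w‖ := by
  obtain ⟨C, q, hq, h⟩ := S.F_lowerOrder.choose_spec.2.2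
  refine ⟨|C| * (1 + |M| ^ q), by positivity, fun z w hz hw => ?_⟩
  have := (convex_closedBall (0 : Z) M).norm_image_sub_le_of_norm_fderiv_le (𝕜 := ℝ) (f := S.G)
    (C := |C| * (1 + |M| ^ q)) (x := w) (y := z)
    (fun x _ => (S.contDiff_G.differentiable one_ne_zero) x) (fun x hx => ?_)
    (by simpa using hw) (by simpa using hz)
  · exact this
  · refine ContinuousLinearMap.opNorm_le_bound _ (by positivity) fun y => (h x y).trans ?_
    have hx' : ‖x‖ ≤ |M| := (by simpa using hx : ‖x‖ ≤ M).trans (le_abs_self M)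
    gcongr
    exact le_abs_self C

theorem continuous_DI (S : ViscousSystem Z V X) : Continuous S.DI := by
  have : S.DI = fun z => S.A z + (S.G z).comp S.ι := by
    ext z w
    rw [DI_apply]
    rfl
  rw [this]
  exact S.A.continuous.add (S.continuous_G.clm_comp continuous_const)

theorem Represents.unique {S : ViscousSystem Z V X} {ξ₁ ξ₂ : StrongDual ℝ V} {ζ : StrongDual ℝ Z}
    (h₁ : S.Represents ξ₁ ζ) (h₂ : S.Represents ξ₂ ζ) : ξ₁ = ξ₂ := by
  ext v
  refine congrFun (S.ι_denseRange.equalizer ξ₁.continuous ξ₂.continuous (funext fun w => ?_)) v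
  simp only [Function.comp_apply, h₁ w, h₂ w]

theorem visc_nonneg (S : ViscousSystem Z V X) (v : V) : 0 ≤ S.visc v v := by
  obtain ⟨γ, hγ, h⟩ := S.visc_elliptic
  exact (by positivity : (0 : ℝ) ≤ γ * ‖v‖ ^ 2).trans (h v)

theorem A_nonneg (S : ViscousSystem Z V X) (z : Z) : 0 ≤ S.A z z := by
  obtain ⟨γ, hγ, h⟩ := S.A_elliptic
  exact (by positivity : (0 : ℝ) ≤ γ * ‖z‖ ^ 2).trans (h z)

end ViscousSystem

/-! ### Uniqueness: testing with averaged velocities -/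

theorem expAverage_le_of_le {φ : ℝ → ℝ} {c r t : ℝ} (hr : 0 ≤ r) (ht : 0 ≤ t) (hc : 0 ≤ c)
    (hφ : IntervalIntegrable φ volume 0 t) (h : ∀ s ∈ Icc 0 t, φ s ≤ c) :
    expAverage r φ t ≤ c := by
  have hci : IntervalIntegrable (fun _ : ℝ => c) volume 0 t := by simp
  have h1 : ∫ s in (0 : ℝ)..t, Real.exp (r * s) • φ s ≤
      ∫ s in (0 : ℝ)..t, Real.exp (r * s) • c := by
    refine intervalIntegral.integral_mono_on ht (hφ.exp_smul r) (hci.exp_smul r) fun s hs => ?_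
    exact smul_le_smul_of_nonneg_left (h s hs) (Real.exp_pos _).le
  have h2 : r * ∫ s in (0 : ℝ)..t, Real.exp (r * s) • c = (Real.exp (r * t) - 1) * c := by
    have hd : ∀ x ∈ uIcc 0 t, HasDerivAt (fun s : ℝ => Real.exp (r * s) * c)
        (r * (Real.exp (r * x) * c)) x := fun x _ => by
      have := (((hasDerivAt_id x).const_mul r).exp).mul_const c
      refine this.congr_deriv ?_
      simp only [id]
      ring
    have := intervalIntegral.integral_eq_sub_of_hasDerivAt hd
      (Continuous.intervalIntegrable (by fun_prop) _ _)
    rw [intervalIntegral.integral_const_mul] at this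
    simp only [smul_eq_mul]
    rw [this]
    simp
    ring
  calc expAverage r φ t
      ≤ (r * Real.exp (-(r * t))) * ∫ s in (0 : ℝ)..t, Real.exp (r * s) • c := by
        unfold expAverage
        rw [smul_eq_mul]
        gcongr
    _ = Real.exp (-(r * t)) * ((Real.exp (r * t) - 1) * c) := by rw [← h2]; ring
    _ = (1 - Real.exp (-(r * t))) * c := by
        have h6 : Real.exp (-(r * t)) * Real.exp (r * t) = 1 := by
          rw [← Real.exp_add]; simp
        linear_combination c * h6
    -- The weight has total mass `1 - e^{-rt}`, less than one; the sign of `c` compensates for the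
    -- deficit.
    _ ≤ c := by nlinarith [mul_nonneg (Real.exp_pos (-(r * t))).le hc]

theorem ContinuousLinearMap.map_expAverage {E F : Type*} [NormedAddCommGroup E] [NormedSpace ℝ E]
    [NormedAddCommGroup F] [NormedSpace ℝ F] [CompleteSpace E] [CompleteSpace F]
    (p : E →L[ℝ] F) {u : ℝ → E} {t : ℝ} (r : ℝ)
    (hu : IntervalIntegrable u volume 0 t) :
    p (expAverage r u t) = expAverage r (fun s => p (u s)) t := by
  unfold expAverage
  rw [map_smul, ← p.intervalIntegral_comp_comm (hu.exp_smul r)]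
  simp only [map_smul]

namespace ViscousSystem

variable {Z V X : Type*}
  [NormedAddCommGroup Z] [InnerProductSpace ℝ Z]
  [NormedAddCommGroup V] [InnerProductSpace ℝ V]
  [NormedAddCommGroup X] [NormedSpace ℝ X]

theorem IsSolution.intervalIntegrable {S : ViscousSystem Z V X} {ℓ : StrongDual ℝ V} {z₀ : Z}
    {z : ℝ → Z} {v : ℝ → V} (h : S.IsSolution ℓ z₀ z v) {T : ℝ} (hT : 0 ≤ T) :
    IntervalIntegrable v volume 0 T := by
  rw [intervalIntegrable_iff_integrableOn_Ioo_of_le hT]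
  exact (h.integrable (T + 1) (by linarith)).mono_set (Ioo_subset_Ioo_right (by linarith))

theorem IsSolution.exists_norm_le {S : ViscousSystem Z V X} {ℓ : StrongDual ℝ V} {z₀ : Z}
    {z : ℝ → Z} {v : ℝ → V} (h : S.IsSolution ℓ z₀ z v) :
    ∃ M : ℝ, ∀ᵐ t ∂(volume.restrict (Ioi (0 : ℝ))), ‖z t‖ ≤ M := by
  refine ⟨(eLpNorm z ∞ (volume.restrict (Ioi 0))).toReal, ?_⟩
  filter_upwards [ae_le_eLpNormEssSup (f := z) (μ := volume.restrict (Ioi 0))] with t ht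
  rw [← toReal_enorm]
  rw [← eLpNorm_exponent_top] at ht
  exact ENNReal.toReal_mono h.memLp.2.ne ht

/-- A convexity inequality for the quadratic form of `A` along a path whose increments are given
by a primitive, averaged in time. -/
theorem sub_expAverage_quadratic_le [CompleteSpace V] (S : ViscousSystem Z V X) {w : ℝ → Z}
    {g : ℝ → V} {p : StrongDual ℝ V} {r t : ℝ} (hr : 0 < r) (ht : 0 ≤ t) (hw0 : w 0 = 0)
    (hg : IntervalIntegrable g volume 0 t)
    (hw : ∀ s ∈ uIcc 0 t, S.ι (w s) = ∫ x in (0 : ℝ)..s, g x)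
    (hf : IntervalIntegrable (fun s => 1 / 2 * S.A (w s) (w s)) volume 0 t)
    (hp : ∀ x, p (S.ι x) = S.A (w t) x) :
    r * (1 / 2 * S.A (w t) (w t) - expAverage r (fun s => 1 / 2 * S.A (w s) (w s)) t) ≤
      p (expAverage r g t) := by
  have hconv : ∀ s, 1 / 2 * S.A (w t) (w t) - 1 / 2 * S.A (w s) (w s) ≤
      p (S.ι (w t)) - p (S.ι (w s)) := fun s => by
    have h := S.A_nonneg (w t - w s)
    simp only [map_sub, sub_apply] at h
    rw [hp, hp]
    rw [S.A_symm (w s) (w t)] at h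
    linarith
  have hui : IntervalIntegrable (fun s => S.ι (w s)) volume 0 t :=
    ((continuousOn_primitive_zero hg).congr fun s hs => hw s hs).intervalIntegrable
  have hpu : IntervalIntegrable (fun s => p (S.ι (w s))) volume 0 t :=
    ((p.continuous.comp_continuousOn (continuousOn_primitive_zero hg)).congr
      fun s hs => by simp only [hw s hs, Function.comp_apply]).intervalIntegrable
  -- Since `w 0 = 0`, the convexity inequality at `s = 0` says that the upper bound to be averaged
  -- is nonnegative, as the deficient mass of the weight requires.
  have h0 := hconv 0
  rw [hw0, map_zero, map_zero, map_zero] at h0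
  have h1 : expAverage r (fun s => p (S.ι (w s)) - 1 / 2 * S.A (w s) (w s)) t ≤
      p (S.ι (w t)) - 1 / 2 * S.A (w t) (w t) := by
    refine expAverage_le_of_le hr.le ht (by linarith) (hpu.sub hf) fun s _ => ?_
    linarith [hconv s]
  rw [expAverage_sub r hpu hf, ← p.map_expAverage r hui] at h1
  have h2 := sub_expAverage_of_primitive (x₀ := (0 : V)) (u := fun s => S.ι (w s)) r hg
    (fun s hs => by rw [zero_add, hw s hs])
  rw [smul_zero, zero_add] at h2
  rw [← h2, map_smul, map_sub, smul_eq_mul]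
  exact mul_le_mul_of_nonneg_left (by linarith) hr.le

/-- With `y` the average, `𝕍 y (g - y) = r⁻¹ 𝕍 y y'` is the derivative of `(2r)⁻¹ 𝕍 y y`, which
starts from zero. Replacing `𝕍 g y` by `𝕍 y y` in an integral therefore loses nothing. -/
theorem integral_visc_expAverage_le [CompleteSpace V] (S : ViscousSystem Z V X)
    {g : ℝ → V} {r T : ℝ} (hr : 0 < r) (hg : IntervalIntegrable g volume 0 T) :
    IntervalIntegrable (fun t => S.visc (expAverage r g t) (expAverage r g t) -
      S.visc (expAverage r g t) (g t)) volume 0 T ∧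
    ∫ t in (0 : ℝ)..T, (S.visc (expAverage r g t) (expAverage r g t) -
      S.visc (expAverage r g t) (g t)) ≤ 0 := by
  have hi := (hg.sub (intervalIntegrable_expAverage r hg)).smul r
  obtain ⟨h1, h2⟩ := bilin_primitive_self S.visc S.visc_symm (u := expAverage r g) hi
    fun t ht => expAverage_eq_integral r (hg.mono_zero ht)
  have he : (fun t => S.visc (expAverage r g t) (expAverage r g t) -
      S.visc (expAverage r g t) (g t)) =
      fun t => (-r⁻¹) * S.visc (expAverage r g t) (r • (g t - expAverage r g t)) := by
    ext t
    rw [map_smul, map_sub, smul_eq_mul]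
    field_simp
    ring
  have h3 := S.visc_nonneg (expAverage r g T)
  have h1' : IntervalIntegrable (fun t => S.visc (expAverage r g t)
    (r • (g t - expAverage r g t))) volume 0 T := h1
  have h2' : S.visc (expAverage r g T) (expAverage r g T) =
    2 * ∫ t in (0 : ℝ)..T, S.visc (expAverage r g t) (r • (g t - expAverage r g t)) := h2
  rw [he]
  refine ⟨h1'.const_mul _, ?_⟩
  rw [intervalIntegral.integral_const_mul]
  have : 0 < r⁻¹ := inv_pos.2 hr
  nlinarith

/-- Pointwise estimate of the difference of two solutions. -/
theorem inclusion_difference (S : ViscousSystem Z V X) {ℓ : StrongDual ℝ V} {z₁ z₂ : Z}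
    {v₁ v₂ : V} (h₁ : S.Inclusion ℓ z₁ v₁) (h₂ : S.Inclusion ℓ z₂ v₂) {K : ℝ} (hK : 0 ≤ K)
    (hR : ∀ v, S.R (S.j v) ≤ K * ‖v‖) :
    ∃ p : StrongDual ℝ V, (∀ x, p (S.ι x) = S.A (z₁ - z₂) x) ∧
      ∀ y, p y ≤ 2 * K * ‖(v₁ - v₂) - y‖ - S.visc (v₁ - v₂) y + ‖S.G z₁ - S.G z₂‖ * ‖y‖ := by
  obtain ⟨η₁, hη₁, e₁⟩ := h₁
  obtain ⟨η₂, hη₂, e₂⟩ := h₂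
  -- Every other term of the inclusion lies in `V*`, so `A (z₁ - z₂)` does too and may be paired
  -- with averages that take values in `V` only.
  refine ⟨-(η₁ - η₂) - S.visc (v₁ - v₂) - (S.G z₁ - S.G z₂), fun x => ?_, fun y => ?_⟩
  · have a := e₁ x
    have b := e₂ x
    rw [DI_apply] at a b
    simp only [sub_apply, neg_apply, map_sub]
    linarith
  · have hm := S.subdiff_monotone hη₁ hη₂
    -- Monotonicity takes care of the pairing with `v₁ - v₂`; only the deviation of `y` from it is
    -- estimated by norms.
    have h1 : (η₁ - η₂) ((v₁ - v₂) - y) ≤ 2 * K * ‖(v₁ - v₂) - y‖ := by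
      refine (le_abs_self _).trans (((η₁ - η₂).le_opNorm _).trans ?_)
      gcongr
      have a := S.norm_le_of_le_R hK hR (S.mem_subdiff_iff.1 hη₁).1
      have b := S.norm_le_of_le_R hK hR (S.mem_subdiff_iff.1 hη₂).1
      linarith [norm_sub_le η₁ η₂]
    have h2 : -((S.G z₁ - S.G z₂) y) ≤ ‖S.G z₁ - S.G z₂‖ * ‖y‖ :=
      (neg_le_abs _).trans ((S.G z₁ - S.G z₂).le_opNorm y)
    rw [map_sub] at h1
    change -((η₁ - η₂) y) - S.visc (v₁ - v₂) y - (S.G z₁ - S.G z₂) y ≤ _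
    linarith

/-- Young's inequality, weighted so that the part in `y` is absorbed by the full viscous form and
the part in `w` becomes a Grönwall term. -/
theorem exists_mul_norm_le_visc_add (S : ViscousSystem Z V X) (L : ℝ) :
    ∃ c : ℝ, 0 ≤ c ∧ ∀ (w : Z) (y : V),
      L * ‖w‖ * ‖y‖ ≤ S.visc y y + c * (1 / 2 * S.A w w) := by
  obtain ⟨α, hα, hA⟩ := S.A_elliptic
  obtain ⟨γ, hγ, hV⟩ := S.visc_elliptic
  refine ⟨L ^ 2 / (2 * γ * α), by positivity, fun w y => ?_⟩
  have h1 : L * ‖w‖ * ‖y‖ ≤ γ * ‖y‖ ^ 2 + L ^ 2 / (4 * γ) * ‖w‖ ^ 2 := by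
    have : 0 ≤ γ * (‖y‖ - L / (2 * γ) * ‖w‖) ^ 2 := by positivity
    have e : γ * (‖y‖ - L / (2 * γ) * ‖w‖) ^ 2 =
      γ * ‖y‖ ^ 2 + L ^ 2 / (4 * γ) * ‖w‖ ^ 2 - L * ‖w‖ * ‖y‖ := by
      field_simp
      ring
    linarith
  have h2 : L ^ 2 / (4 * γ) * ‖w‖ ^ 2 ≤ L ^ 2 / (2 * γ * α) * (1 / 2 * S.A w w) := by
    have e : L ^ 2 / (4 * γ) * ‖w‖ ^ 2 = L ^ 2 / (2 * γ * α) * (1 / 2 * (α * ‖w‖ ^ 2)) := by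
      field_simp
      ring
    rw [e]
    gcongr
    exact hA w
  linarith [hV y]

theorem IsSolution.eqOn [CompleteSpace V] {S : ViscousSystem Z V X} {ℓ : StrongDual ℝ V} {z₀ : Z}
    {z₁ z₂ : ℝ → Z} {v₁ v₂ : ℝ → V} (h₁ : S.IsSolution ℓ z₀ z₁ v₁)
    (h₂ : S.IsSolution ℓ z₀ z₂ v₂) : EqOn z₁ z₂ (Ici 0) := by
  obtain ⟨M₁, hM₁⟩ := h₁.exists_norm_le
  obtain ⟨M₂, hM₂⟩ := h₂.exists_norm_le
  obtain ⟨L, hL, hGL⟩ := S.exists_lipschitz_G (max M₁ M₂)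
  obtain ⟨K, hK, hR⟩ := S.exists_R_le
  obtain ⟨c, hc, hLc⟩ := S.exists_mul_norm_le_visc_add L
  obtain ⟨α, hα, hA⟩ := S.A_elliptic
  set w : ℝ → Z := fun t => z₁ t - z₂ t with hwdef
  set g : ℝ → V := fun t => v₁ t - v₂ t with hgdef
  set f : ℝ → ℝ := fun t => 1 / 2 * S.A (w t) (w t) with hfdef
  have hw0 : w 0 = 0 := by simp [w, h₁.initial, h₂.initial]
  have hgi : ∀ T, 0 ≤ T → IntervalIntegrable g volume 0 T := fun T hT =>
    (h₁.intervalIntegrable hT).sub (h₂.intervalIntegrable hT)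
  have hwp : ∀ t, 0 ≤ t → S.ι (w t) = ∫ x in (0 : ℝ)..t, g x := fun t ht => by
    rw [intervalIntegral.integral_sub (h₁.intervalIntegrable ht) (h₂.intervalIntegrable ht),
      map_sub, h₁.primitive t ht, h₂.primitive t ht, h₁.initial, h₂.initial]
    abel
  have hwm : AEStronglyMeasurable w (volume.restrict (Ioi 0)) := h₁.memLp.1.sub h₂.memLp.1
  have hfm : AEStronglyMeasurable f (volume.restrict (Ioi 0)) := by
    have hcont : Continuous fun z : Z => 1 / 2 * S.A z z := by fun_prop
    exact hcont.comp_aestronglyMeasurable hwm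
  have hfi : ∀ T, 0 ≤ T → IntervalIntegrable f volume 0 T := fun T hT => by
    rw [intervalIntegrable_iff_integrableOn_Ioc_of_le hT]
    refine Integrable.of_bound (hfm.mono_set Ioc_subset_Ioi_self)
      (1 / 2 * (‖S.A‖ * (M₁ + M₂) * (M₁ + M₂))) ?_
    filter_upwards [ae_restrict_of_ae_restrict_of_subset Ioc_subset_Ioi_self hM₁,
      ae_restrict_of_ae_restrict_of_subset Ioc_subset_Ioi_self hM₂] with t a b
    have hn : ‖w t‖ ≤ M₁ + M₂ := (norm_sub_le _ _).trans (add_le_add a b)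
    rw [hfdef, norm_mul, Real.norm_of_nonneg (by norm_num : (0 : ℝ) ≤ 1 / 2)]
    have h0 : 0 ≤ M₁ + M₂ := (norm_nonneg _).trans hn
    gcongr
    exact (S.A.le_opNorm₂ _ _).trans (by gcongr)
  have hf0 : ∀ t, 0 ≤ f t := fun t => by have := S.A_nonneg (w t); simp only [f]; linarith
  set H : ℝ → ℝ := fun T => ∫ t in (0 : ℝ)..T, f t with hHdef
  -- the averaged energy estimate
  have key : ∀ r T, 0 < r → 0 ≤ T → expAverage r f T ≤
      2 * K * (∫ t in (0 : ℝ)..T, ‖g t - expAverage r g t‖) + c * H T := by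
    intro r T hr hT
    have hyi := intervalIntegrable_expAverage r (hgi T hT)
    obtain ⟨hVi, hV⟩ := S.integral_visc_expAverage_le hr (hgi T hT)
    have hni := ((hgi T hT).sub hyi).norm
    rw [expAverage_eq_integral r (hfi T hT)]
    have hle : ∫ s in (0 : ℝ)..T, r • (f s - expAverage r f s) ≤
        ∫ s in (0 : ℝ)..T, (2 * K * ‖g s - expAverage r g s‖ +
          (S.visc (expAverage r g s) (expAverage r g s) - S.visc (expAverage r g s) (g s)) +
          c * f s) := by
      refine intervalIntegral.integral_mono_ae_restrict hT
        (((hfi T hT).sub (intervalIntegrable_expAverage r (hfi T hT))).smul r)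
        (((hni.const_mul _).add hVi).add ((hfi T hT).const_mul c)) ?_
      rw [Filter.EventuallyLE, restrict_Ioc_eq_restrict_Icc.symm]
      have hsub : Ioc 0 T ⊆ Ioi 0 := Ioc_subset_Ioi_self
      filter_upwards [ae_restrict_of_ae_restrict_of_subset hsub hM₁,
        ae_restrict_of_ae_restrict_of_subset hsub hM₂,
        ae_restrict_of_ae_restrict_of_subset hsub h₁.inclusion,
        ae_restrict_of_ae_restrict_of_subset hsub h₂.inclusion,
        ae_restrict_mem measurableSet_Ioc] with t b₁ b₂ i₁ i₂ ht
      obtain ⟨p, hp, hpy⟩ := S.inclusion_difference i₁ i₂ hK.le hR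
      have hq := S.sub_expAverage_quadratic_le (w := w) (g := g) (p := p) hr ht.1.le hw0
        (hgi t ht.1.le) (fun s hs => hwp s (by rw [uIcc_of_le ht.1.le] at hs; exact hs.1))
        (hfi t ht.1.le) hp
      have h3 := hpy (expAverage r g t)
      have h4 := hGL _ _ (b₁.trans (le_max_left _ _)) (b₂.trans (le_max_right _ _))
      have h5 : ‖S.G (z₁ t) - S.G (z₂ t)‖ * ‖expAverage r g t‖ ≤
          L * ‖w t‖ * ‖expAverage r g t‖ := by gcongr
      have h6 := hLc (w t) (expAverage r g t)
      have h7 := S.visc_symm (g t) (expAverage r g t)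
      change r * (f t - expAverage r f t) ≤ _
      change r * (f t - expAverage r f t) ≤ _ at hq
      change _ ≤ 2 * K * ‖g t - expAverage r g t‖ - S.visc (g t) (expAverage r g t) + _ at h3
      change _ ≤ S.visc _ _ + c * f t at h6
      linarith
    rw [intervalIntegral.integral_add ((hni.const_mul _).add hVi) ((hfi T hT).const_mul c),
      intervalIntegral.integral_add (hni.const_mul _) hVi, intervalIntegral.integral_const_mul,
      intervalIntegral.integral_const_mul] at hle
    linarith
  have hHmono : ∀ s t, 0 ≤ s → s ≤ t → H s ≤ H t := fun s t hs hst =>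
    intervalIntegral.integral_mono_interval le_rfl hs hst
      (Eventually.of_forall hf0) (hfi t (hs.trans hst))
  have hHcont : ∀ T, 0 ≤ T → ContinuousOn H (Icc 0 T) := fun T hT => by
    have := continuousOn_primitive_zero (hfi T hT)
    rwa [uIcc_of_le hT] at this
  -- The energy estimate controls the average of `f` at time `T`, not `f T`. Integrated over time,
  -- the average differs from `f` only by `r⁻¹` times its final value, which vanishes as `r → ∞`.
  have hHle : ∀ T, 0 ≤ T → H T ≤ 0 + c * ∫ s in (0 : ℝ)..T, H s := by
    intro T hT
    have hHi : IntervalIntegrable H volume 0 T := (hHcont T hT).intervalIntegrable_of_Icc hT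
    have htend := tendsto_integral_norm_expAverage_sub hT (hgi T hT)
    have hlim : Tendsto (fun r : ℝ => r⁻¹ * (2 * K *
        (∫ t in (0 : ℝ)..T, ‖g t - expAverage r g t‖) + c * H T) +
        (T * (2 * K * (∫ t in (0 : ℝ)..T, ‖g t - expAverage r g t‖)) +
          c * ∫ s in (0 : ℝ)..T, H s)) atTop
        (𝓝 (0 * (2 * K * 0 + c * H T) + (T * (2 * K * 0) + c * ∫ s in (0 : ℝ)..T, H s))) :=
      (tendsto_inv_atTop_zero.mul ((htend.const_mul _).add_const _)).add
        (((htend.const_mul _).const_mul _).add_const _)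
    have hle := ge_of_tendsto hlim ((eventually_gt_atTop 0).mono fun r hr => ?_) (b := H T)
    · simpa using hle
    have hfa := intervalIntegrable_expAverage r (hfi T hT)
    set D := ∫ t in (0 : ℝ)..T, ‖g t - expAverage r g t‖
    have h1 := key r T hr hT
    have h2 : H T = (∫ s in (0 : ℝ)..T, expAverage r f s) + r⁻¹ * expAverage r f T := by
      have := expAverage_eq_integral r (hfi T hT)
      rw [intervalIntegral.integral_smul, intervalIntegral.integral_sub (hfi T hT) hfa,
        smul_eq_mul] at this
      rw [this, ← mul_assoc, inv_mul_cancel₀ hr.ne']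
      simp only [H]
      ring
    have h3 : ∫ s in (0 : ℝ)..T, expAverage r f s ≤
        ∫ s in (0 : ℝ)..T, (2 * K * D + c * H s) := by
      refine intervalIntegral.integral_mono_on hT hfa
        (intervalIntegrable_const.add (hHi.const_mul c)) fun s hs => ?_
      refine (key r s hr hs.1).trans ?_
      gcongr
      exact intervalIntegral.integral_mono_interval le_rfl hs.1 hs.2
        (Eventually.of_forall fun _ => norm_nonneg _)
        ((hgi T hT).sub (intervalIntegrable_expAverage r (hgi T hT))).norm
    rw [intervalIntegral.integral_add intervalIntegrable_const (hHi.const_mul c),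
      intervalIntegral.integral_const, intervalIntegral.integral_const_mul, sub_zero,
      smul_eq_mul] at h3
    have h4 : r⁻¹ * expAverage r f T ≤ r⁻¹ * (2 * K * D + c * H T) := by gcongr
    linarith
  intro T hT
  rw [mem_Ici] at hT
  rcases hT.eq_or_lt with rfl | hTpos
  · rw [h₁.initial, h₂.initial]
  have hH0 : H T ≤ 0 := by
    simpa using le_mul_exp_of_le_add_integral hc (hHcont T hT)
      (fun t ht => hHle t ht.1) T ⟨hT, le_rfl⟩
  have hH0' : H T = 0 :=
    le_antisymm hH0 (intervalIntegral.integral_nonneg hT fun t _ => hf0 t)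
  have hae : f =ᵐ[volume.restrict (Ioc 0 T)] 0 :=
    (intervalIntegral.integral_eq_zero_iff_of_le_of_nonneg_ae hT
      (Eventually.of_forall hf0) (hfi T hT)).1 hH0'
  -- The energy vanishes almost everywhere only. Continuity of `ι ∘ w` and injectivity of `ι` extend
  -- this to every time.
  have hae2 : (fun t => S.ι (w t)) =ᵐ[volume.restrict (Icc 0 T)] fun _ => 0 := by
    rw [restrict_Ioc_eq_restrict_Icc.symm]
    filter_upwards [hae] with t ht
    have h1 := hA (w t)
    have h2 : f t = 0 := ht
    have h3 : ‖w t‖ ^ 2 ≤ 0 := by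
      simp only [f] at h2
      nlinarith [sq_nonneg ‖w t‖]
    have h4 : w t = 0 := by
      rw [← norm_eq_zero]
      exact pow_eq_zero_iff two_ne_zero |>.1 (le_antisymm h3 (sq_nonneg _))
    rw [h4, map_zero]
  have hcu : ContinuousOn (fun t => S.ι (w t)) (Icc 0 T) := by
    have := continuousOn_primitive_zero (hgi T hT)
    rw [uIcc_of_le hT] at this
    exact this.congr fun t ht => hwp t ht.1
  have := Measure.eqOn_Icc_of_ae_eq volume hTpos.ne hae2 hcu continuousOn_const
    (right_mem_Icc.2 hT)
  have hz : w T = 0 := S.ι_injective (by simpa using this)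
  exact sub_eq_zero.1 hz

end ViscousSystem

/-! ### Compactness, the direct method and closedness of the inclusion -/

theorem exists_subseq_weak_limit {Z : Type*} [NormedAddCommGroup Z] [InnerProductSpace ℝ Z]
    [CompleteSpace Z] [TopologicalSpace.SeparableSpace Z] {u : ℕ → Z} {M : ℝ}
    (hu : ∀ n, ‖u n‖ ≤ M) :
    ∃ (z : Z) (φ : ℕ → ℕ), StrictMono φ ∧
      ∀ f : StrongDual ℝ Z, Tendsto (fun n => f (u (φ n))) atTop (𝓝 (f z)) := by
  obtain ⟨ζ, -, φ, hφ, hlim⟩ := WeakDual.isSeqCompact_closedBall ℝ Z 0 M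
    (x := fun n => StrongDual.toWeakDual (InnerProductSpace.toDual ℝ Z (u n)))
    (fun n => by
      change InnerProductSpace.toDual ℝ Z (u n) ∈ Metric.closedBall 0 M
      simpa using hu n)
  refine ⟨(InnerProductSpace.toDual ℝ Z).symm (WeakDual.toStrongDual ζ), φ, hφ, fun f => ?_⟩
  obtain ⟨y, rfl⟩ := (InnerProductSpace.toDual ℝ Z).surjective f
  have h := ((WeakDual.eval_continuous (𝕜 := ℝ) y).tendsto ζ).comp hlim
  have e : ∀ x : Z, InnerProductSpace.toDual ℝ Z y x = InnerProductSpace.toDual ℝ Z x y :=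
    fun x => by simp [real_inner_comm]
  simp only [e, LinearIsometryEquiv.apply_symm_apply]
  exact h

namespace ViscousSystem

variable {Z V X : Type*}
  [NormedAddCommGroup Z] [InnerProductSpace ℝ Z]
  [NormedAddCommGroup V] [InnerProductSpace ℝ V]
  [NormedAddCommGroup X] [NormedSpace ℝ X]

theorem exists_subseq_tendsto_ι (S : ViscousSystem Z V X) {u : ℕ → Z} {M : ℝ}
    (hu : ∀ n, ‖u n‖ ≤ M) :
    ∃ (v : V) (φ : ℕ → ℕ), StrictMono φ ∧ Tendsto (fun n => S.ι (u (φ n))) atTop (𝓝 v) := by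
  have hc := S.ι_compact.isCompact_closure_image_closedBall (𝕜₁ := ℝ) M
  obtain ⟨v, -, φ, hφ, h⟩ := hc.tendsto_subseq (x := fun n => S.ι (u n)) fun n =>
    subset_closure (mem_image_of_mem _ (by simpa using hu n))
  exact ⟨v, φ, hφ, h⟩

/-- Compactness of `ι` yields a strong limit in `V` along a further subsequence; functionals on `V`
identify it with the image of the weak limit. -/
theorem exists_subseq_weak_limit_ι [CompleteSpace Z] [TopologicalSpace.SeparableSpace Z]
    (S : ViscousSystem Z V X) {u : ℕ → Z} {M : ℝ} (hu : ∀ n, ‖u n‖ ≤ M) :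
    ∃ (z : Z) (φ : ℕ → ℕ), StrictMono φ ∧
      (∀ f : StrongDual ℝ Z, Tendsto (fun n => f (u (φ n))) atTop (𝓝 (f z))) ∧
      Tendsto (fun n => S.ι (u (φ n))) atTop (𝓝 (S.ι z)) := by
  obtain ⟨z, φ, hφ, hw⟩ := exists_subseq_weak_limit hu
  obtain ⟨v, ψ, hψ, hv⟩ := S.exists_subseq_tendsto_ι (fun n => hu (φ n))
  have hvz : v = S.ι z := by
    refine (SeparatingDual.eq_iff_forall_dual_eq (R := ℝ)).2 fun f => ?_
    exact tendsto_nhds_unique ((f.continuous.tendsto v).comp hv)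
      ((hw (f.comp S.ι)).comp hψ.tendsto_atTop)
  exact ⟨z, φ ∘ ψ, hφ.comp hψ, fun f => (hw f).comp hψ.tendsto_atTop, hvz ▸ hv⟩

/-- Ehrling's inequality. -/
theorem exists_norm_ι_le (S : ViscousSystem Z V X) {ε : ℝ} (hε : 0 < ε) :
    ∃ C : ℝ, 0 ≤ C ∧ ∀ z : Z, ‖S.ι z‖ ≤ ε * ‖z‖ + C * S.R (S.j (S.ι z)) := by
  -- Counterexamples with constants `n`, normalized in `Z`, have images converging in `V` to some
  -- `v` with `‖v‖ ≥ ε`, while `R` along them tends to zero. Hence `j v = 0`, contradicting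
  -- injectivity of `j`.
  by_contra! hcon
  obtain ⟨c, C, hc, -, hRc⟩ := S.R_bounds
  choose u hu using fun n : ℕ => hcon n n.cast_nonneg
  have hRn : ∀ z, 0 ≤ S.R z := S.R_nonneg
  have hpos : ∀ n, 0 < ‖u n‖ := fun n => by
    refine norm_pos_iff.2 fun h0 => ?_
    have := hu n
    simp [h0, S.R_zero] at this
  have hyn : ∀ n, ‖(‖u n‖⁻¹ • u n)‖ = 1 := fun n => by
    rw [norm_smul, norm_inv, norm_norm, inv_mul_cancel₀ (hpos n).ne']
  have hy : ∀ n : ℕ, ε + n * S.R (S.j (S.ι (‖u n‖⁻¹ • u n))) < ‖S.ι (‖u n‖⁻¹ • u n)‖ := fun n => by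
    have hi : 0 < ‖u n‖⁻¹ := inv_pos.2 (hpos n)
    rw [map_smul, map_smul, S.R_homogeneous _ _ hi, norm_smul, norm_inv, norm_norm]
    have := mul_lt_mul_of_pos_left (hu n) hi
    rw [mul_add] at this
    have e : ‖u n‖⁻¹ * (ε * ‖u n‖) = ε := by field_simp [(hpos n).ne']
    rw [e] at this
    linarith
  set y : ℕ → Z := fun n => ‖u n‖⁻¹ • u n with hydef
  obtain ⟨v, φ, hφ, hv⟩ := S.exists_subseq_tendsto_ι (u := y) (M := 1) fun n => (hyn n).le
  have hvε : ε ≤ ‖v‖ := ge_of_tendsto' hv.norm fun n => by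
    have := hy (φ n)
    have h2 : 0 ≤ (φ n : ℝ) * S.R (S.j (S.ι (y (φ n)))) := mul_nonneg (Nat.cast_nonneg _) (hRn _)
    linarith
  have hjv : ‖S.j v‖ ≤ 0 := by
    have h1 : Tendsto (fun n => ‖S.j (S.ι (y (φ n)))‖) atTop (𝓝 ‖S.j v‖) :=
      ((S.j.continuous.tendsto v).comp hv).norm
    have h2 : Tendsto (fun n : ℕ => ‖S.ι‖ / c * ((φ n : ℝ))⁻¹) atTop (𝓝 (‖S.ι‖ / c * 0)) :=
      (tendsto_inv_atTop_zero.comp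
        (tendsto_natCast_atTop_atTop.comp hφ.tendsto_atTop)).const_mul _
    rw [mul_zero] at h2
    refine le_of_tendsto_of_tendsto h1 h2 ((eventually_ge_atTop 1).mono fun n hn => ?_)
    have hφn : 0 < (φ n : ℝ) := by
      have : n ≤ φ n := hφ.id_le n
      exact_mod_cast lt_of_lt_of_le hn this
    have a := hy (φ n)
    have b := (hRc (S.j (S.ι (y (φ n))))).1
    have d : ‖S.ι (y (φ n))‖ ≤ ‖S.ι‖ := by
      have := S.ι.le_opNorm (y (φ n))
      rwa [show ‖y (φ n)‖ = 1 from hyn _, mul_one] at this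
    change ‖S.j (S.ι (y (φ n)))‖ ≤ ‖S.ι‖ / c * (φ n : ℝ)⁻¹
    rw [← div_eq_mul_inv, le_div_iff₀ hφn, le_div_iff₀ hc]
    change ε + (φ n : ℝ) * S.R (S.j (S.ι (y (φ n)))) < ‖S.ι (y (φ n))‖ at a
    nlinarith
  have : v = 0 := S.j_injective (by rw [map_zero]; exact norm_le_zero_iff.1 hjv)
  rw [this, norm_zero] at hvε
  linarith

/-- The direct method for the sum of the energy and a continuous function on `V`. -/
theorem exists_minimizer [CompleteSpace Z] [TopologicalSpace.SeparableSpace Z]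
    (S : ViscousSystem Z V X) {Φ : V → ℝ} (hΦ : Continuous Φ) {b : ℝ}
    (hb : ∀ z, -b * ‖z‖ ≤ Φ (S.ι z)) :
    ∃ z, ∀ y, S.I z + Φ (S.ι z) ≤ S.I y + Φ (S.ι y) := by
  obtain ⟨α, hα, hA⟩ := S.A_elliptic
  have hlow : ∀ z, α / 2 * ‖z‖ ^ 2 - b * ‖z‖ ≤ S.I z + Φ (S.ι z) := fun z => by
    have h1 := hA z
    have h2 := S.F_nonneg z
    have h3 := hb z
    unfold I
    linarith
  have hbdd : BddBelow (range fun z => S.I z + Φ (S.ι z)) := by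
    refine ⟨-(b ^ 2 / (2 * α)), ?_⟩
    rintro _ ⟨z, rfl⟩
    refine le_trans ?_ (hlow z)
    have : 0 ≤ α / 2 * (‖z‖ - b / α) ^ 2 := by positivity
    have e : α / 2 * (‖z‖ - b / α) ^ 2 = α / 2 * ‖z‖ ^ 2 - b * ‖z‖ + b ^ 2 / (2 * α) := by
      field_simp
      ring
    linarith
  obtain ⟨a, -, ha, hmem⟩ := exists_seq_tendsto_sInf (range_nonempty _) hbdd
  choose u hu using hmem
  obtain ⟨C, hC⟩ := ha.bddAbove_range
  have hEu : ∀ n, S.I (u n) + Φ (S.ι (u n)) ≤ C := fun n => by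
    have := hC (mem_range_self n)
    rw [← hu n] at this
    exact this
  -- Beyond this radius `‖u n‖ ≥ 1`, so the quadratic term beats `(|C| + |b|) ‖u n‖`, which
  -- dominates `C + b ‖u n‖`.
  have hun : ∀ n, ‖u n‖ ≤ 1 + 2 / α * (|C| + |b|) := fun n => by
    by_contra! hlt
    have h1 : 1 ≤ ‖u n‖ := by
      have : 0 ≤ 2 / α * (|C| + |b|) := by positivity
      linarith
    have h2 := (hlow (u n)).trans (hEu n)
    have h3 : |C| + |b| < α / 2 * ‖u n‖ := by
      have : 2 / α * (|C| + |b|) < ‖u n‖ := by linarith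
      rw [div_mul_eq_mul_div, div_lt_iff₀ hα] at this
      linarith
    have h4 := le_abs_self C
    have h5 := le_abs_self b
    have h6 : (|C| + |b|) * ‖u n‖ < α / 2 * ‖u n‖ * ‖u n‖ := by gcongr
    nlinarith [abs_nonneg C]
  obtain ⟨z, φ, hφ, hw, hs⟩ := S.exists_subseq_weak_limit_ι hun
  refine ⟨z, fun y => ?_⟩
  have hm : S.I z + Φ (S.ι z) ≤ sInf (range fun z => S.I z + Φ (S.ι z)) := by
    -- Weak lower semicontinuity: the quadratic part is replaced by its tangent at `z`, an affine
    -- minorant that converges weakly.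
    have h1 : Tendsto (fun n => S.A z (u (φ n)) - 1 / 2 * S.A z z + S.F (u (φ n)) +
        Φ (S.ι (u (φ n)))) atTop (𝓝 (S.A z z - 1 / 2 * S.A z z + S.F z + Φ (S.ι z))) :=
      (((hw (S.A z)).sub_const _).add (S.F_weak _ _ hw)).add ((hΦ.tendsto _).comp hs)
    have h2 := le_of_tendsto_of_tendsto' h1 (ha.comp hφ.tendsto_atTop) fun n => ?_
    · refine le_trans (le_of_eq ?_) h2
      unfold I
      ring
    · have h3 := S.A_nonneg (u (φ n) - z)
      simp only [map_sub, sub_apply] at h3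
      rw [S.A_symm (u (φ n)) z] at h3
      rw [Function.comp_apply, ← hu (φ n)]
      unfold I
      linarith
  exact hm.trans (csInf_le hbdd (mem_range_self y))

/-- A criterion for the differential inclusion which refers to test functions in `Z` only. -/
theorem inclusion_of_forall_le (S : ViscousSystem Z V X) {ℓ : StrongDual ℝ V} {z : Z} {v : V}
    {K : ℝ}
    (h₁ : ∀ w, ℓ (S.ι w) - S.visc v (S.ι w) - S.DI z w ≤ S.R (S.j (S.ι w)))
    (h₂ : ∀ w, S.R (S.j v) ≤
      ℓ (S.ι w) - S.visc v (S.ι w) - S.DI z w + K * ‖v - S.ι w‖) :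
    S.Inclusion ℓ z v := by
  obtain ⟨C, hC, hR⟩ := S.exists_R_le
  set ζ : StrongDual ℝ Z := ℓ.comp S.ι - (S.visc v).comp S.ι - S.DI z with hζ
  have hζa : ∀ w, ζ w = ℓ (S.ι w) - S.visc v (S.ι w) - S.DI z w := fun w => rfl
  have hb : ∀ w, ‖ζ w‖ ≤ C * ‖S.ι w‖ := fun w => by
    refine abs_le.2 ⟨?_, ?_⟩
    · have := (h₁ (-w)).trans (hR (S.ι (-w)))
      rw [← hζa, map_neg, map_neg, norm_neg] at this
      linarith
    · exact (hζa w ▸ h₁ w).trans (hR _)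
  -- Domination by `R` bounds `ζ` in the norm of `V`, so it extends from the dense range of `ι` to
  -- the required subgradient.
  set η : StrongDual ℝ V := (ζ : Z →ₗ[ℝ] ℝ).extendOfNorm (S.ι : Z →ₗ[ℝ] V)
  have hη : ∀ w, η (S.ι w) = ζ w := fun w =>
    LinearMap.extendOfNorm_eq (f := (ζ : Z →ₗ[ℝ] ℝ)) (e := (S.ι : Z →ₗ[ℝ] V))
      S.ι_denseRange ⟨C, hb⟩ w
  refine ⟨η, S.mem_subdiff_iff.2 ⟨fun y => ?_, ?_⟩, fun w => ?_⟩
  · refine S.ι_denseRange.induction_on (p := fun y => η y ≤ S.R (S.j y)) y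
      (isClosed_le η.continuous (S.R_continuous.comp S.j.continuous)) fun w => ?_
    rw [hη]
    exact h₁ w
  -- As `v` need not lie in the range of `ι`, contact is tested nearby; the penalty disappears at `y
  -- = v`.
  · have : ∀ y, S.R (S.j v) ≤ η y + K * ‖v - y‖ := fun y => by
      refine S.ι_denseRange.induction_on (p := fun y => S.R (S.j v) ≤ η y + K * ‖v - y‖) y
        (isClosed_le continuous_const (by fun_prop)) fun w => ?_
      rw [hη]
      exact h₂ w
    simpa using this v
  · rw [hη, hζa]
    ring

/-- The equation gives convergence of the subgradients on the range of `ι`. Domination and penalized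
contact, tested there, pass to the limit and suffice to reconstruct a subgradient. -/
theorem inclusion_of_tendsto (S : ViscousSystem Z V X) {ℓ : StrongDual ℝ V} {z : ℕ → Z}
    {v : ℕ → V} {z' : Z} {v' : V} (hz : Tendsto z atTop (𝓝 z')) (hv : Tendsto v atTop (𝓝 v'))
    (h : ∀ n, S.Inclusion ℓ (z n) (v n)) : S.Inclusion ℓ z' v' := by
  obtain ⟨K, hK, hR⟩ := S.exists_R_le
  choose η hη e using h
  have ee : ∀ n w, η n (S.ι w) = ℓ (S.ι w) - S.visc (v n) (S.ι w) - S.DI (z n) w := fun n w => by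
    linarith [e n w]
  have hlim : ∀ w, Tendsto (fun n => η n (S.ι w)) atTop
      (𝓝 (ℓ (S.ι w) - S.visc v' (S.ι w) - S.DI z' w)) := fun w => by
    simp only [ee]
    have h1 : Continuous fun v : V => S.visc v (S.ι w) := by fun_prop
    have h2 : Continuous fun z : Z => S.DI z w := S.continuous_DI.clm_apply continuous_const
    exact (((h1.tendsto v').comp hv).const_sub _).sub ((h2.tendsto z').comp hz)
  refine S.inclusion_of_forall_le (K := K) (fun w => ?_) (fun w => ?_)
  · exact le_of_tendsto' (hlim w) fun n => (S.mem_subdiff_iff.1 (hη n)).1 _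
  · have hRc : Continuous fun v => S.R (S.j v) := S.R_continuous.comp S.j.continuous
    have hnc : Continuous fun v => K * ‖v - S.ι w‖ := by fun_prop
    refine le_of_tendsto_of_tendsto' ((hRc.tendsto v').comp hv)
      ((hlim w).add ((hnc.tendsto v').comp hv)) fun n => ?_
    have h1 := (S.mem_subdiff_iff.1 (hη n)).2
    have h2 := ((S.mem_subdiff_iff.1 (hη n)).1 (v n - S.ι w)).trans (hR _)
    rw [map_sub] at h2
    simp only [Function.comp_apply]
    linarith

end ViscousSystem

/-! ### Implicit Euler steps and a priori estimates -/

namespace ViscousSystem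

variable {Z V X : Type*}
  [NormedAddCommGroup Z] [InnerProductSpace ℝ Z]
  [NormedAddCommGroup V] [InnerProductSpace ℝ V]
  [NormedAddCommGroup X] [NormedSpace ℝ X]

/-- The norm on `V` induced by the viscosity operator. -/
noncomputable def viscNorm (S : ViscousSystem Z V X) (v : V) : ℝ :=
  Real.sqrt (S.visc v v)

theorem viscNorm_nonneg (S : ViscousSystem Z V X) (v : V) : 0 ≤ S.viscNorm v :=
  Real.sqrt_nonneg _

theorem viscNorm_sq (S : ViscousSystem Z V X) (v : V) : S.viscNorm v ^ 2 = S.visc v v :=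
  Real.sq_sqrt (S.visc_nonneg v)

theorem viscNorm_eq_zero (S : ViscousSystem Z V X) {v : V} (h : S.viscNorm v = 0) : v = 0 := by
  obtain ⟨γ, hγ, hV⟩ := S.visc_elliptic
  have h1 := hV v
  rw [← S.viscNorm_sq, h] at h1
  have h2 : ‖v‖ ^ 2 ≤ 0 := by nlinarith [sq_nonneg ‖v‖]
  exact norm_eq_zero.1 (pow_eq_zero_iff two_ne_zero |>.1 (le_antisymm h2 (sq_nonneg _)))

theorem visc_apply_le (S : ViscousSystem Z V X) (v w : V) :
    S.visc v w ≤ S.viscNorm v * S.viscNorm w := by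
  set a := S.viscNorm v
  set b := S.viscNorm w
  rcases (S.viscNorm_nonneg v).eq_or_lt with ha | ha
  · rw [S.viscNorm_eq_zero ha.symm, map_zero, zero_apply]
    exact mul_nonneg (S.viscNorm_nonneg _) (S.viscNorm_nonneg _)
  rcases (S.viscNorm_nonneg w).eq_or_lt with hb | hb
  · rw [S.viscNorm_eq_zero hb.symm, map_zero]
    exact mul_nonneg (S.viscNorm_nonneg _) (S.viscNorm_nonneg _)
  have h := S.visc_nonneg (b • v - a • w)
  simp only [map_sub, map_smul, sub_apply, smul_apply, smul_eq_mul] at h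
  rw [S.visc_symm w v, ← S.viscNorm_sq, ← S.viscNorm_sq] at h
  have hab : 0 < a * b := mul_pos ha hb
  have h2 : (a * b) * S.visc v w ≤ (a * b) * (a * b) := by
    change 0 ≤ b * (b * a ^ 2 - a * S.visc v w) - a * (b * S.visc v w - a * b ^ 2) at h
    nlinarith
  exact le_of_mul_le_mul_left h2 hab

/-- The state `z'` is a minimizer of the incremental functional with time step `τ` and previous
state `z`. -/
def IsTimeStep (S : ViscousSystem Z V X) (ℓ : StrongDual ℝ V) (τ : ℝ) (z z' : Z) : Prop :=
  ∀ y, S.I z' - ℓ (S.ι z') + S.R (S.j (S.ι (z' - z))) +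
      1 / (2 * τ) * S.visc (S.ι (z' - z)) (S.ι (z' - z)) ≤
    S.I y - ℓ (S.ι y) + S.R (S.j (S.ι (y - z))) +
      1 / (2 * τ) * S.visc (S.ι (y - z)) (S.ι (y - z))

theorem exists_isTimeStep [CompleteSpace Z] [TopologicalSpace.SeparableSpace Z]
    (S : ViscousSystem Z V X) (ℓ : StrongDual ℝ V) {τ : ℝ} (hτ : 0 < τ) (z : Z) :
    ∃ z', S.IsTimeStep ℓ τ z z' := by
  have hRc : Continuous fun v => S.R (S.j v) := S.R_continuous.comp S.j.continuous
  have hΦ : Continuous fun v : V => -ℓ v + S.R (S.j (v - S.ι z)) +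
      1 / (2 * τ) * S.visc (v - S.ι z) (v - S.ι z) := by
    have := hRc.comp (continuous_sub_right (S.ι z))
    have h2 : Continuous fun v : V => 1 / (2 * τ) * S.visc (v - S.ι z) (v - S.ι z) := by fun_prop
    exact (ℓ.continuous.neg.add this).add h2
  obtain ⟨z', hz'⟩ := S.exists_minimizer hΦ (b := ‖ℓ‖ * ‖S.ι‖) fun y => by
    have h1 := S.R_nonneg (S.j (S.ι y - S.ι z))
    have h2 : 0 ≤ 1 / (2 * τ) * S.visc (S.ι y - S.ι z) (S.ι y - S.ι z) :=
      mul_nonneg (by positivity) (S.visc_nonneg _)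
    have h3 : ℓ (S.ι y) ≤ ‖ℓ‖ * ‖S.ι‖ * ‖y‖ := by
      refine (le_abs_self _).trans ((ℓ.le_opNorm _).trans ?_)
      rw [mul_assoc]
      gcongr
      exact S.ι.le_opNorm y
    linarith
  refine ⟨z', fun y => ?_⟩
  have := hz' y
  simp only [map_sub] at this ⊢
  linarith

theorem IsTimeStep.energy_le {S : ViscousSystem Z V X} {ℓ : StrongDual ℝ V} {τ : ℝ} {z z' : Z}
    (h : S.IsTimeStep ℓ τ z z') (hτ : 0 < τ) :
    S.I z' - ℓ (S.ι z') + S.R (S.j (S.ι (z' - z))) ≤ S.I z - ℓ (S.ι z) := by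
  have h1 := h z
  have h2 : 0 ≤ 1 / (2 * τ) * S.visc (S.ι (z' - z)) (S.ι (z' - z)) :=
    mul_nonneg (by positivity) (S.visc_nonneg _)
  simp only [sub_self, map_zero, S.R_zero, mul_zero, add_zero] at h1
  linarith

theorem IsTimeStep.inclusion {S : ViscousSystem Z V X} {ℓ : StrongDual ℝ V} {τ : ℝ} {z z' : Z}
    (h : S.IsTimeStep ℓ τ z z') (hτ : 0 < τ) :
    S.Inclusion ℓ z' (S.ι (τ⁻¹ • (z' - z))) := by
  obtain ⟨K, hK, hR⟩ := S.exists_R_le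
  set d := z' - z with hd
  set ζ : StrongDual ℝ Z :=
    ℓ.comp S.ι - (S.visc (S.ι (τ⁻¹ • d))).comp S.ι - S.DI z' with hζ
  have hζa : ∀ w, ζ w = ℓ (S.ι w) - S.visc (S.ι (τ⁻¹ • d)) (S.ι w) - S.DI z' w := fun w => rfl
  set r : Z → ℝ := fun y => S.R (S.j (S.ι y)) with hr
  have hradd : ∀ x y, r (x + y) ≤ r x + r y := fun x y => by
    simp only [r, map_add]
    exact S.R_add_le _ _
  have hrsmul : ∀ (s : ℝ) x, 0 < s → r (s • x) = s * r x := fun s x hs => by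
    simp only [r, map_smul]
    exact S.R_homogeneous s _ hs
  -- The smooth part of the functional is differentiated along the segment from `d` to `y`, while
  -- convexity bounds the nonsmooth part linearly in `s`.
  have key : ∀ y, ζ (y - d) ≤ r y - r d := by
    intro y
    set e := y - d with he
    set Φ : ℝ → ℝ := fun s => S.I (z' + s • e) - ℓ (S.ι (z' + s • e)) +
      1 / (2 * τ) * S.visc (S.ι (d + s • e)) (S.ι (d + s • e)) with hΦ
    have hline : HasDerivAt (fun s : ℝ => z' + s • e) e 0 := by
      simpa using ((hasDerivAt_id (0 : ℝ)).smul_const e).const_add z'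
    have hline2 : HasDerivAt (fun s : ℝ => S.ι (d + s • e)) (S.ι e) 0 := by
      have : HasDerivAt (fun s : ℝ => d + s • e) e 0 := by
        simpa using ((hasDerivAt_id (0 : ℝ)).smul_const e).const_add d
      exact S.ι.hasFDerivAt.comp_hasDerivAt 0 this
    have hI : HasDerivAt (fun s : ℝ => S.I (z' + s • e)) (S.DI z' e) 0 := by
      have h0 : HasFDerivAt S.I (S.DI z') (z' + (0 : ℝ) • e) := by
        rw [zero_smul, add_zero]
        exact (S.hasFDerivAt_I z').differentiableAt.hasFDerivAt
      exact h0.comp_hasDerivAt 0 hline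
    have hL : HasDerivAt (fun s : ℝ => ℓ (S.ι (z' + s • e))) (ℓ (S.ι e)) 0 :=
      (ℓ.comp S.ι).hasFDerivAt.comp_hasDerivAt 0 hline
    have hV : HasDerivAt (fun s : ℝ => S.visc (S.ι (d + s • e)) (S.ι (d + s • e)))
        (2 * S.visc (S.ι d) (S.ι e)) 0 := by
      have h2 : HasDerivAt (fun s : ℝ => S.visc (S.ι (d + s • e))) (S.visc (S.ι e)) 0 :=
        S.visc.hasFDerivAt.comp_hasDerivAt 0 hline2
      refine (h2.clm_apply hline2).congr_deriv ?_
      rw [zero_smul, add_zero, S.visc_symm (S.ι e) (S.ι d)]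
      ring
    have hder : HasDerivAt Φ (-ζ e) 0 := by
      refine ((hI.fun_sub hL).fun_add (hV.const_mul (1 / (2 * τ)))).congr_deriv ?_
      rw [hζa, map_smul, map_smul, smul_apply, smul_eq_mul]
      field_simp
      ring
    have hslope := (hasDerivWithinAt_iff_tendsto_slope' (s := Ioi (0 : ℝ)) (by simp)).1
      hder.hasDerivWithinAt
    have hge : -(r y - r d) ≤ -ζ e := by
      refine ge_of_tendsto hslope ?_
      have hmem : Ioc (0 : ℝ) 1 ∈ 𝓝[>] (0 : ℝ) := Ioc_mem_nhdsGT one_pos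
      filter_upwards [hmem] with s hs
      have h1 := h (z' + s • e)
      have e1 : z' + s • e - z = d + s • e := by rw [hd]; abel
      rw [e1] at h1
      have e2 : d + s • e = (1 - s) • d + s • y := by
        rw [he, smul_sub, sub_smul, one_smul]
        abel
      have h2 : r (d + s • e) ≤ (1 - s) * r d + s * r y := by
        rw [e2]
        refine (hradd _ _).trans ?_
        rw [hrsmul s y hs.1]
        rcases hs.2.eq_or_lt with rfl | hs1
        · simp [r, S.R_zero]
        · rw [hrsmul (1 - s) d (by linarith)]
      have h3 : Φ 0 = S.I z' - ℓ (S.ι z') + 1 / (2 * τ) * S.visc (S.ι d) (S.ι d) := by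
        simp [Φ]
      rw [slope_def_field, sub_zero, le_div_iff₀ hs.1, h3]
      simp only [Φ]
      change S.I z' - ℓ (S.ι z') + r d + _ ≤ S.I (z' + s • e) - _ + r (d + s • e) + _ at h1
      nlinarith
    linarith
  -- The choices `y = 0` here and `y = d + w` below recover contact and domination; contact then
  -- scales from the increment to the velocity.
  have hd0 : r d ≤ ζ d := by
    have := key 0
    rw [zero_sub, map_neg] at this
    have h0 : r 0 = 0 := by simp [r, S.R_zero]
    linarith
  have hle : ∀ w, ζ w ≤ r w := fun w => by
    have := key (d + w)
    rw [add_sub_cancel_left] at this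
    linarith [hradd d w]
  refine S.inclusion_of_forall_le (K := K) (fun w => ?_) (fun w => ?_)
  · rw [← hζa]
    exact hle w
  · rw [← hζa, ← map_sub]
    have h1 : r (τ⁻¹ • d) ≤ ζ (τ⁻¹ • d) := by
      rw [hrsmul _ _ (inv_pos.2 hτ), map_smul, smul_eq_mul]
      exact mul_le_mul_of_nonneg_left hd0 (inv_pos.2 hτ).le
    have h2 := (hle (τ⁻¹ • d - w)).trans (hR _)
    rw [map_sub] at h2
    change r (τ⁻¹ • d) ≤ _
    linarith

/-- Coercivity of the energy. -/
theorem norm_le_of_energy_le (S : ViscousSystem Z V X) {α : ℝ} (hα : 0 < α)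
    (hA : ∀ z : Z, α * ‖z‖ ^ 2 ≤ S.A z z) (ℓ : StrongDual ℝ V) {e : ℝ} {z : Z}
    (h : S.I z - ℓ (S.ι z) ≤ e) :
    0 ≤ S.I z - ℓ (S.ι z) + (‖ℓ‖ * ‖S.ι‖) ^ 2 / α ∧
    ‖z‖ ≤ 1 + 4 / α * (e + (‖ℓ‖ * ‖S.ι‖) ^ 2 / α) := by
  set b := ‖ℓ‖ * ‖S.ι‖
  have h3 : ℓ (S.ι z) ≤ b * ‖z‖ := by
    refine (le_abs_self _).trans ((ℓ.le_opNorm _).trans ?_)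
    rw [mul_assoc]
    gcongr
    exact S.ι.le_opNorm z
  have h4 : b * ‖z‖ ≤ α / 4 * ‖z‖ ^ 2 + b ^ 2 / α := by
    have : 0 ≤ α / 4 * (‖z‖ - 2 * b / α) ^ 2 := by positivity
    have e : α / 4 * (‖z‖ - 2 * b / α) ^ 2 = α / 4 * ‖z‖ ^ 2 + b ^ 2 / α - b * ‖z‖ := by
      field_simp
      ring
    linarith
  have h5 : α / 4 * ‖z‖ ^ 2 ≤ S.I z - ℓ (S.ι z) + b ^ 2 / α := by
    have h1 := hA z
    have h2 := S.F_nonneg z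
    unfold I
    linarith
  refine ⟨le_trans (by positivity) h5, ?_⟩
  have h6 : ‖z‖ ^ 2 ≤ 4 / α * (e + b ^ 2 / α) := by
    rw [div_mul_eq_mul_div, le_div_iff₀ hα]
    linarith
  nlinarith [sq_nonneg (‖z‖ - 1)]

/-- The a priori estimate for one step, relative to the previous velocity. -/
theorem exists_step_estimate (S : ViscousSystem Z V X) {α : ℝ} (hα : 0 < α)
    (hA : ∀ z : Z, α * ‖z‖ ^ 2 ≤ S.A z z) (M : ℝ) :
    ∃ κ C D : ℝ, 0 < κ ∧ 0 ≤ C ∧ 0 ≤ D ∧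
      ∀ (ℓ : StrongDual ℝ V) (τ : ℝ) (z x : Z) (v₀ : V) (σ : StrongDual ℝ V), 0 < τ →
      ‖z‖ ≤ M → ‖z + τ • x‖ ≤ M → σ ∈ S.subdiff 0 →
      (∀ w : Z, σ (S.ι w) + S.visc v₀ (S.ι w) + S.DI z w - ℓ (S.ι w) = 0) →
      S.Inclusion ℓ (z + τ • x) (S.ι x) →
      S.viscNorm (S.ι x) + κ * (τ * ‖x‖) ≤ S.viscNorm v₀ + C * (τ * S.R (S.j (S.ι x))) ∧
      S.viscNorm (S.ι x) ^ 2 + α * (τ * ‖x‖ ^ 2) ≤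
        S.viscNorm v₀ ^ 2 + D * (τ * S.viscNorm (S.ι x) ^ 2) := by
  obtain ⟨γ, hγ, hV⟩ := S.visc_elliptic
  obtain ⟨L, hL, hG⟩ := S.exists_lipschitz_G M
  set a := ‖S.ι‖ + 1
  have ha : 0 < a := by positivity
  set P := L ^ 2 / (2 * α)
  have hP : 0 ≤ P := by positivity
  set s := Real.sqrt ‖S.visc‖ + 1
  have hs : 0 < s := by positivity
  set g := (Real.sqrt γ)⁻¹
  have hg : 0 < g := inv_pos.2 (Real.sqrt_pos.2 hγ)
  -- This `ε` gives `P ε ≤ α / (4a)`, half of the coefficient of `‖x‖ ‖v‖` available from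
  -- coercivity; the other half remains as `κ`.
  obtain ⟨Cε, hCε, hE⟩ := S.exists_norm_ι_le (ε := α / (4 * a * (P + 1))) (by positivity)
  refine ⟨α / (4 * a * s), P * Cε * g, L ^ 2 / (α * γ), by positivity, by positivity,
    by positivity, ?_⟩
  intro ℓ τ z x v₀ σ hτ hz hz' hσ he ⟨η, hη, he'⟩
  set v := S.ι x
  set N := S.viscNorm v with hN
  set N₀ := S.viscNorm v₀
  have hNn : 0 ≤ N := S.viscNorm_nonneg _
  have hN0 : 0 ≤ N₀ := S.viscNorm_nonneg _
  have hRn : 0 ≤ S.R (S.j v) := S.R_nonneg _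
  have hvx : ‖v‖ ≤ a * ‖x‖ := by
    refine (S.ι.le_opNorm x).trans ?_
    gcongr
    simp only [a]
    linarith
  have hNs : N ≤ s * ‖v‖ := by
    have h1 : S.visc v v ≤ ‖S.visc‖ * ‖v‖ ^ 2 := by
      refine (le_abs_self _).trans ((S.visc.le_opNorm₂ v v).trans (le_of_eq ?_))
      ring
    calc N ≤ Real.sqrt (‖S.visc‖ * ‖v‖ ^ 2) := Real.sqrt_le_sqrt h1
      _ = Real.sqrt ‖S.visc‖ * ‖v‖ := by
        rw [Real.sqrt_mul' _ (sq_nonneg _), Real.sqrt_sq (norm_nonneg _)]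
      _ ≤ s * ‖v‖ := by
        gcongr
        simp only [s]
        linarith
  have hvN : ‖v‖ ≤ g * N := by
    have h1 : Real.sqrt (γ * ‖v‖ ^ 2) ≤ N := Real.sqrt_le_sqrt (hV v)
    rw [Real.sqrt_mul hγ.le, Real.sqrt_sq (norm_nonneg _)] at h1
    rw [inv_mul_eq_div, le_div_iff₀ (Real.sqrt_pos.2 hγ)]
    linarith
  have hvN2 : γ * ‖v‖ ^ 2 ≤ N ^ 2 := by
    rw [hN, S.viscNorm_sq]
    exact hV v
  -- The old equation is subtracted from the new one and tested with `v`. Of the old subgradient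
  -- only `σ v ≤ R v = η v` is needed, so `σ ∈ ∂R(0)` suffices.
  have base : N ^ 2 + τ * (α * ‖x‖ ^ 2) ≤ N₀ * N + τ * (L * ‖x‖ * ‖v‖) := by
    have h1 := he x
    have h2 := he' x
    have h3 := (S.mem_subdiff_iff.1 hσ).1 v
    have h4 := S.subdiff_apply_self hη
    have h5 := S.visc_apply_le v₀ v
    rw [DI_apply] at h1 h2
    simp only [map_add, map_smul, add_apply, smul_apply, smul_eq_mul] at h2
    have h6 : -((S.G (z + τ • x) - S.G z) v) ≤ τ * (L * ‖x‖ * ‖v‖) := by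
      refine (neg_le_abs _).trans (((S.G (z + τ • x) - S.G z).le_opNorm v).trans ?_)
      have := hG _ _ hz' hz
      rw [add_sub_cancel_left, norm_smul, Real.norm_of_nonneg hτ.le] at this
      calc ‖S.G (z + τ • x) - S.G z‖ * ‖v‖ ≤ L * (τ * ‖x‖) * ‖v‖ := by gcongr
        _ = _ := by ring
    rw [sub_apply] at h6
    have h7 : τ * (α * ‖x‖ ^ 2) ≤ τ * S.A x x := mul_le_mul_of_nonneg_left (hA x) hτ.le
    rw [hN, S.viscNorm_sq]
    change σ v + S.visc v₀ v + (S.A z x + S.G z v) - ℓ v = 0 at h1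
    change η v + S.visc v v + (S.A z x + τ * S.A x x + S.G (z + τ • x) v) - ℓ v = 0 at h2
    change S.visc v₀ v ≤ N₀ * S.viscNorm v at h5
    linarith
  have young : L * ‖x‖ * ‖v‖ ≤ α / 2 * ‖x‖ ^ 2 + P * ‖v‖ ^ 2 := by
    have : 0 ≤ α / 2 * (‖x‖ - L / α * ‖v‖) ^ 2 := by positivity
    have e : α / 2 * (‖x‖ - L / α * ‖v‖) ^ 2 =
        α / 2 * ‖x‖ ^ 2 + P * ‖v‖ ^ 2 - L * ‖x‖ * ‖v‖ := by
      simp only [P]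
      field_simp
      ring
    linarith
  have base2 : N ^ 2 + τ * (α / 2 * ‖x‖ ^ 2) ≤ N₀ * N + τ * (P * ‖v‖ ^ 2) := by
    have := mul_le_mul_of_nonneg_left young hτ.le
    linarith
  constructor
  · rcases hNn.eq_or_lt with h0 | hpos
    · have hv0 : v = 0 := S.viscNorm_eq_zero h0.symm
      have hx0 : x = 0 := S.ι_injective (by rw [map_zero]; exact hv0)
      rw [← h0, hv0, hx0]
      simp only [norm_zero, map_zero, S.R_zero, mul_zero, add_zero]
      exact hN0
    · have i1 : α / 2 * (‖x‖ * ‖v‖ / a) ≤ α / 2 * ‖x‖ ^ 2 := by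
        gcongr
        rw [div_le_iff₀ ha]
        calc ‖x‖ * ‖v‖ ≤ ‖x‖ * (a * ‖x‖) := by gcongr
          _ = _ := by ring
      have i2 : P * ‖v‖ ^ 2 ≤ α / (4 * a) * (‖x‖ * ‖v‖) + P * Cε * (S.R (S.j v) * ‖v‖) := by
        have j1 : P * (α / (4 * a * (P + 1))) ≤ α / (4 * a) := by
          have e1 : P * (α / (4 * a * (P + 1))) = α / (4 * a) * (P / (P + 1)) := by
            field_simp
          rw [e1]
          have : P / (P + 1) ≤ 1 := by
            rw [div_le_one (by positivity)]
            linarith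
          exact mul_le_of_le_one_right (by positivity) this
        calc P * ‖v‖ ^ 2 = P * (‖v‖ * ‖v‖) := by ring
          _ ≤ P * ((α / (4 * a * (P + 1)) * ‖x‖ + Cε * S.R (S.j v)) * ‖v‖) := by
              gcongr
              exact hE x
          _ = P * (α / (4 * a * (P + 1))) * (‖x‖ * ‖v‖) + P * Cε * (S.R (S.j v) * ‖v‖) := by ring
          _ ≤ _ := by gcongr
      have i3 : N ^ 2 + τ * (α / (4 * a) * (‖x‖ * ‖v‖)) ≤
          N₀ * N + τ * (P * Cε * (S.R (S.j v) * ‖v‖)) := by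
        have e1 : α / 2 * (‖x‖ * ‖v‖ / a) = 2 * (α / (4 * a) * (‖x‖ * ‖v‖)) := by
          field_simp
          ring
        rw [e1] at i1
        have k1 := mul_le_mul_of_nonneg_left i1 hτ.le
        have k2 := mul_le_mul_of_nonneg_left i2 hτ.le
        linarith
      have i4 : α / (4 * a * s) * (‖x‖ * N) ≤ α / (4 * a) * (‖x‖ * ‖v‖) := by
        calc α / (4 * a * s) * (‖x‖ * N) ≤ α / (4 * a * s) * (‖x‖ * (s * ‖v‖)) := by gcongr
          _ = _ := by field_simp
      have i5 : P * Cε * (S.R (S.j v) * ‖v‖) ≤ P * Cε * g * (S.R (S.j v) * N) := by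
        calc P * Cε * (S.R (S.j v) * ‖v‖) ≤ P * Cε * (S.R (S.j v) * (g * N)) := by gcongr
          _ = _ := by ring
      have k4 := mul_le_mul_of_nonneg_left i4 hτ.le
      have k5 := mul_le_mul_of_nonneg_left i5 hτ.le
      -- All terms have been given a factor `N`; cancelling it makes the estimate linear, so that it
      -- can be summed uniformly in time.
      refine le_of_mul_le_mul_right ?_ hpos
      calc (N + α / (4 * a * s) * (τ * ‖x‖)) * N
          = N ^ 2 + τ * (α / (4 * a * s) * (‖x‖ * N)) := by ring
        _ ≤ N₀ * N + τ * (P * Cε * g * (S.R (S.j v) * N)) := by linarith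
        _ = _ := by ring
  · have i1 : P * ‖v‖ ^ 2 ≤ L ^ 2 / (α * γ) * N ^ 2 / 2 := by
      have e1 : P * ‖v‖ ^ 2 = L ^ 2 / (α * γ) * (γ * ‖v‖ ^ 2) / 2 := by
        simp only [P]
        field_simp
      rw [e1]
      gcongr
    have k1 := mul_le_mul_of_nonneg_left i1 hτ.le
    have i2 : N₀ * N ≤ (N₀ ^ 2 + N ^ 2) / 2 := by nlinarith [sq_nonneg (N₀ - N)]
    have e2 : L ^ 2 / (α * γ) * (τ * N ^ 2) = 2 * (τ * (L ^ 2 / (α * γ) * N ^ 2 / 2)) := by ring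
    rw [e2]
    linarith

/-- A solution of the implicit Euler scheme with time step `τ`. -/
structure IsScheme (S : ViscousSystem Z V X) (ℓ : StrongDual ℝ V) (τ : ℝ) (z₀ : Z)
    (u : ℕ → Z) : Prop where
  zero : u 0 = z₀
  step : ∀ k, S.IsTimeStep ℓ τ (u k) (u (k + 1))

theorem exists_isScheme [CompleteSpace Z] [TopologicalSpace.SeparableSpace Z]
    (S : ViscousSystem Z V X) (ℓ : StrongDual ℝ V) {τ : ℝ} (hτ : 0 < τ) (z₀ : Z) :
    ∃ u, S.IsScheme ℓ τ z₀ u := by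
  choose next hnext using S.exists_isTimeStep ℓ hτ
  refine ⟨fun n => next^[n] z₀, rfl, fun k => ?_⟩
  rw [Function.iterate_succ_apply']
  exact hnext _

theorem IsScheme.energy_le {S : ViscousSystem Z V X} {ℓ : StrongDual ℝ V} {τ : ℝ} {z₀ : Z}
    {u : ℕ → Z} (h : S.IsScheme ℓ τ z₀ u) (hτ : 0 < τ) (n : ℕ) :
    S.I (u n) - ℓ (S.ι (u n)) + ∑ k ∈ Finset.range n, S.R (S.j (S.ι (u (k + 1) - u k))) ≤
      S.I z₀ - ℓ (S.ι z₀) := by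
  induction n with
  | zero => simp [h.zero]
  | succ n ih =>
    rw [Finset.sum_range_succ]
    linarith [(h.step n).energy_le hτ]

/-- The constants are those of `exists_step_estimate`. -/
theorem exists_scheme_estimate (S : ViscousSystem Z V X) {α : ℝ} (hα : 0 < α)
    (hA : ∀ z : Z, α * ‖z‖ ^ 2 ≤ S.A z z) (M : ℝ) :
    ∃ κ C D : ℝ, 0 < κ ∧ 0 ≤ C ∧ 0 ≤ D ∧
      ∀ (ℓ : StrongDual ℝ V) (τ : ℝ) (z₀ : Z) (u : ℕ → Z) (v₀ : V) (σ : StrongDual ℝ V) (e : ℝ),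
      0 < τ → S.IsScheme ℓ τ z₀ u → (∀ n, ‖u n‖ ≤ M) →
      (∀ n, ∑ k ∈ Finset.range n, S.R (S.j (S.ι (u (k + 1) - u k))) ≤ e) →
      σ ∈ S.subdiff 0 →
      (∀ w : Z, σ (S.ι w) + S.visc v₀ (S.ι w) + S.DI z₀ w - ℓ (S.ι w) = 0) →
      (∀ n, S.viscNorm (S.ι (τ⁻¹ • (u (n + 1) - u n))) ≤ S.viscNorm v₀ + C * e) ∧
      (∀ n, κ * ∑ k ∈ Finset.range n, ‖u (k + 1) - u k‖ ≤ S.viscNorm v₀ + C * e) ∧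
      (∀ n : ℕ, α * ∑ k ∈ Finset.range n, τ * ‖τ⁻¹ • (u (k + 1) - u k)‖ ^ 2 ≤
        S.viscNorm v₀ ^ 2 + D * (n * τ * (S.viscNorm v₀ + C * e) ^ 2)) := by
  obtain ⟨κ, C, D, hκ, hC, hD, hstep⟩ := S.exists_step_estimate hα hA M
  refine ⟨κ, C, D, hκ, hC, hD, ?_⟩
  intro ℓ τ z₀ u v₀ σ e hτ hu hM he hσ heq
  obtain ⟨x, hx⟩ : ∃ x : ℕ → Z, ∀ k, τ⁻¹ • (u (k + 1) - u k) = x k := ⟨_, fun _ => rfl⟩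
  simp only [hx]
  have hτx : ∀ k, τ • x k = u (k + 1) - u k := fun k => by
    rw [← hx, smul_smul, mul_inv_cancel₀ hτ.ne', one_smul]
  have hux : ∀ k, u k + τ • x k = u (k + 1) := fun k => by
    rw [hτx]
    abel
  have hinc : ∀ k, S.Inclusion ℓ (u k + τ • x k) (S.ι (x k)) := fun k => by
    rw [hux, ← hx]
    exact (hu.step k).inclusion hτ
  have hR : ∀ k, τ * S.R (S.j (S.ι (x k))) = S.R (S.j (S.ι (u (k + 1) - u k))) := fun k => by
    rw [← S.R_homogeneous τ _ hτ, ← hτx, ← map_smul, ← map_smul]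
  have hnx : ∀ k, τ * ‖x k‖ = ‖u (k + 1) - u k‖ := fun k => by
    rw [← hτx, norm_smul, Real.norm_of_nonneg hτ.le]
  -- The prescribed `v₀` and `σ` play the role of a step before time zero. Later steps use the
  -- velocity and the subgradient of their predecessor.
  have h0 := hstep ℓ τ (u 0) (x 0) v₀ σ hτ (hM 0) (hux 0 ▸ hM 1) hσ (hu.zero ▸ heq) (hinc 0)
  have hs : ∀ k, S.viscNorm (S.ι (x (k + 1))) + κ * (τ * ‖x (k + 1)‖) ≤
        S.viscNorm (S.ι (x k)) + C * (τ * S.R (S.j (S.ι (x (k + 1))))) ∧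
      S.viscNorm (S.ι (x (k + 1))) ^ 2 + α * (τ * ‖x (k + 1)‖ ^ 2) ≤
        S.viscNorm (S.ι (x k)) ^ 2 + D * (τ * S.viscNorm (S.ι (x (k + 1))) ^ 2) := fun k => by
    obtain ⟨η, hη, e'⟩ := hinc k
    rw [hux] at e'
    exact hstep ℓ τ (u (k + 1)) (x (k + 1)) (S.ι (x k)) η hτ (hM (k + 1))
      (hux (k + 1) ▸ hM (k + 2)) (S.subdiff_subset_subdiff_zero _ hη) e' (hinc (k + 1))
  have hsum : ∀ n, S.viscNorm (S.ι (x n)) +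
      κ * ∑ k ∈ Finset.range (n + 1), ‖u (k + 1) - u k‖ ≤ S.viscNorm v₀ +
        C * ∑ k ∈ Finset.range (n + 1), S.R (S.j (S.ι (u (k + 1) - u k))) := by
    intro n
    induction n with
    | zero =>
      have := h0.1
      rw [hR, hnx] at this
      simpa using this
    | succ n ih =>
      have := (hs n).1
      rw [hR, hnx] at this
      rw [Finset.sum_range_succ _ (n + 1), Finset.sum_range_succ _ (n + 1), mul_add, mul_add]
      linarith
  have hCe : ∀ n, C * ∑ k ∈ Finset.range n, S.R (S.j (S.ι (u (k + 1) - u k))) ≤ C * e :=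
    fun n => mul_le_mul_of_nonneg_left (he n) hC
  have hN : ∀ n, S.viscNorm (S.ι (x n)) ≤ S.viscNorm v₀ + C * e := fun n => by
    have : 0 ≤ κ * ∑ k ∈ Finset.range (n + 1), ‖u (k + 1) - u k‖ :=
      mul_nonneg hκ.le (Finset.sum_nonneg fun _ _ => norm_nonneg _)
    linarith [hsum n, hCe (n + 1)]
  have hN0 := S.viscNorm_nonneg v₀
  have he0 : 0 ≤ C * e := by simpa using hCe 0
  refine ⟨hN, fun n => ?_, fun n => ?_⟩
  · cases n with
    | zero =>
      simp only [Finset.range_zero, Finset.sum_empty, mul_zero]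
      linarith
    | succ n => linarith [hsum n, hCe (n + 1), S.viscNorm_nonneg (S.ι (x n))]
  · have hNsq : ∀ n, D * (τ * S.viscNorm (S.ι (x n)) ^ 2) ≤
        D * (τ * (S.viscNorm v₀ + C * e) ^ 2) := fun n => by
      gcongr
      · exact S.viscNorm_nonneg _
      · exact hN n
    have hind : ∀ n : ℕ, S.viscNorm (S.ι (x n)) ^ 2 +
        α * ∑ k ∈ Finset.range (n + 1), τ * ‖x k‖ ^ 2 ≤
        S.viscNorm v₀ ^ 2 + D * ((n + 1 : ℕ) * τ * (S.viscNorm v₀ + C * e) ^ 2) := by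
      intro n
      induction n with
      | zero =>
        have := h0.2
        simp only [zero_add, Finset.range_one, Finset.sum_singleton, Nat.cast_one, one_mul]
        linarith [hNsq 0]
      | succ n ih =>
        have := (hs n).2
        rw [Finset.sum_range_succ _ (n + 1), mul_add]
        push_cast at ih ⊢
        linarith [hNsq (n + 1)]
    cases n with
    | zero =>
      simp only [Finset.range_zero, Finset.sum_empty, mul_zero, Nat.cast_zero, zero_mul, add_zero]
      positivity
    | succ n => linarith [hind n, sq_nonneg (S.viscNorm (S.ι (x n)))]

end ViscousSystem

/-! ### Step functions on a uniform grid -/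

section StepFunction

variable {E : Type*} [NormedAddCommGroup E] [NormedSpace ℝ E]

theorem floor_div_eq {τ s : ℝ} {k : ℕ} (hτ : 0 < τ) (h₁ : k * τ ≤ s) (h₂ : s < (k + 1) * τ) :
    ⌊s / τ⌋₊ = k := by
  have hs : 0 ≤ s := le_trans (by positivity) h₁
  rw [Nat.floor_eq_iff (by positivity), le_div_iff₀ hτ, div_lt_iff₀ hτ]
  exact ⟨h₁, h₂⟩

/-- The right endpoint of the cell is admitted, although the floor jumps there, so that the
induction can pass through the node to the next cell. -/
theorem integral_step [CompleteSpace E] (a : ℕ → E) {τ : ℝ} (hτ : 0 < τ) (k : ℕ) :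
    ∀ t : ℝ, k * τ ≤ t → t ≤ (k + 1) * τ →
    IntervalIntegrable (fun s => a ⌊s / τ⌋₊) volume 0 t ∧
    ∫ s in (0 : ℝ)..t, a ⌊s / τ⌋₊ = ∑ i ∈ Finset.range k, τ • a i + (t - k * τ) • a k := by
  have hlast : ∀ (k : ℕ) (t : ℝ), k * τ ≤ t → t ≤ (k + 1) * τ →
      IntervalIntegrable (fun s => a ⌊s / τ⌋₊) volume (k * τ) t ∧
      ∫ s in (k * τ : ℝ)..t, a ⌊s / τ⌋₊ = (t - k * τ) • a k := by
    intro k t h₁ h₂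
    have he : EqOn (fun s => a ⌊s / τ⌋₊) (fun _ => a k) (Ioo (k * τ) t) := fun s hs => by
      simp only [floor_div_eq hτ hs.1.le (hs.2.trans_le h₂)]
    constructor
    · refine IntervalIntegrable.congr_uIoo (f := fun _ => a k) intervalIntegrable_const ?_
      rw [uIoo_of_le h₁]
      exact he.symm
    · rw [intervalIntegral.integral_congr_Ioo_of_le h₁ he, intervalIntegral.integral_const]
  induction k with
  | zero =>
    intro t h₁ h₂
    have := hlast 0 t h₁ h₂
    simpa using this
  | succ k ih =>
    intro t h₁ h₂
    have h := ih ((k + 1) * τ) (by nlinarith) le_rfl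
    have h' := hlast (k + 1) t h₁ h₂
    push_cast at h' ⊢
    refine ⟨h.1.trans h'.1, ?_⟩
    rw [← intervalIntegral.integral_add_adjacent_intervals h.1 h'.1, h.2, h'.2,
      Finset.sum_range_succ]
    congr 3
    ring

theorem mul_floor_div_le {τ t : ℝ} (hτ : 0 < τ) (ht : 0 ≤ t) : ⌊t / τ⌋₊ * τ ≤ t := by
  rw [← le_div_iff₀ hτ]
  exact Nat.floor_le (by positivity)

theorem le_floor_div_add_one_mul {τ t : ℝ} (hτ : 0 < τ) : t ≤ (⌊t / τ⌋₊ + 1) * τ := by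
  rw [← div_le_iff₀ hτ]
  exact (Nat.lt_floor_add_one _).le

theorem intervalIntegrable_step [CompleteSpace E] (a : ℕ → E) {τ t : ℝ} (hτ : 0 < τ)
    (ht : 0 ≤ t) : IntervalIntegrable (fun s => a ⌊s / τ⌋₊) volume 0 t :=
  (integral_step a hτ _ t (mul_floor_div_le hτ ht) (le_floor_div_add_one_mul hτ)).1

theorem stronglyMeasurable_step {E : Type*} [NormedAddCommGroup E] (a : ℕ → E) (τ : ℝ) :
    StronglyMeasurable (fun s : ℝ => a ⌊s / τ⌋₊) :=
  (StronglyMeasurable.of_discrete (f := a)).comp_measurable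
    (Nat.measurable_floor.comp (measurable_id.div_const τ))

/-- Any monotone choice of indices is refined by consecutive ones, and the triangle inequality
applies. -/
theorem eVariationOn_nat_le {E : Type*} [PseudoMetricSpace E] {u : ℕ → E} {W : ℝ}
    (h : ∀ n, ∑ k ∈ Finset.range n, dist (u (k + 1)) (u k) ≤ W) :
    eVariationOn u univ ≤ ENNReal.ofReal W := by
  refine iSup_le ?_
  rintro ⟨n, ⟨p, hp, -⟩⟩
  have hle : ∀ n, ∑ i ∈ Finset.range n, edist (u (p (i + 1))) (u (p i)) ≤
      ∑ k ∈ Finset.range (p n), edist (u (k + 1)) (u k) := by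
    intro n
    induction n with
    | zero => simp
    | succ n ih =>
      rw [Finset.sum_range_succ, ← Finset.sum_range_add_sum_Ico _ (hp n.le_succ)]
      gcongr
      rw [edist_comm]
      refine (edist_le_Ico_sum_edist u (hp n.le_succ)).trans (le_of_eq ?_)
      exact Finset.sum_congr rfl fun _ _ => edist_comm _ _
  refine (hle n).trans ?_
  simp only [edist_dist]
  rw [← ENNReal.ofReal_sum_of_nonneg fun _ _ => dist_nonneg]
  exact ENNReal.ofReal_le_ofReal (h _)

end StepFunction

/-! ### Approximate solutions and their comparison -/

namespace ViscousSystem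

variable {Z V X : Type*}
  [NormedAddCommGroup Z] [InnerProductSpace ℝ Z]
  [NormedAddCommGroup V] [InnerProductSpace ℝ V]
  [NormedAddCommGroup X] [NormedSpace ℝ X]

/-- An approximate solution: the inclusion holds with the velocity `x` at the state `y t`, which
is close to the primitive of `x`. -/
structure IsApprox (S : ViscousSystem Z V X) (ℓ : StrongDual ℝ V) (z₀ : Z) (τ M Q W : ℝ)
    (B : ℝ → ℝ) (x y : ℝ → Z) : Prop where
  meas : StronglyMeasurable x
  integrable : ∀ T, 0 ≤ T → IntervalIntegrable x volume 0 T
  sq_integrable : ∀ T, 0 ≤ T → IntervalIntegrable (fun t => ‖x t‖ ^ 2) volume 0 T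
  integral_sq_le : ∀ T, 0 ≤ T → ∫ t in (0 : ℝ)..T, ‖x t‖ ^ 2 ≤ B T
  integral_norm_le : ∀ T, 0 ≤ T → ∫ t in (0 : ℝ)..T, ‖x t‖ ≤ W
  norm_sub_primitive_le : ∀ t, 0 ≤ t → ‖y t - (z₀ + ∫ s in (0 : ℝ)..t, x s)‖ ≤ τ * ‖x t‖
  sq_le : ∀ t, 0 ≤ t → τ * ‖x t‖ ^ 2 ≤ B t
  inclusion : ∀ t, 0 ≤ t → S.Inclusion ℓ (y t) (S.ι (x t))
  norm_le : ∀ t, 0 ≤ t → ‖y t‖ ≤ M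
  viscNorm_le : ∀ t, 0 ≤ t → S.viscNorm (S.ι (x t)) ≤ Q
  variation_le : eVariationOn y (Ici 0) ≤ ENNReal.ofReal W

/-- Here `x` is the slope of the affine interpolant and `y` its value at the right node, where the
Euler inclusion holds. The bound has `T + 1` because the cells covering `[0,T]` may overshoot by one
step `τ ≤ 1`. -/
theorem IsScheme.isApprox [CompleteSpace Z] {S : ViscousSystem Z V X} {ℓ : StrongDual ℝ V}
    {z₀ : Z} {τ M Q W b c : ℝ} {u : ℕ → Z} (h : S.IsScheme ℓ τ z₀ u) (hτ : 0 < τ) (hτ1 : τ ≤ 1)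
    (hc : 0 ≤ c) (hM : ∀ n, ‖u n‖ ≤ M)
    (hQ : ∀ n, S.viscNorm (S.ι (τ⁻¹ • (u (n + 1) - u n))) ≤ Q)
    (hW : ∀ n, ∑ k ∈ Finset.range n, ‖u (k + 1) - u k‖ ≤ W)
    (hb : ∀ n : ℕ, ∑ k ∈ Finset.range n, τ * ‖τ⁻¹ • (u (k + 1) - u k)‖ ^ 2 ≤ b + c * (n * τ)) :
    S.IsApprox ℓ z₀ τ M Q W (fun T => b + c * (T + 1))
      (fun t => τ⁻¹ • (u (⌊t / τ⌋₊ + 1) - u ⌊t / τ⌋₊)) (fun t => u (⌊t / τ⌋₊ + 1)) := by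
  obtain ⟨x, hx⟩ : ∃ x : ℕ → Z, ∀ k, τ⁻¹ • (u (k + 1) - u k) = x k := ⟨_, fun _ => rfl⟩
  have hτx : ∀ k, τ • x k = u (k + 1) - u k := fun k => by
    rw [← hx, smul_smul, mul_inv_cancel₀ hτ.ne', one_smul]
  simp only [hx] at hQ hb ⊢
  have hfloor : ∀ t, 0 ≤ t → b + c * ((⌊t / τ⌋₊ + 1 : ℕ) * τ) ≤ b + c * (t + 1) := fun t ht => by
    gcongr
    push_cast
    linarith [mul_floor_div_le hτ ht]
  refine ⟨stronglyMeasurable_step x τ, fun T hT => intervalIntegrable_step x hτ hT,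
    fun T hT => intervalIntegrable_step (fun k => ‖x k‖ ^ 2) hτ hT, fun T hT => ?_,
    fun T hT => ?_, fun t ht => ?_, fun t ht => ?_, fun t ht => ?_, fun t _ => hM _, fun t _ => hQ _, ?_⟩
  · refine le_trans ?_ ((hb (⌊T / τ⌋₊ + 1)).trans (hfloor T hT))
    rw [(integral_step (fun k => ‖x k‖ ^ 2) hτ _ T (mul_floor_div_le hτ hT)
      (le_floor_div_add_one_mul hτ)).2, Finset.sum_range_succ]
    simp only [smul_eq_mul]
    gcongr
    linarith [le_floor_div_add_one_mul (t := T) hτ]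
  · refine le_trans ?_ (hW (⌊T / τ⌋₊ + 1))
    rw [(integral_step (fun k => ‖x k‖) hτ _ T (mul_floor_div_le hτ hT)
      (le_floor_div_add_one_mul hτ)).2, Finset.sum_range_succ]
    simp only [smul_eq_mul, ← hτx, norm_smul, Real.norm_of_nonneg hτ.le]
    gcongr
    linarith [le_floor_div_add_one_mul (t := T) hτ]
  · rw [(integral_step x hτ _ t (mul_floor_div_le hτ ht) (le_floor_div_add_one_mul hτ)).2]
    simp only [hτx]
    rw [Finset.sum_range_sub, h.zero]
    set k := ⌊t / τ⌋₊
    have e : u (k + 1) - (z₀ + (u k - z₀ + (t - k * τ) • x k)) =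
        ((k + 1) * τ - t) • x k := by
      have : u (k + 1) = u k + τ • x k := by rw [hτx]; abel
      rw [this, show ((k : ℝ) + 1) * τ - t = τ - (t - k * τ) by ring, sub_smul τ]
      abel
    have h1 := mul_floor_div_le hτ ht
    have h2 := le_floor_div_add_one_mul (t := t) hτ
    rw [e, norm_smul, Real.norm_of_nonneg (by linarith)]
    gcongr
    linarith
  · refine le_trans ?_ ((hb (⌊t / τ⌋₊ + 1)).trans (hfloor t ht))
    exact Finset.single_le_sum (f := fun k => τ * ‖x k‖ ^ 2) (fun _ _ => by positivity)
      (Finset.mem_range.2 (Nat.lt_succ_self _))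
  · rw [← hx]
    exact (h.step _).inclusion hτ
  · have hmono : MonotoneOn (fun t : ℝ => ⌊t / τ⌋₊ + 1) (Ici 0) := fun s _ t _ hst => by
      dsimp only
      gcongr
    refine (eVariationOn.comp_le_of_monotoneOn u _ hmono (s := univ)
      (fun _ _ => mem_univ _)).trans (eVariationOn_nat_le fun n => ?_)
    simpa only [dist_eq_norm] using hW n

/-- Pointwise estimate for the difference of two approximate solutions. -/
theorem exists_inclusion_sub_le (S : ViscousSystem Z V X) (M : ℝ) :
    ∃ c C : ℝ, 0 ≤ c ∧ 0 ≤ C ∧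
      ∀ (ℓ : StrongDual ℝ V) (y₁ y₂ x₁ x₂ u : Z) (δ : ℝ), 0 ≤ δ → δ ≤ 2 →
      ‖y₁‖ ≤ M → ‖y₂‖ ≤ M → S.Inclusion ℓ y₁ (S.ι x₁) → S.Inclusion ℓ y₂ (S.ι x₂) →
      ‖y₁ - y₂ - u‖ ≤ δ * (‖x₁‖ + ‖x₂‖) →
      S.A u (x₁ - x₂) + 1 / 2 * S.visc (S.ι (x₁ - x₂)) (S.ι (x₁ - x₂)) ≤
        c * (1 / 2 * S.A u u) + C * δ * (‖x₁‖ ^ 2 + ‖x₂‖ ^ 2) := by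
  obtain ⟨K, hK, hR⟩ := S.exists_R_le
  obtain ⟨L, hL, hG⟩ := S.exists_lipschitz_G M
  -- Doubling `L` means that absorption uses only half of the viscous form; the other half controls
  -- the difference of velocities.
  obtain ⟨c, hc, hLc⟩ := S.exists_mul_norm_le_visc_add (2 * L)
  refine ⟨c, 2 * (‖S.A‖ * (c + 1)), hc, by positivity, ?_⟩
  intro ℓ y₁ y₂ x₁ x₂ u δ hδ hδ2 h₁ h₂ i₁ i₂ hd
  obtain ⟨p, hp, hpy⟩ := S.inclusion_difference i₁ i₂ hK.le hR
  set e := y₁ - y₂ - u with he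
  have hye : y₁ - y₂ = u + e := by rw [he]; abel
  set v := S.ι (x₁ - x₂) with hv
  have h3 := hpy v
  rw [← map_sub, ← hv, sub_self, norm_zero, mul_zero, zero_sub, hp, hye, map_add, add_apply] at h3
  have h4 : ‖S.G y₁ - S.G y₂‖ * ‖v‖ ≤ L * ‖u + e‖ * ‖v‖ := by
    have := hG _ _ h₁ h₂
    rw [hye] at this
    gcongr
  have h5 := hLc (u + e) v
  have h6 : S.A (u + e) (u + e) ≤ 2 * S.A u u + 2 * S.A e e := by
    have := S.A_nonneg (u - e)
    simp only [map_add, map_sub, add_apply, sub_apply] at this ⊢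
    linarith
  set s := ‖x₁‖ + ‖x₂‖ with hs
  have hs0 : 0 ≤ s := by positivity
  have h7 : S.A e e ≤ ‖S.A‖ * (2 * δ * s ^ 2) := by
    calc S.A e e ≤ ‖S.A‖ * ‖e‖ * ‖e‖ := (le_abs_self _).trans (S.A.le_opNorm₂ e e)
      _ ≤ ‖S.A‖ * (δ * s) * (δ * s) := by gcongr
      _ = ‖S.A‖ * (δ * δ * s ^ 2) := by ring
      -- The assumption `δ ≤ 2` makes the quadratic error linear in `δ`.
      _ ≤ _ := by gcongr
  have h8 : -(S.A e (x₁ - x₂)) ≤ ‖S.A‖ * (δ * s ^ 2) := by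
    calc -(S.A e (x₁ - x₂)) ≤ ‖S.A‖ * ‖e‖ * ‖x₁ - x₂‖ :=
          (neg_le_abs _).trans (S.A.le_opNorm₂ e _)
      _ ≤ ‖S.A‖ * (δ * s) * s := by
          gcongr
          exact norm_sub_le _ _
      _ = _ := by ring
  have h9 : s ^ 2 ≤ 2 * (‖x₁‖ ^ 2 + ‖x₂‖ ^ 2) := by nlinarith [sq_nonneg (‖x₁‖ - ‖x₂‖)]
  have h10 : ‖S.A‖ * (c + 1) * δ * s ^ 2 ≤
      ‖S.A‖ * (c + 1) * δ * (2 * (‖x₁‖ ^ 2 + ‖x₂‖ ^ 2)) := by gcongr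
  have h6' := mul_le_mul_of_nonneg_left h6 hc
  have h7' := mul_le_mul_of_nonneg_left h7 hc
  linarith

/-- Approximate velocities take values in `Z`, so the difference may be tested with itself and the
quadratic energy obeys the ordinary chain rule. The mismatch between states and primitives is of
order `τ₁ + τ₂` once integrated, and Grönwall concludes. -/
theorem IsApprox.exists_compare [CompleteSpace Z] (S : ViscousSystem Z V X) (M : ℝ) :
    ∃ c C : ℝ, 0 ≤ c ∧ 0 ≤ C ∧
      ∀ (ℓ : StrongDual ℝ V) (z₀ : Z) (τ₁ τ₂ Q W : ℝ) (B : ℝ → ℝ) (x₁ x₂ y₁ y₂ : ℝ → Z),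
      0 ≤ τ₁ → τ₁ ≤ 1 → 0 ≤ τ₂ → τ₂ ≤ 1 → Monotone B →
      S.IsApprox ℓ z₀ τ₁ M Q W B x₁ y₁ → S.IsApprox ℓ z₀ τ₂ M Q W B x₂ y₂ →
      ∀ T, 0 ≤ T →
        1 / 2 * S.A (∫ t in (0 : ℝ)..T, (x₁ t - x₂ t)) (∫ t in (0 : ℝ)..T, (x₁ t - x₂ t)) ≤
          C * (τ₁ + τ₂) * B T * Real.exp (c * T) ∧
        IntervalIntegrable (fun t => S.visc (S.ι (x₁ t - x₂ t)) (S.ι (x₁ t - x₂ t))) volume 0 T ∧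
        ∫ t in (0 : ℝ)..T, S.visc (S.ι (x₁ t - x₂ t)) (S.ι (x₁ t - x₂ t)) ≤
          2 * (c * T * Real.exp (c * T) + 1) * (C * (τ₁ + τ₂) * B T) := by
  obtain ⟨c, C, hc, hC, hineq⟩ := S.exists_inclusion_sub_le M
  refine ⟨c, 2 * C, hc, by positivity, ?_⟩
  intro ℓ z₀ τ₁ τ₂ Q W B x₁ x₂ y₁ y₂ hτ₁ hτ₁' hτ₂ hτ₂' hB h₁ h₂ T hT
  set x : ℝ → Z := fun t => x₁ t - x₂ t
  set u : ℝ → Z := fun t => ∫ s in (0 : ℝ)..t, x s with hu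
  set a : ℝ → ℝ := fun t => 1 / 2 * S.A (u t) (u t) with ha
  set w : ℝ → ℝ := fun t => S.visc (S.ι (x t)) (S.ι (x t)) with hw
  set δ := 2 * C * (τ₁ + τ₂) * B T
  have hw0 : ∀ t, 0 ≤ w t := fun t => S.visc_nonneg _
  have hxi : ∀ t, 0 ≤ t → IntervalIntegrable x volume 0 t := fun t ht =>
    (h₁.integrable t ht).sub (h₂.integrable t ht)
  have hqi : ∀ t, 0 ≤ t → IntervalIntegrable (fun t => ‖x₁ t‖ ^ 2 + ‖x₂ t‖ ^ 2) volume 0 t :=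
    fun t ht => (h₁.sq_integrable t ht).add (h₂.sq_integrable t ht)
  have hwi : ∀ t, 0 ≤ t → IntervalIntegrable w volume 0 t := fun t ht => by
    refine ((hqi t ht).const_mul (‖S.visc‖ * ‖S.ι‖ ^ 2 * 2)).mono_fun ?_ ?_
    · have hcont : Continuous fun z : Z => S.visc (S.ι z) (S.ι z) := by fun_prop
      exact hcont.comp_aestronglyMeasurable (h₁.meas.sub h₂.meas).aestronglyMeasurable
    · refine Eventually.of_forall fun s => ?_
      change ‖w s‖ ≤ ‖‖S.visc‖ * ‖S.ι‖ ^ 2 * 2 * (‖x₁ s‖ ^ 2 + ‖x₂ s‖ ^ 2)‖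
      rw [Real.norm_of_nonneg (hw0 s), Real.norm_of_nonneg (by positivity)]
      have e1 : ‖x s‖ ^ 2 ≤ 2 * (‖x₁ s‖ ^ 2 + ‖x₂ s‖ ^ 2) := by
        have : ‖x s‖ ≤ ‖x₁ s‖ + ‖x₂ s‖ := norm_sub_le _ _
        nlinarith [sq_nonneg (‖x₁ s‖ - ‖x₂ s‖), norm_nonneg (x s)]
      calc w s ≤ ‖S.visc‖ * ‖S.ι (x s)‖ * ‖S.ι (x s)‖ :=
            (le_abs_self _).trans (S.visc.le_opNorm₂ _ _)
        _ ≤ ‖S.visc‖ * (‖S.ι‖ * ‖x s‖) * (‖S.ι‖ * ‖x s‖) := by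
            gcongr <;> exact S.ι.le_opNorm _
        _ = ‖S.visc‖ * ‖S.ι‖ ^ 2 * ‖x s‖ ^ 2 := by ring
        _ ≤ ‖S.visc‖ * ‖S.ι‖ ^ 2 * (2 * (‖x₁ s‖ ^ 2 + ‖x₂ s‖ ^ 2)) := by gcongr
        _ = _ := by ring
  have huc : ContinuousOn u (Icc 0 T) := by
    have := continuousOn_primitive_zero (hxi T hT)
    rwa [uIcc_of_le hT] at this
  have hac : ContinuousOn a (Icc 0 T) := by
    have hcont : Continuous fun z : Z => 1 / 2 * S.A z z := by fun_prop
    exact hcont.comp_continuousOn huc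
  have hai : ∀ t ∈ Icc 0 T, IntervalIntegrable a volume 0 t := fun t ht =>
    (hac.mono (Icc_subset_Icc_right ht.2)).intervalIntegrable_of_Icc ht.1
  have key : ∀ t ∈ Icc 0 T, a t + 1 / 2 * ∫ s in (0 : ℝ)..t, w s ≤
      δ + c * ∫ s in (0 : ℝ)..t, a s := by
    intro t ht
    obtain ⟨hbi, hbe⟩ := bilin_primitive_self S.A S.A_symm (u := u) (hxi t ht.1) fun _ _ => rfl
    have hle : ∫ s in (0 : ℝ)..t, (S.A (u s) (x s) + 1 / 2 * w s) ≤
        ∫ s in (0 : ℝ)..t, (c * a s + C * (τ₁ + τ₂) * (‖x₁ s‖ ^ 2 + ‖x₂ s‖ ^ 2)) := by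
      refine intervalIntegral.integral_mono_on ht.1 (hbi.add ((hwi t ht.1).const_mul _))
        (((hai t ht).const_mul c).add ((hqi t ht.1).const_mul _)) fun s hs => ?_
      refine hineq ℓ (y₁ s) (y₂ s) (x₁ s) (x₂ s) (u s) (τ₁ + τ₂) (by positivity) (by linarith)
        (h₁.norm_le s hs.1) (h₂.norm_le s hs.1) (h₁.inclusion s hs.1) (h₂.inclusion s hs.1) ?_
      have e : y₁ s - y₂ s - u s = (y₁ s - (z₀ + ∫ r in (0 : ℝ)..s, x₁ r)) -
          (y₂ s - (z₀ + ∫ r in (0 : ℝ)..s, x₂ r)) := by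
        simp only [u, x]
        rw [intervalIntegral.integral_sub (h₁.integrable s hs.1) (h₂.integrable s hs.1)]
        abel
      rw [e]
      refine (norm_sub_le _ _).trans ((add_le_add (h₁.norm_sub_primitive_le s hs.1)
        (h₂.norm_sub_primitive_le s hs.1)).trans ?_)
      have e1 := mul_nonneg hτ₁ (norm_nonneg (x₂ s))
      have e2 := mul_nonneg hτ₂ (norm_nonneg (x₁ s))
      linarith
    rw [intervalIntegral.integral_add hbi ((hwi t ht.1).const_mul _),
      intervalIntegral.integral_add ((hai t ht).const_mul c) ((hqi t ht.1).const_mul _),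
      intervalIntegral.integral_const_mul, intervalIntegral.integral_const_mul,
      intervalIntegral.integral_const_mul (C * (τ₁ + τ₂)),
      intervalIntegral.integral_add (h₁.sq_integrable t ht.1) (h₂.sq_integrable t ht.1)] at hle
    have hq : (∫ s in (0 : ℝ)..t, ‖x₁ s‖ ^ 2) + ∫ s in (0 : ℝ)..t, ‖x₂ s‖ ^ 2 ≤ 2 * B T := by
      linarith [h₁.integral_sq_le t ht.1, h₂.integral_sq_le t ht.1, hB ht.2]
    have hq' : C * (τ₁ + τ₂) * ((∫ s in (0 : ℝ)..t, ‖x₁ s‖ ^ 2) +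
        ∫ s in (0 : ℝ)..t, ‖x₂ s‖ ^ 2) ≤ C * (τ₁ + τ₂) * (2 * B T) := by gcongr
    have hat : a t = ∫ s in (0 : ℝ)..t, S.A (u s) (x s) := by
      simp only [a]
      rw [hbe]
      ring
    rw [hat]
    simp only [δ]
    linarith
  have hwint : ∀ t ∈ Icc 0 T, 0 ≤ ∫ s in (0 : ℝ)..t, w s := fun t ht =>
    intervalIntegral.integral_nonneg ht.1 fun s _ => hw0 s
  have hgr := le_mul_exp_of_le_add_integral (δ := δ) hc hac fun t ht => by
    linarith [key t ht, hwint t ht]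
  have hTm : T ∈ Icc 0 T := ⟨hT, le_rfl⟩
  have hBT : 0 ≤ B T := (intervalIntegral.integral_nonneg hT fun t _ => sq_nonneg _).trans
    (h₁.integral_sq_le T hT)
  have hδ : 0 ≤ δ := by positivity
  refine ⟨hgr T hTm, hwi T hT, ?_⟩
  have hint : ∫ s in (0 : ℝ)..T, a s ≤ T * (δ * Real.exp (c * T)) := by
    calc ∫ s in (0 : ℝ)..T, a s ≤ ∫ s in (0 : ℝ)..T, δ * Real.exp (c * T) := by
          refine intervalIntegral.integral_mono_on hT (hai T hTm) intervalIntegrable_const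
            fun s hs => (hgr s hs).trans ?_
          gcongr
          exact hs.2
      _ = _ := by
          rw [intervalIntegral.integral_const, sub_zero, smul_eq_mul]
  have h3 := key T hTm
  have h4 : 0 ≤ a T := by
    have := S.A_nonneg (u T)
    simp only [a]
    linarith
  have h5 := mul_le_mul_of_nonneg_left hint hc
  linarith

end ViscousSystem

/-! ### Passage to the limit -/

theorem ae_exists_tendsto_of_integral_sq_le {α E : Type*} [MeasurableSpace α] {μ : Measure α}
    [IsFiniteMeasure μ] [NormedAddCommGroup E] [CompleteSpace E] {f : ℕ → α → E} {K : ℝ}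
    (hf : ∀ n, AEStronglyMeasurable (f n) μ)
    (hi : ∀ n m, Integrable (fun t => ‖f n t - f m t‖ ^ 2) μ)
    (h : ∀ n m, ∫ t, ‖f n t - f m t‖ ^ 2 ∂μ ≤ K * ((1 / 4) ^ n + (1 / 4) ^ m)) :
    ∀ᵐ t ∂μ, ∃ l, Tendsto (fun n => f n t) atTop (𝓝 l) := by
  have hK : 0 ≤ K := by
    have := (integral_nonneg fun t => by positivity).trans (h 0 0)
    norm_num at this
    exact this
  have hsum : Summable fun N : ℕ => (2 * K + 1) * (1 / 2 : ℝ) ^ N :=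
    (summable_geometric_of_lt_one (by norm_num) (by norm_num)).mul_left _
  -- The squared rate `4⁻ᴺ` becomes the summable rate `2⁻ᴺ`, so the whole sequence converges almost
  -- everywhere. The factor `2K + 1` provides the strict inequality, as `2K < (2K + 1)²`.
  refine Lp.ae_tendsto_of_cauchy_eLpNorm (p := 2) hf (by norm_num)
    (B := fun N => ENNReal.ofReal ((2 * K + 1) * (1 / 2 : ℝ) ^ N)) hsum.tsum_ofReal_ne_top
    fun N n m hn hm => ?_
  rw [← ENNReal.pow_lt_pow_left_iff two_ne_zero, ← ENNReal.ofReal_pow (by positivity)]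
  have e := eLpNorm_nnreal_pow_eq_lintegral (f := f n - f m) (μ := μ) (p := 2) two_ne_zero
  norm_num at e
  rw [e]
  have e2 : ∀ t, ‖f n t - f m t‖ₑ ^ 2 = ENNReal.ofReal (‖f n t - f m t‖ ^ 2) := fun t => by
    rw [ENNReal.ofReal_pow (norm_nonneg _), ofReal_norm]
  simp only [e2]
  rw [← ofReal_integral_eq_lintegral_ofReal (hi n m) (Eventually.of_forall fun t => by positivity),
    ENNReal.ofReal_lt_ofReal_iff (by positivity)]
  have h1 : (1 / 4 : ℝ) ^ n ≤ (1 / 4) ^ N :=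
    pow_le_pow_of_le_one (by norm_num) (by norm_num) hn
  have h2 : (1 / 4 : ℝ) ^ m ≤ (1 / 4) ^ N :=
    pow_le_pow_of_le_one (by norm_num) (by norm_num) hm
  have h3 : ((1 / 2 : ℝ) ^ N) ^ 2 = (1 / 4) ^ N := by
    rw [← pow_mul, mul_comm, pow_mul]
    norm_num
  rw [mul_pow, h3]
  have h4 : (0 : ℝ) < (1 / 4) ^ N := by positivity
  calc _ ≤ K * ((1 / 4) ^ n + (1 / 4) ^ m) := h n m
    _ ≤ K * ((1 / 4) ^ N + (1 / 4) ^ N) := by gcongr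
    _ = (2 * K) * (1 / 4) ^ N := by ring
    _ < (2 * K + 1) ^ 2 * (1 / 4) ^ N := by
      gcongr
      nlinarith

namespace ViscousSystem

variable {Z V X : Type*}
  [NormedAddCommGroup Z] [InnerProductSpace ℝ Z]
  [NormedAddCommGroup V] [InnerProductSpace ℝ V]
  [NormedAddCommGroup X] [NormedSpace ℝ X]

theorem quarter_pow_le_one (n : ℕ) : (1 / 4 : ℝ) ^ n ≤ 1 :=
  pow_le_one₀ (by norm_num) (by norm_num)

theorem tendsto_quarter_pow : Tendsto (fun n : ℕ => (1 / 4 : ℝ) ^ n) atTop (𝓝 0) :=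
  tendsto_pow_atTop_nhds_zero_of_lt_one (by norm_num) (by norm_num)

theorem IsApprox.exists_state_limit [CompleteSpace Z] {S : ViscousSystem Z V X}
    {ℓ : StrongDual ℝ V} {z₀ : Z} {M Q W : ℝ} {B : ℝ → ℝ} {x y : ℕ → ℝ → Z} (hB : Monotone B)
    (h : ∀ n, S.IsApprox ℓ z₀ ((1 / 4) ^ n) M Q W B (x n) (y n)) :
    ∃ z : ℝ → Z, z 0 = z₀ ∧ ∀ t, 0 ≤ t →
      Tendsto (fun n => z₀ + ∫ s in (0 : ℝ)..t, x n s) atTop (𝓝 (z t)) ∧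
      Tendsto (fun n => y n t) atTop (𝓝 (z t)) := by
  obtain ⟨c, C, hc, hC, hcomp⟩ := IsApprox.exists_compare S M
  obtain ⟨α, hα, hA⟩ := S.A_elliptic
  have hcauchy : ∀ t, 0 ≤ t → CauchySeq fun n => z₀ + ∫ s in (0 : ℝ)..t, x n s := fun t ht => by
    have hBt : 0 ≤ B t := (intervalIntegral.integral_nonneg ht fun t _ => sq_nonneg _).trans
      ((h 0).integral_sq_le t ht)
    refine cauchySeq_of_le_tendsto_0
      (fun N => √(2 / α * (C * (2 * (1 / 4) ^ N) * B t * Real.exp (c * t)))) ?_ ?_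
    · intro n m N hn hm
      refine Real.le_sqrt_of_sq_le ?_
      have h1 := (hcomp ℓ z₀ _ _ Q W B _ _ _ _ (by positivity) (quarter_pow_le_one n)
        (by positivity) (quarter_pow_le_one m) hB (h n) (h m) t ht).1
      rw [intervalIntegral.integral_sub ((h n).integrable t ht) ((h m).integrable t ht)] at h1
      rw [dist_eq_norm, add_sub_add_left_eq_sub, div_mul_eq_mul_div, le_div_iff₀ hα]
      have h2 := hA ((∫ s in (0 : ℝ)..t, x n s) - ∫ s in (0 : ℝ)..t, x m s)
      have h3 : (1 / 4 : ℝ) ^ n ≤ (1 / 4) ^ N :=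
        pow_le_pow_of_le_one (by norm_num) (by norm_num) hn
      have h4 : (1 / 4 : ℝ) ^ m ≤ (1 / 4) ^ N :=
        pow_le_pow_of_le_one (by norm_num) (by norm_num) hm
      have h5 : C * ((1 / 4) ^ n + (1 / 4) ^ m) * B t * Real.exp (c * t) ≤
          C * (2 * (1 / 4) ^ N) * B t * Real.exp (c * t) := by
        gcongr
        linarith
      linarith
    · have : Tendsto (fun N : ℕ => √(2 / α * (C * (2 * (1 / 4) ^ N) * B t * Real.exp (c * t))))
          atTop (𝓝 √(2 / α * (C * (2 * 0) * B t * Real.exp (c * t)))) :=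
        ((((tendsto_quarter_pow.const_mul 2).const_mul C).mul_const (B t)).mul_const
          (Real.exp (c * t))).const_mul (2 / α) |>.sqrt
      simpa using this
  refine ⟨fun t => limUnder atTop fun n => z₀ + ∫ s in (0 : ℝ)..t, x n s, ?_, fun t ht => ?_⟩
  · simp only [intervalIntegral.integral_same, add_zero]
    exact tendsto_const_nhds.limUnder_eq
  · have h1 := (hcauchy t ht).tendsto_limUnder
    refine ⟨h1, ?_⟩
    -- The gap is at most `τ ‖x‖ ≤ √(τ B t)`, by the bound on `τ ‖x‖²` at the single time `t`.
    have h2 : Tendsto (fun n => y n t - (z₀ + ∫ s in (0 : ℝ)..t, x n s)) atTop (𝓝 0) := by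
      have h3 : Tendsto (fun n : ℕ => √((1 / 4) ^ n * B t)) atTop (𝓝 √(0 * B t)) :=
        (tendsto_quarter_pow.mul_const _).sqrt
      rw [zero_mul, Real.sqrt_zero] at h3
      refine squeeze_zero_norm (fun n => ?_) h3
      refine ((h n).norm_sub_primitive_le t ht).trans (Real.le_sqrt_of_sq_le ?_)
      have h4 := mul_le_mul_of_nonneg_left ((h n).sq_le t ht)
        (by positivity : (0 : ℝ) ≤ (1 / 4) ^ n)
      linarith [mul_pow ((1 / 4 : ℝ) ^ n) ‖x n t‖ 2]
    simpa using h2.add h1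

theorem IsApprox.exists_velocity_limit [CompleteSpace Z] [CompleteSpace V]
    {S : ViscousSystem Z V X}
    {ℓ : StrongDual ℝ V} {z₀ : Z} {M Q W : ℝ} {B : ℝ → ℝ} {x y : ℕ → ℝ → Z} (hB : Monotone B)
    (h : ∀ n, S.IsApprox ℓ z₀ ((1 / 4) ^ n) M Q W B (x n) (y n)) :
    ∃ v : ℝ → V, StronglyMeasurable v ∧
      ∀ᵐ t ∂(volume.restrict (Ioi (0 : ℝ))), Tendsto (fun n => S.ι (x n t)) atTop (𝓝 (v t)) := by
  obtain ⟨c, C, hc, hC, hcomp⟩ := IsApprox.exists_compare S M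
  obtain ⟨γ, hγ, hV⟩ := S.visc_elliptic
  have hm : ∀ n, StronglyMeasurable fun t => S.ι (x n t) := fun n =>
    S.ι.continuous.comp_stronglyMeasurable (h n).meas
  refine exists_stronglyMeasurable_limit_of_tendsto_ae (fun n => (hm n).aestronglyMeasurable) ?_
  have hU : (Ioi (0 : ℝ)) = ⋃ N : ℕ, Ioc (0 : ℝ) N := by
    ext t
    simp only [mem_Ioi, mem_iUnion, mem_Ioc]
    exact ⟨fun ht => (exists_nat_ge t).imp fun N hN => ⟨ht, hN⟩, fun ⟨_, ht, _⟩ => ht⟩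
  rw [hU, ae_restrict_iUnion_iff]
  intro N
  have hN : (0 : ℝ) ≤ N := N.cast_nonneg
  have hw := fun n m => (hcomp ℓ z₀ _ _ Q W B _ _ _ _ (by positivity) (quarter_pow_le_one n)
        (by positivity) (quarter_pow_le_one m) hB (h n) (h m) N hN).2
  have hle : ∀ n m t, ‖S.ι (x n t) - S.ι (x m t)‖ ^ 2 ≤
      γ⁻¹ * S.visc (S.ι (x n t - x m t)) (S.ι (x n t - x m t)) := fun n m t => by
    rw [← map_sub, inv_mul_eq_div, le_div_iff₀ hγ, mul_comm]
    exact hV _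
  have hwi : ∀ n m, Integrable (fun t => γ⁻¹ * S.visc (S.ι (x n t - x m t))
      (S.ι (x n t - x m t))) (volume.restrict (Ioc 0 (N : ℝ))) := fun n m =>
    ((hw n m).1.const_mul γ⁻¹).1
  have hint : ∀ n m, Integrable (fun t => ‖S.ι (x n t) - S.ι (x m t)‖ ^ 2)
      (volume.restrict (Ioc 0 (N : ℝ))) := fun n m => by
    refine (hwi n m).mono' ?_ (Eventually.of_forall fun t => ?_)
    · exact (((hm n).sub (hm m)).norm.pow 2).aestronglyMeasurable
    · rw [Real.norm_of_nonneg (by positivity)]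
      exact hle n m t
  refine ae_exists_tendsto_of_integral_sq_le
    (K := γ⁻¹ * (2 * (c * N * Real.exp (c * N) + 1) * (C * B N)))
    (fun n => (hm n).aestronglyMeasurable) hint fun n m => ?_
  refine (integral_mono (hint n m) (hwi n m) (hle n m)).trans ?_
  rw [integral_const_mul, mul_assoc]
  gcongr
  rw [← intervalIntegral.integral_of_le hN]
  refine (hw n m).2.trans (le_of_eq ?_)
  ring

theorem IsApprox.exists_isSolution [CompleteSpace Z] [CompleteSpace V] {S : ViscousSystem Z V X}
    {ℓ : StrongDual ℝ V} {z₀ : Z} {M Q W : ℝ} {B : ℝ → ℝ} {x y : ℕ → ℝ → Z} (hB : Monotone B)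
    (h : ∀ n, S.IsApprox ℓ z₀ ((1 / 4) ^ n) M Q W B (x n) (y n)) :
    ∃ (z : ℝ → Z) (v : ℝ → V), S.IsSolution ℓ z₀ z v ∧ (∀ t, 0 ≤ t → ‖z t‖ ≤ M) ∧
      (∀ᵐ t ∂(volume.restrict (Ioi (0 : ℝ))), S.viscNorm (v t) ≤ Q) ∧
      IntegrableOn v (Ioi 0) ∧ eVariationOn z (Ici 0) ≤ ENNReal.ofReal W := by
  obtain ⟨z, hz0, hz⟩ := IsApprox.exists_state_limit hB h
  obtain ⟨v, hvm, hv⟩ := IsApprox.exists_velocity_limit hB h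
  obtain ⟨γ, hγ, hV⟩ := S.visc_elliptic
  have hviscNorm : Continuous S.viscNorm := by
    unfold viscNorm
    fun_prop
  have hnorm : ∀ w, S.viscNorm w ≤ Q → ‖w‖ ≤ √(Q ^ 2 / γ) := fun w hw => by
    refine Real.le_sqrt_of_sq_le ?_
    rw [le_div_iff₀ hγ, mul_comm]
    refine (hV w).trans ?_
    rw [← S.viscNorm_sq]
    have := S.viscNorm_nonneg w
    gcongr
  have hpos : ∀ᵐ t ∂(volume.restrict (Ioi (0 : ℝ))), 0 ≤ t := by
    filter_upwards [ae_restrict_mem measurableSet_Ioi] with t ht using ht.le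
  have hQ : ∀ᵐ t ∂(volume.restrict (Ioi (0 : ℝ))), S.viscNorm (v t) ≤ Q := by
    filter_upwards [hv, hpos] with t ht ht0
    exact le_of_tendsto' ((hviscNorm.tendsto _).comp ht) fun n => (h n).viscNorm_le t ht0
  have hM : ∀ t, 0 ≤ t → ‖z t‖ ≤ M := fun t ht =>
    le_of_tendsto' (hz t ht).2.norm fun n => (h n).norm_le t ht
  have hvol : ∀ T, 0 ≤ T → ∀ᵐ t, t ∈ uIoc 0 T → t ∈ Ioi (0 : ℝ) := fun T hT =>
    Eventually.of_forall fun t ht => (uIoc_of_le hT ▸ ht).1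
  have hv' : ∀ T, 0 ≤ T → ∀ᵐ t, t ∈ uIoc 0 T →
      Tendsto (fun n => S.ι (x n t)) atTop (𝓝 (v t)) := fun T hT => by
    filter_upwards [(ae_restrict_iff' measurableSet_Ioi).1 hv, hvol T hT] with t ht h1 h2
    exact ht (h1 h2)
  have hb : ∀ T, 0 ≤ T → ∀ n, ∀ᵐ t, t ∈ uIoc 0 T → ‖S.ι (x n t)‖ ≤ √(Q ^ 2 / γ) :=
    fun T hT n => Eventually.of_forall fun t ht =>
      hnorm _ ((h n).viscNorm_le t (uIoc_of_le hT ▸ ht).1.le)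
  have hxm : ∀ n, StronglyMeasurable fun t => S.ι (x n t) := fun n =>
    S.ι.continuous.comp_stronglyMeasurable (h n).meas
  have hvi : ∀ T, IntegrableOn v (Ioc 0 T) := fun T => by
    refine Measure.integrableOn_of_bounded (M := √(Q ^ 2 / γ)) (by simp)
      hvm.aestronglyMeasurable ?_
    refine ae_restrict_of_ae_restrict_of_subset Ioc_subset_Ioi_self ?_
    filter_upwards [hQ] with t ht using hnorm _ ht
  refine ⟨z, v, ⟨?_, fun a ha => (hvi a).mono_set Ioo_subset_Ioc_self, fun t ht => ?_, hz0, ?_⟩,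
    hM, hQ, ?_, ?_⟩
  · refine memLp_top_of_bound ?_ M (hpos.mono hM)
    refine aestronglyMeasurable_of_tendsto_ae atTop
      (f := fun n t => z₀ + ∫ s in (0 : ℝ)..t, x n s) (fun n => ?_)
      (hpos.mono fun t ht => (hz t ht).1)
    refine ContinuousOn.aestronglyMeasurable ?_ measurableSet_Ioi
    refine continuousOn_const.add fun t ht => ?_
    have hc := continuousOn_primitive_zero ((h n).integrable (t + 1) (by linarith [mem_Ioi.1 ht]))
    rw [uIcc_of_le (by linarith [mem_Ioi.1 ht])] at hc
    exact (hc.continuousAt (Icc_mem_nhds ht (by linarith))).continuousWithinAt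
  · have h1 := (S.ι.continuous.tendsto _).comp (hz t ht).1
    have h2 := intervalIntegral.tendsto_integral_filter_of_dominated_convergence
      (fun _ => √(Q ^ 2 / γ)) (Eventually.of_forall fun n => (hxm n).aestronglyMeasurable)
      (Eventually.of_forall (hb t ht)) intervalIntegrable_const (hv' t ht)
    refine tendsto_nhds_unique h1 ((h2.const_add (S.ι (z 0))).congr fun n => ?_)
    simp only [Function.comp_apply, map_add, hz0,
      S.ι.intervalIntegral_comp_comm ((h n).integrable t ht)]
  · filter_upwards [hv, hpos] with t ht ht0
    exact S.inclusion_of_tendsto (hz t ht0).2 ht fun n => (h n).inclusion t ht0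
  -- Integrability on the whole half line comes from the bound on the total length in `Z`, which
  -- does not depend on `T`.
  · refine integrableOn_Ioi_of_intervalIntegral_norm_bounded (l := atTop) (b := fun T : ℝ => T)
      (‖S.ι‖ * W) 0 hvi tendsto_id ?_
    filter_upwards [eventually_ge_atTop 0] with T hT
    have h2 := intervalIntegral.tendsto_integral_filter_of_dominated_convergence
      (F := fun n t => ‖S.ι (x n t)‖) (f := fun t => ‖v t‖)
      (fun _ => √(Q ^ 2 / γ)) (Eventually.of_forall fun n => (hxm n).norm.aestronglyMeasurable)
      (Eventually.of_forall fun n => (hb T hT n).mono fun t ht ht' => by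
        rw [norm_norm]
        exact ht ht')
      intervalIntegrable_const ((hv' T hT).mono fun t ht ht' => (ht ht').norm)
    refine le_of_tendsto' h2 fun n => ?_
    calc _ ≤ ∫ t in (0 : ℝ)..T, ‖S.ι‖ * ‖x n t‖ := by
          refine intervalIntegral.integral_mono_on hT
            (IntervalIntegrable.norm ⟨S.ι.integrable_comp ((h n).integrable T hT).1,
              S.ι.integrable_comp ((h n).integrable T hT).2⟩)
            (((h n).integrable T hT).norm.const_mul _) fun t _ => S.ι.le_opNorm _
      _ ≤ ‖S.ι‖ * W := by
          rw [intervalIntegral.integral_const_mul]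
          gcongr
          exact (h n).integral_norm_le T hT
  · by_contra! hlt
    -- Variation is lower semicontinuous under pointwise convergence, so an excess in the limit
    -- would already appear in some approximation.
    obtain ⟨n, hn⟩ := (eVariationOn.lowerSemicontinuous_aux (fun t ht => (hz t ht).2) hlt).exists
    exact hn.not_ge (h n).variation_le

end ViscousSystem

/-! ### Existence with uniform bounds -/

namespace ViscousSystem

variable {Z V X : Type*}
  [NormedAddCommGroup Z] [InnerProductSpace ℝ Z]
  [NormedAddCommGroup V] [InnerProductSpace ℝ V]
  [NormedAddCommGroup X] [NormedSpace ℝ X]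

theorem visc_inverse_apply [CompleteSpace V] (S : ViscousSystem Z V X) (ξ : StrongDual ℝ V) :
    S.visc (S.visc.inverse ξ) = ξ :=
  S.visc_isInvertible.self_apply_inverse ξ

theorem dualNorm_eq [CompleteSpace V] (S : ViscousSystem Z V X) (ξ : StrongDual ℝ V) :
    S.dualNorm ξ = S.viscNorm (S.visc.inverse ξ) := by
  rw [dualNorm, viscNorm, visc_inverse_apply]

/-- Continuity alone does not bound `F` on balls of an infinite-dimensional space; the Lipschitz
bound on `G` controls the gradient, and the mean value inequality does the rest. -/
theorem exists_I_le (S : ViscousSystem Z V X) (M : ℝ) : ∃ K, ∀ z, ‖z‖ ≤ M → S.I z ≤ K := by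
  obtain ⟨L, hL, h⟩ := S.exists_lipschitz_G |M|
  have hb : ∀ z ∈ Metric.closedBall (0 : Z) |M|,
      ‖fderiv ℝ S.F z‖ ≤ (‖S.G 0‖ + L * |M|) * ‖S.ι‖ := fun z hz => by
    have hz : ‖z‖ ≤ |M| := by simpa using hz
    have h1 := h z 0 hz (by simp)
    rw [sub_zero] at h1
    have h2 : ‖S.G z‖ ≤ ‖S.G 0‖ + L * |M| := by
      calc ‖S.G z‖ ≤ ‖S.G 0‖ + ‖S.G z - S.G 0‖ := norm_le_norm_add_norm_sub' _ _
        _ ≤ _ := by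
          gcongr
          exact h1.trans (by gcongr)
    have e : fderiv ℝ S.F z = (S.G z).comp S.ι := by
      ext w
      exact (S.G_apply z w).symm
    rw [e]
    exact ((S.G z).opNorm_comp_le S.ι).trans (by gcongr)
  refine ⟨1 / 2 * (‖S.A‖ * |M| * |M|) +
    (S.F 0 + (‖S.G 0‖ + L * |M|) * ‖S.ι‖ * |M|), fun z hz => ?_⟩
  have hz' : ‖z‖ ≤ |M| := hz.trans (le_abs_self M)
  unfold I
  refine add_le_add ?_ ?_
  · gcongr
    exact (le_abs_self _).trans ((S.A.le_opNorm₂ z z).trans (by gcongr))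
  · have h1 := (convex_closedBall (0 : Z) |M|).norm_image_sub_le_of_norm_fderiv_le (𝕜 := ℝ)
      (fun x _ => S.differentiable_F x) hb (x := 0) (y := z) (by simp) (by simpa using hz')
    rw [sub_zero] at h1
    have h2 : S.F z - S.F 0 ≤ (‖S.G 0‖ + L * |M|) * ‖S.ι‖ * |M| :=
      (le_abs_self _).trans (h1.trans (by gcongr))
    linarith

/-- The energy at `p = (z₀, ℓ)`, shifted by a constant that makes it nonnegative. -/
noncomputable def shiftedEnergy (S : ViscousSystem Z V X) (α : ℝ) (p : Z × StrongDual ℝ V) : ℝ :=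
  S.I p.1 - p.2 (S.ι p.1) + (‖p.2‖ * ‖S.ι‖) ^ 2 / α

theorem exists_shiftedEnergy_le (S : ViscousSystem Z V X) {α : ℝ} (hα : 0 < α)
    {s : Set (Z × StrongDual ℝ V)} (hs : Bornology.IsBounded s) :
    ∃ K, ∀ p ∈ s, S.shiftedEnergy α p ≤ K := by
  obtain ⟨M, hM⟩ := isBounded_iff_forall_norm_le.1 hs
  obtain ⟨K, hK⟩ := S.exists_I_le M
  refine ⟨K + M * (‖S.ι‖ * M) + (M * ‖S.ι‖) ^ 2 / α, fun p hp => ?_⟩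
  have h1 : ‖p.1‖ ≤ M := (norm_fst_le p).trans (hM p hp)
  have h2 : ‖p.2‖ ≤ M := (norm_snd_le p).trans (hM p hp)
  have h3 : -p.2 (S.ι p.1) ≤ M * (‖S.ι‖ * M) := by
    refine (neg_le_abs _).trans ((p.2.le_opNorm _).trans ?_)
    have := S.ι.le_opNorm p.1
    have h0 : 0 ≤ M := (norm_nonneg _).trans h1
    calc ‖p.2‖ * ‖S.ι p.1‖ ≤ M * (‖S.ι‖ * ‖p.1‖) := by gcongr
      _ ≤ _ := by gcongr
  have h4 : (‖p.2‖ * ‖S.ι‖) ^ 2 / α ≤ (M * ‖S.ι‖) ^ 2 / α := by gcongr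
  unfold shiftedEnergy
  linarith [hK p.1 h1]

theorem sqrt_mul_norm_le_viscNorm (S : ViscousSystem Z V X) {γ : ℝ} (hγ : 0 < γ)
    (hV : ∀ v, γ * ‖v‖ ^ 2 ≤ S.visc v v) (v : V) : √γ * ‖v‖ ≤ S.viscNorm v := by
  refine Real.le_sqrt_of_sq_le ?_
  rw [mul_pow, Real.sq_sqrt hγ.le]
  exact hV v

/-- The data enter `C` only through the radius `N` of a ball containing all iterates, on which `G`
is Lipschitz. The shifted energy bounds both these iterates and their total dissipation. -/
theorem exists_isSolution_of_norm_le [CompleteSpace Z] [TopologicalSpace.SeparableSpace Z]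
    [CompleteSpace V] (S : ViscousSystem Z V X) {α : ℝ} (hα : 0 < α)
    (hA : ∀ z : Z, α * ‖z‖ ^ 2 ≤ S.A z z) (N : ℝ) :
    ∃ C : ℝ, 0 < C ∧ ∀ (ℓ : StrongDual ℝ V) (z₀ : Z) (ξ₀ σ : StrongDual ℝ V) (M : ℝ), M ≤ N →
      1 + 4 / α * S.shiftedEnergy α (z₀, ℓ) ≤ M → S.shiftedEnergy α (z₀, ℓ) ≤ M →
      S.Represents ξ₀ (S.DI z₀) → σ ∈ S.subdiff 0 →
      ∃ (z : ℝ → Z) (v : ℝ → V) (b w : ℝ), S.IsSolution ℓ z₀ z v ∧ (∀ t, 0 ≤ t → ‖z t‖ ≤ M) ∧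
        0 ≤ b ∧ (∀ᵐ t ∂(volume.restrict (Ioi (0 : ℝ))), ‖v t‖ ≤ b) ∧ IntegrableOn v (Ioi 0) ∧
        0 ≤ w ∧ eVariationOn z (Ici 0) ≤ ENNReal.ofReal w ∧
        b + w ≤ C * (S.dualNorm (-ξ₀ + ℓ - σ) + M) := by
  obtain ⟨γ, hγ, hV⟩ := S.visc_elliptic
  obtain ⟨κ, C, D, hκ, hC, hD, hest⟩ := S.exists_scheme_estimate hα hA N
  have hγ' : 0 < √γ := Real.sqrt_pos.2 hγ
  refine ⟨(1 / √γ + 1 / κ) * (1 + C), by positivity, ?_⟩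
  intro ℓ z₀ ξ₀ σ M hMN hM hM' hξ₀ hσ
  -- This velocity makes the equation hold at `z₀` with subgradient `σ`, and its viscous norm is the
  -- dual norm of `-ξ₀ + ℓ - σ`.
  obtain ⟨v₀, hv₀⟩ : ∃ v₀, S.visc.inverse (-ξ₀ + ℓ - σ) = v₀ := ⟨_, rfl⟩
  have hv₀' : S.visc v₀ = -ξ₀ + ℓ - σ := by rw [← hv₀, visc_inverse_apply]
  rw [dualNorm_eq, hv₀]
  set e := S.shiftedEnergy α (z₀, ℓ)
  set Q := S.viscNorm v₀ + C * e with hQ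
  have he : 0 ≤ e := (S.norm_le_of_energy_le hα hA ℓ le_rfl).1
  have hv₀n := S.viscNorm_nonneg v₀
  have hQ0 : 0 ≤ Q := by positivity
  choose u hu using fun n : ℕ => S.exists_isScheme ℓ (τ := (1 / 4) ^ n) (by positivity) z₀
  have hτ : ∀ n : ℕ, (0 : ℝ) < (1 / 4) ^ n := fun n => by positivity
  have hsum0 : ∀ n k, 0 ≤
      ∑ i ∈ Finset.range k, S.R (S.j (S.ι (u n (i + 1) - u n i))) := fun n k =>
    Finset.sum_nonneg fun _ _ => S.R_nonneg _
  have hen : ∀ n k, S.I (u n k) - ℓ (S.ι (u n k)) ≤ S.I z₀ - ℓ (S.ι z₀) := fun n k => by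
    linarith [(hu n).energy_le (hτ n) k, hsum0 n k]
  have hun : ∀ n k, ‖u n k‖ ≤ M := fun n k =>
    (S.norm_le_of_energy_le hα hA ℓ (hen n k)).2.trans hM
  have hR : ∀ n k, ∑ i ∈ Finset.range k, S.R (S.j (S.ι (u n (i + 1) - u n i))) ≤ e :=
    fun n k => by
    have h1 := (S.norm_le_of_energy_le hα hA ℓ (hen n k)).1
    have h2 := (hu n).energy_le (hτ n) k
    change _ ≤ S.I z₀ - ℓ (S.ι z₀) + (‖ℓ‖ * ‖S.ι‖) ^ 2 / α
    linarith
  have heq : ∀ w : Z, σ (S.ι w) + S.visc v₀ (S.ι w) + S.DI z₀ w - ℓ (S.ι w) = 0 := fun w => by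
    rw [hv₀', ← hξ₀ w]
    simp only [add_apply, sub_apply, neg_apply]
    ring
  have hest' := fun n => hest ℓ _ z₀ (u n) v₀ σ e (hτ n) (hu n)
    (fun k => (hun n k).trans hMN) (hR n) hσ heq
  have happ := fun n => (hu n).isApprox (hτ n) (quarter_pow_le_one n)
    (c := D * Q ^ 2 / α) (b := S.viscNorm v₀ ^ 2 / α) (by positivity) (hun n) (hest' n).1
    (fun k => by
      rw [le_div_iff₀' hκ]
      exact (hest' n).2.1 k)
    (fun k => by
      have h1 := (hest' n).2.2 k
      rw [← hQ, ← le_div_iff₀' hα] at h1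
      refine h1.trans (le_of_eq ?_)
      ring)
  obtain ⟨z, v, hsol, hzM, hvQ, hvi, hvar⟩ := IsApprox.exists_isSolution (fun s t hst => by
    gcongr) happ
  refine ⟨z, v, Q / √γ, Q / κ, hsol, hzM, by positivity, ?_, hvi, by positivity, hvar, ?_⟩
  · filter_upwards [hvQ] with t ht
    rw [le_div_iff₀' hγ']
    exact (S.sqrt_mul_norm_le_viscNorm hγ hV _).trans ht
  · calc Q / √γ + Q / κ = (1 / √γ + 1 / κ) * Q := by ring
      _ ≤ (1 / √γ + 1 / κ) * ((1 + C) * (S.viscNorm v₀ + M)) := by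
        gcongr
        nlinarith
      _ = _ := by ring

theorem exists_isSolution_bounds [CompleteSpace Z] [TopologicalSpace.SeparableSpace Z]
    [CompleteSpace V] (S : ViscousSystem Z V X) :
    ∃ m₁ m₂ : Z × StrongDual ℝ V → ℝ, (∀ p, 0 ≤ m₁ p) ∧ (∀ p, 0 < m₂ p) ∧
      MapsBoundedToBounded m₁ ∧ MapsBoundedToBounded m₂ ∧
      ∀ (ℓ : StrongDual ℝ V) (z₀ : Z) (ξ₀ σ : StrongDual ℝ V),
      S.Represents ξ₀ (S.DI z₀) → σ ∈ S.subdiff 0 →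
      ∃ (z : ℝ → Z) (v : ℝ → V) (b w : ℝ), S.IsSolution ℓ z₀ z v ∧
        (∀ t, 0 ≤ t → ‖z t‖ ≤ m₁ (z₀, ℓ)) ∧
        0 ≤ b ∧ (∀ᵐ t ∂(volume.restrict (Ioi (0 : ℝ))), ‖v t‖ ≤ b) ∧ IntegrableOn v (Ioi 0) ∧
        0 ≤ w ∧ eVariationOn z (Ici 0) ≤ ENNReal.ofReal w ∧
        b + w ≤ m₂ (z₀, ℓ) * (S.dualNorm (-ξ₀ + ℓ - σ) + m₁ (z₀, ℓ)) := by
  obtain ⟨α, hα, hA⟩ := S.A_elliptic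
  choose C hC hsol using fun N : ℕ => S.exists_isSolution_of_norm_le hα hA N
  have he : ∀ p, 0 ≤ S.shiftedEnergy α p := fun p =>
    (S.norm_le_of_energy_le hα hA p.2 (z := p.1) le_rfl).1
  obtain ⟨m, hm⟩ : ∃ m : Z × StrongDual ℝ V → ℝ,
      ∀ p, m p = 1 + (4 / α + 1) * S.shiftedEnergy α p := ⟨_, fun _ => rfl⟩
  have hm0 : ∀ p, 0 ≤ m p := fun p => by
    have := he p
    rw [hm]
    positivity
  have hmb : ∀ s, Bornology.IsBounded s → ∃ K, ∀ p ∈ s, m p ≤ K := fun s hs => by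
    obtain ⟨K, hK⟩ := S.exists_shiftedEnergy_le hα hs
    refine ⟨1 + (4 / α + 1) * K, fun p hp => ?_⟩
    rw [hm]
    gcongr
    exact hK p hp
  -- Nothing is known about how `C` depends on the radius. Rounding up to integers lets a bounded
  -- set of data meet only finitely many values of `C`.
  refine ⟨m, fun p => C ⌈m p⌉₊, hm0, fun p => hC _, fun s hs => ?_, fun s hs => ?_, ?_⟩
  · obtain ⟨K, hK⟩ := hmb s hs
    refine (Metric.isBounded_Icc 0 K).subset ?_
    rintro _ ⟨p, hp, rfl⟩
    exact ⟨hm0 p, hK p hp⟩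
  · obtain ⟨K, hK⟩ := hmb s hs
    refine ((finite_Iic ⌈K⌉₊).image C).isBounded.subset ?_
    rintro _ ⟨p, hp, rfl⟩
    exact mem_image_of_mem C (Nat.ceil_mono (hK p hp))
  · intro ℓ z₀ ξ₀ σ hξ₀ hσ
    have h1 := he (z₀, ℓ)
    have h2 : 0 ≤ 4 / α * S.shiftedEnergy α (z₀, ℓ) := by positivity
    exact hsol _ ℓ z₀ ξ₀ σ _ (Nat.le_ceil _) (by rw [hm]; linarith) (by rw [hm]; linarith) hξ₀ hσ

end ViscousSystem

/-! ### Velocities and the representative of the energy derivative in `V*` -/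

/-- A locally integrable function on the half line is determined by its primitive. -/
theorem ae_eq_of_forall_integral_eq {E : Type*} [NormedAddCommGroup E] [NormedSpace ℝ E]
    [CompleteSpace E] {f g : ℝ → E} (hf : ∀ T, 0 ≤ T → IntervalIntegrable f volume 0 T)
    (hg : ∀ T, 0 ≤ T → IntervalIntegrable g volume 0 T)
    (h : ∀ T, 0 ≤ T → ∫ t in (0 : ℝ)..T, f t = ∫ t in (0 : ℝ)..T, g t) :
    f =ᵐ[volume.restrict (Ioi 0)] g := by
  refine (ae_restrict_iff' measurableSet_Ioi).2 ?_
  have h1 : ∀ᵐ t : ℝ, ∀ N : ℕ, t ∈ uIcc 0 (N : ℝ) →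
      HasDerivAt (fun t => ∫ s in (0 : ℝ)..t, f s) (f t) t ∧
      HasDerivAt (fun t => ∫ s in (0 : ℝ)..t, g s) (g t) t := ae_all_iff.2 fun N => by
    filter_upwards [(hf N N.cast_nonneg).ae_hasDerivAt_integral,
      (hg N N.cast_nonneg).ae_hasDerivAt_integral] with t hft hgt ht
    exact ⟨hft ht 0 left_mem_uIcc, hgt ht 0 left_mem_uIcc⟩
  filter_upwards [h1] with t ht ht0
  obtain ⟨N, hN⟩ := exists_nat_ge t
  obtain ⟨d1, d2⟩ := ht N (by rw [uIcc_of_le N.cast_nonneg]; exact ⟨ht0.le, hN⟩)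
  refine d1.unique (d2.congr_of_eventuallyEq ?_)
  filter_upwards [Ioi_mem_nhds ht0] with s hs using h s hs.le

namespace ViscousSystem

variable {Z V X : Type*}
  [NormedAddCommGroup Z] [InnerProductSpace ℝ Z]
  [NormedAddCommGroup V] [InnerProductSpace ℝ V]
  [NormedAddCommGroup X] [NormedSpace ℝ X]

theorem IsSolution.ae_eq_velocity [CompleteSpace V] {S : ViscousSystem Z V X}
    {ℓ : StrongDual ℝ V} {z₀ : Z} {z₁ z₂ : ℝ → Z} {v₁ v₂ : ℝ → V}
    (h₁ : S.IsSolution ℓ z₀ z₁ v₁) (h₂ : S.IsSolution ℓ z₀ z₂ v₂) :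
    v₁ =ᵐ[volume.restrict (Ioi 0)] v₂ := by
  refine ae_eq_of_forall_integral_eq (fun _ hT => h₁.intervalIntegrable hT)
    (fun _ hT => h₂.intervalIntegrable hT) fun T hT => ?_
  have h := h₁.primitive T hT
  rw [h₁.eqOn h₂ hT, h₁.initial, h₂.primitive T hT, h₂.initial] at h
  exact (add_left_cancel h).symm

/-- The inclusion expresses `DI(z)` as `ℓ - η - 𝕍 v`. Since `0` and `η` both lie in `∂R(0)`, the
diameter bounds the norm of `η`. -/
theorem Inclusion.exists_represents {S : ViscousSystem Z V X} {ℓ : StrongDual ℝ V} {z : Z} {v : V}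
    (h : S.Inclusion ℓ z v) : ∃ ξ, S.Represents ξ (S.DI z) ∧
      ‖ξ‖ ≤ Metric.diam (S.subdiff 0) + ‖ℓ‖ + ‖S.visc‖ * ‖v‖ := by
  obtain ⟨η, hη, e⟩ := h
  refine ⟨ℓ - η - S.visc v, fun w => ?_, ?_⟩
  · have := e w
    simp only [sub_apply]
    linarith
  · have h1 := Metric.dist_le_diam_of_mem S.isBounded_subdiff_zero
      (S.subdiff_subset_subdiff_zero v hη) S.zero_mem_subdiff_zero
    rw [dist_zero_right] at h1
    calc ‖ℓ - η - S.visc v‖ ≤ ‖ℓ‖ + ‖η‖ + ‖S.visc v‖ :=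
          (norm_sub_le _ _).trans (add_le_add_left (norm_sub_le _ _) _)
      _ ≤ _ := by linarith [S.visc.le_opNorm v]

theorem aestronglyMeasurable_of_represents [CompleteSpace Z] [TopologicalSpace.SeparableSpace Z]
    [CompleteSpace V] [TopologicalSpace.SeparableSpace V] (S : ViscousSystem Z V X)
    {α : Type*} [MeasurableSpace α] {μ : Measure α} {ξ : α → StrongDual ℝ V}
    {ζ : α → StrongDual ℝ Z} (hζ : AEStronglyMeasurable ζ μ)
    (h : ∀ᵐ t ∂μ, S.Represents (ξ t) (ζ t)) : AEStronglyMeasurable ξ μ := by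
  have hsep : TopologicalSpace.SeparableSpace (StrongDual ℝ V) :=
    (InnerProductSpace.toDual ℝ V).surjective.denseRange.separableSpace
      (InnerProductSpace.toDual ℝ V).continuous
  borelize (StrongDual ℝ V) (StrongDual ℝ Z)
  -- The restriction `V* → Z*` is continuous and injective between Polish spaces, so by the
  -- Lusin–Souslin theorem measurability in `Z*` lifts to `V*`.
  have hT : MeasurableEmbedding fun ξ : StrongDual ℝ V => ξ.comp S.ι := by
    refine Continuous.measurableEmbedding (continuous_id.clm_comp continuous_const) ?_
    intro ξ₁ ξ₂ h12
    exact Represents.unique (S := S) (ζ := ξ₁.comp S.ι) (fun _ => rfl)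
      fun w => (DFunLike.congr_fun h12 w).symm
  rw [aestronglyMeasurable_iff_aemeasurable, ← hT.aemeasurable_comp_iff]
  refine hζ.aemeasurable.congr ?_
  filter_upwards [h] with t ht
  ext w
  exact (ht w).symm

end ViscousSystem

/-! ### The main theorem -/

theorem mainTheorem4 {Z V X : Type*}
    [NormedAddCommGroup Z] [InnerProductSpace ℝ Z] [CompleteSpace Z]
    [TopologicalSpace.SeparableSpace Z]
    [NormedAddCommGroup V] [InnerProductSpace ℝ V] [CompleteSpace V]
    [TopologicalSpace.SeparableSpace V]
    [NormedAddCommGroup X] [NormedSpace ℝ X] [CompleteSpace X]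
    (S : ViscousSystem Z V X) :
    -- uniqueness
    (∀ (ℓ : StrongDual ℝ V) (z₀ : Z) (z₁ z₂ : ℝ → Z) (v₁ v₂ : ℝ → V),
      S.IsSolution ℓ z₀ z₁ v₁ → S.IsSolution ℓ z₀ z₂ v₂ → EqOn z₁ z₂ (Ici 0)) ∧
    -- existence and regularity
    (∀ (ℓ : StrongDual ℝ V) (z₀ : Z), (∃ ξ₀, S.Represents ξ₀ (S.DI z₀)) →
      ∃ (z : ℝ → Z) (v : ℝ → V),
        S.IsSolution ℓ z₀ z v ∧ MemLp v 2 (volume.restrict (Ioi 0)) ∧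
        (∀ (z' : ℝ → Z) (v' : ℝ → V),
          S.IsSolution ℓ z₀ z' v' → MemLp v' 2 (volume.restrict (Ioi 0)) →
          EqOn z' z (Ici 0)) ∧
        MemLp (fun t => S.ι (z t)) ∞ (volume.restrict (Ioi 0)) ∧
        MemLp v ∞ (volume.restrict (Ioi 0)) ∧
        eVariationOn z (Ici 0) < ∞ ∧
        ∃ ξ : ℝ → StrongDual ℝ V, MemLp ξ ∞ (volume.restrict (Ioi 0)) ∧
          ∀ᵐ t ∂(volume.restrict (Ioi (0 : ℝ))), S.Represents (ξ t) (S.DI (z t))) ∧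
    -- uniform estimates
    (∃ m₁ m₂ : Z × StrongDual ℝ V → ℝ,
      (∀ p, 0 ≤ m₁ p) ∧ (∀ p, 0 ≤ m₂ p) ∧
      MapsBoundedToBounded m₁ ∧ MapsBoundedToBounded m₂ ∧
      ∀ (ℓ : StrongDual ℝ V) (z₀ : Z) (ξ₀ : StrongDual ℝ V), S.Represents ξ₀ (S.DI z₀) →
      ∀ (z : ℝ → Z) (v : ℝ → V), S.IsSolution ℓ z₀ z v →
        eLpNorm z ∞ (volume.restrict (Ioi 0)) ≤ ENNReal.ofReal (m₁ (z₀, ℓ)) ∧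
        eLpNorm v ∞ (volume.restrict (Ioi 0)) + eVariationOn z (Ici 0) ≤
          ENNReal.ofReal (m₂ (z₀, ℓ) * (S.dist (-ξ₀ + ℓ) + m₁ (z₀, ℓ))) ∧
        ∀ ξ : ℝ → StrongDual ℝ V,
          (∀ᵐ t ∂(volume.restrict (Ioi (0 : ℝ))), S.Represents (ξ t) (S.DI (z t))) →
          eLpNorm ξ ∞ (volume.restrict (Ioi 0)) ≤
            ENNReal.ofReal (Metric.diam (S.subdiff 0)) + ENNReal.ofReal ‖ℓ‖ +
              ENNReal.ofReal ‖S.visc‖ * eLpNorm v ∞ (volume.restrict (Ioi 0))) := by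
  obtain ⟨m₁, m₂, hm₁, hm₂, hb₁, hb₂, hsol⟩ := S.exists_isSolution_bounds
  refine ⟨fun ℓ z₀ z₁ z₂ v₁ v₂ h₁ h₂ => h₁.eqOn h₂, ?_,
    m₁, m₂, hm₁, fun p => (hm₂ p).le, hb₁, hb₂, ?_⟩
  · rintro ℓ z₀ ⟨ξ₀, hξ₀⟩
    obtain ⟨z, v, b, w, h, hz, hb, hvb, hvi, hw, hvar, -⟩ :=
      hsol ℓ z₀ ξ₀ 0 hξ₀ S.zero_mem_subdiff_zero
    have hvtop : MemLp v ∞ (volume.restrict (Ioi 0)) :=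
      memLp_top_of_bound hvi.aestronglyMeasurable b hvb
    refine ⟨z, v, h, ?_, fun z' v' h' _ => h'.eqOn h, S.ι.comp_memLp' h.memLp, hvtop,
      hvar.trans_lt ENNReal.ofReal_lt_top, ?_⟩
    -- Square integrability on the half line follows from `‖v‖² ≤ b ‖v‖` with `v` integrable.
    · rw [memLp_two_iff_integrable_sq_norm hvi.aestronglyMeasurable]
      refine (hvi.norm.const_mul b).mono' (hvi.aestronglyMeasurable.norm.pow 2) ?_
      filter_upwards [hvb] with t ht
      rw [Real.norm_of_nonneg (by positivity), sq]
      gcongr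
    · choose! ξ hξ hξn using fun (t : ℝ) (ht : S.Inclusion ℓ (z t) (v t)) => ht.exists_represents
      have hrep : ∀ᵐ t ∂(volume.restrict (Ioi (0 : ℝ))), S.Represents (ξ t) (S.DI (z t)) :=
        h.inclusion.mono hξ
      refine ⟨ξ, memLp_top_of_bound (S.aestronglyMeasurable_of_represents
        (S.continuous_DI.comp_aestronglyMeasurable h.memLp.1) hrep)
        (Metric.diam (S.subdiff 0) + ‖ℓ‖ + ‖S.visc‖ * b) ?_, hrep⟩
      filter_upwards [h.inclusion, hvb] with t ht hvt
      refine (hξn t ht).trans ?_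
      gcongr
  · intro ℓ z₀ ξ₀ hξ₀ z v h
    -- Each `σ` may produce its own constructed solution; uniqueness identifies them all with the
    -- given one, so its bounds hold for every `σ` at once.
    have hbound : ∀ σ ∈ S.subdiff 0, (∀ t, 0 ≤ t → ‖z t‖ ≤ m₁ (z₀, ℓ)) ∧
        eLpNorm v ∞ (volume.restrict (Ioi 0)) + eVariationOn z (Ici 0) ≤
          ENNReal.ofReal (m₂ (z₀, ℓ) * (S.dualNorm (-ξ₀ + ℓ - σ) + m₁ (z₀, ℓ))) := by
      intro σ hσ
      obtain ⟨z', v', b, w, h', hz, hb, hvb, -, hw, hvar, hle⟩ := hsol ℓ z₀ ξ₀ σ hξ₀ hσ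
      have hzz := h.eqOn h'
      refine ⟨fun t ht => hzz ht ▸ hz t ht, ?_⟩
      rw [eVariationOn.congr hzz, eLpNorm_congr_ae (h.ae_eq_velocity h')]
      refine (add_le_add (eLpNormEssSup_le_of_ae_bound hvb) hvar).trans ?_
      rw [← ENNReal.ofReal_add hb hw]
      exact ENNReal.ofReal_le_ofReal hle
    have hdual : ∀ ξ, 0 ≤ S.dualNorm ξ := fun ξ => Real.sqrt_nonneg _
    have hdist : 0 ≤ S.dist (-ξ₀ + ℓ) := Real.sInf_nonneg (by
      rintro _ ⟨σ, -, rfl⟩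
      exact hdual _)
    refine ⟨?_, ?_, fun ξ hξ => ?_⟩
    · refine eLpNormEssSup_le_of_ae_bound ?_
      filter_upwards [ae_restrict_mem measurableSet_Ioi] with t ht
      exact (hbound 0 S.zero_mem_subdiff_zero).1 t ht.le
    · have hfin := ((hbound 0 S.zero_mem_subdiff_zero).2.trans_lt ENNReal.ofReal_lt_top).ne
      have hp := hm₂ (z₀, ℓ)
      -- Solving for the distance, which needs `m₂ > 0`, reduces the claim to a lower bound for the
      -- infimum over `σ`; it need not be attained.
      rw [ENNReal.le_ofReal_iff_toReal_le hfin (mul_nonneg hp.le (add_nonneg hdist (hm₁ _))),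
        ← div_le_iff₀' hp, ← sub_le_iff_le_add]
      refine le_csInf (Nonempty.image _ ⟨0, S.zero_mem_subdiff_zero⟩) ?_
      rintro _ ⟨σ, hσ, rfl⟩
      rw [sub_le_iff_le_add, div_le_iff₀' hp]
      exact (ENNReal.le_ofReal_iff_toReal_le hfin
        (mul_nonneg hp.le (add_nonneg (hdual _) (hm₁ _)))).1 (hbound σ hσ).2
    · refine eLpNormEssSup_le_of_ae_enorm_bound ?_
      filter_upwards [h.inclusion, hξ, ae_le_eLpNormEssSup (f := v)] with t ht hξt hvt
      obtain ⟨ξ', hξ', hle⟩ := ht.exists_represents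
      rw [hξt.unique hξ', ← ofReal_norm]
      refine (ENNReal.ofReal_le_ofReal hle).trans ?_
      rw [ENNReal.ofReal_add (by positivity) (by positivity),
        ENNReal.ofReal_add Metric.diam_nonneg (norm_nonneg _),
        ENNReal.ofReal_mul (norm_nonneg S.visc), ofReal_norm (v t)]
      gcongr
      exact hvt
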